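/- Let $I$ be a finite set and $\Omega=(\Omega_{ij})_{i,j\in I}$ an integer matrix with $\Omega_{ii}>0$, with $\Omega_{ij}\le 0$ and $(\Omega_{ij}+\Omega_{ji})/\Omega_{ii}\in\mathbb Z_{\le 0}$ for $i\ne j$, and with $\gcd\{\Omega_{ii}\}=1$. Let $\langle\cdot,\cdot\rangle$ be the bilinear form on $\mathbb Z[I]$ with $\langle i,j\rangle=\Omega_{ij}$, and put $\mu\cdot\nu=\langle\mu,\nu\rangle+\langle\nu,\mu\rangle$, $v_i=v^{i\cdot i/2}$, $t_i=t^{i\cdot i/2}$, $v_\mu=\prod_i v_i^{\mu_i}$ for $\mu\in\mathbb Z[I]$, $\operatorname{tr}\mu=\sum_i\mu_i$, and $\{i,j\}=v^{i\cdot j}t^{\langle j,i\rangle-\langle i,j\rangle}$. Let $\mathbf U$ be the two-parameter quantum algebra over $\mathbb Q(v,t)$: it is generated by $E_i,F_i,K_i^{\pm1},K_i'^{\pm1}$ ($i\in I$), where $K_i^{\pm1}$ and $K_i'^{\pm 1}$ are mutually inverse and all the $K_i,K'_j$ commute, subject to $K_iE_jK_i^{-1}=v^{i\cdot j}t^{\langle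 j,i\rangle-\langle i,j\rangle}E_j$, $K'_iE_jK_i'^{-1}=v^{-i\cdot j}t^{\langle j,i\rangle-\langle i,j\rangle}E_j$, $K'_iF_jK_i'^{-1}=v^{i\cdot j}t^{\langle i,j\rangle-\langle j,i\rangle}F_j$, $K_iF_jK_i^{-1}=v^{-i\cdot j}t^{\langle i,j\rangle-\langle j,i\rangle}F_j$, $E_iF_j-F_jE_i=\delta_{ij}(K_i-K'_i)/(v_i-v_i^{-1})$, and, for $i\ne j$, the quantum Serre relations $$\sum_{p+p'=1-2\frac{i\cdot j}{i\cdot i}}(-1)^p\,t_i^{-p\left(p'-2\frac{\langle i,j\rangle}{i\cdot i}+2\frac{\langle j,i\rangle}{i\cdot i}\right)}E_i^{(p)}E_jE_i^{(p')}=0,\qquad \sum_{p+p'=1-2\frac{i\cdot j}{i\cdot i}}(-1)^p\,t_i^{-p\left(p'-2\frac{\langle i,j\rangle}{i\cdot i}+2\frac{\langle j,i\rangle}{i\cdot i}\right)}F_i^{(p')}F_jF_i^{(p)}=0,$$ where $x_i^{(n)}=x_i^n/[n]^!_{v_i,t_i}$, $[n]_{v,t}=\frac{(vt)^n-(vt^{-1})^{-n}}{vt-(vt^{-1})^{-1}}$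 and $[n]^!_{v,t}=\prod_{k=1}^n[k]_{v,t}$. Its comultiplication satisfies $\Delta(E_i)=E_i\otimes1+K_i\otimes E_i$, $\Delta(F_i)=1\otimes F_i+F_i\otimes K'_i$, with $K_i^{\pm 1},K_i'^{\pm 1}$ group-like; its counit $\varepsilon$ sends $E_i,F_i$ to $0$ and $K_i^{\pm 1},K_i'^{\pm 1}$ to $1$. The bar involution of $\mathbf U$ is the ring endomorphism fixing $E_i$, $F_i$ and $t$, exchanging $K_i$ and $K'_i$, and sending $v$ to $v^{-1}$; $\mathbf U\otimes\mathbf U$ carries $\bar{\ }\otimes\bar{\ }$. Let $\mathbf U^+,\mathbf U^-,\mathbf U^0$ be the subalgebras generated by the $E_i$, by the $F_i$, and by the $K_i^{\pm1},K_i'^{\pm1}$; for $\nu=\sum\nu_i i\in\mathbb N[I]$ let $\mathbf U^+_\nu$ (resp. $\mathbf U^-_{-\nu}$) be the span of the monomials in the $E_i$ (resp. the $F_i$) in which each letter $i$ occurs $\nu_i$ times. Let $(\,,)_\phi:\mathbf U_{\ge0}\times\mathbf U_{\le0}\to\mathbb Q(v,t)$ be the skew-Hopf pairing between the subalgebras generated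 by the $E_i,K_i^{\pm1}$ and by the $F_i,K_i'^{\pm1}$, that is, the bilinear form with $(a,bb')_\phi=(\Delta(a),b\otimes b')_\phi$, $(aa',b)_\phi=(a\otimes a',\Delta^{op}(b))_\phi$, $(a,1)_\phi=\varepsilon(a)$, $(1,b)_\phi=\varepsilon(b)$, $(E_i,F_j)_\phi=\delta_{ij}(v_i^{-1}-v_i)^{-1}$, $(K_i,K'_j)_\phi=\{i,j\}$, $(E_i,K'_j)_\phi=(K_i,F_j)_\phi=0$. For $\nu\in\mathbb N[I]$ let $\mathbf B_\nu$ be a basis of $\mathbf U^-_{-\nu}$, let $\{b^*\mid b\in\mathbf B_\nu\}$ be the basis of $\mathbf U^+_\nu$ dual to $\mathbf B_\nu$ under $(\,,)_\phi$, and put $\Theta_\nu=\sum_{b\in\mathbf B_\nu}b\otimes b^*$. Let $\sigma^+:\mathbf U^+\to\mathbf U^+$ be the linear map with $\sigma^+(E_i)=E_i$ and $\sigma^+(xy)=t^{\langle|y|,|x|\rangle-\langle|x|,|y|\rangle}\sigma^+(y)\sigma^+(x)$ for $x\in\mathbf U^+_{|x|}$, $y\in\mathbf U^+_{|y|}$.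 Then for every $\nu\in\mathbb N[I]$ $$\overline{\Theta_\nu}=(-1)^{\operatorname{tr}\nu}\,v^{\frac{\nu\cdot\nu}{2}}\,v_{-\nu}\sum_{b\in\mathbf B_\nu}b\otimes\sigma^+(b^*)\ \in\ \mathbf U^-_{-\nu}\otimes\mathbf U^+_\nu .$$ Moreover, let $(\mathbf U\otimes\mathbf U)^\wedge$ be the completion of $\mathbf U\otimes\mathbf U$ with respect to the subspaces $$\mathcal H_N=\Big(\mathbf U^+\mathbf U^0\sum_{\operatorname{tr}\nu\ge N}\mathbf U^-_{-\nu}\Big)\otimes\mathbf U+\mathbf U\otimes\Big(\mathbf U^-\mathbf U^0\sum_{\operatorname{tr}\nu\ge N}\mathbf U^+_{\nu}\Big),$$ with the bar map induced from $\mathbf U\otimes\mathbf U$. Then the bar image of the quasi-$\mathcal R$-matrix $\Theta=\sum_\nu\Theta_\nu\in(\mathbf U\otimes\mathbf U)^\wedge$ is $$\overline\Theta=\sum_{\nu\in\mathbb N[I]}(-1)^{\operatorname{tr}\nu}\,v^{\frac{\nu\cdot\nu}{2}}\,v_{-\nu}\sum_{b\in\mathbf B_\nu}b\otimes\sigma^+(b^*).$$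 -/

import Mathlib

namespace TwoParam

section QCommutators

variable {k R : Type*} [Field k] [Ring R] [Algebra k R]

/-- `1 + Q + ⋯ + Q ^ (n - 1)`. -/
def geom (Q : k) (n : ℕ) : k := ∑ j ∈ Finset.range n, Q ^ j

/-- `geom Q 1 * ⋯ * geom Q n`. -/
def geomFact (Q : k) (n : ℕ) : k := ∏ j ∈ Finset.range n, geom Q (j + 1)

/-- Iterated `q`-commutators of `e` with `g`. -/
def qcomm (q : ℕ → k) (e g : R) : ℕ → R
  | 0 => g
  | n + 1 => e * qcomm q e g n - q n • (qcomm q e g n * e)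

/-- First-order variation of `qcomm` along `e ↦ x`, `g ↦ y`. -/
def qcommVar (q : ℕ → k) (e g x y : R) : ℕ → R
  | 0 => y
  | n + 1 => e * qcommVar q e g x y n + x * qcomm q e g n
      - q n • (qcommVar q e g x y n * e + qcomm q e g n * x)

theorem geom_zero (Q : k) : geom Q 0 = 0 := by simp [geom]

theorem geom_succ (Q : k) (n : ℕ) : geom Q (n + 1) = geom Q n + Q ^ n := by
  simp [geom, Finset.sum_range_succ]

theorem geom_add (Q : k) (a b : ℕ) : geom Q (a + b) = geom Q a + Q ^ a * geom Q b := by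
  induction b with
  | zero => simp [geom_zero]
  | succ b ih => rw [← add_assoc, geom_succ, ih, geom_succ, pow_add]; ring

theorem geomFact_succ (Q : k) (n : ℕ) : geomFact Q (n + 1) = geomFact Q n * geom Q (n + 1) := by
  simp [geomFact, Finset.prod_range_succ]

theorem geomFact_ne {Q : k} (hQ : ∀ n, geom Q (n + 1) ≠ 0) (n : ℕ) : geomFact Q n ≠ 0 :=
  Finset.prod_ne_zero_iff.2 fun _ _ => hQ _

theorem geom_mul_inv {Q : k} (hQ : ∀ n, geom Q (n + 1) ≠ 0) (n : ℕ) :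
    geom Q (n + 1) * (geomFact Q (n + 1))⁻¹ = (geomFact Q n)⁻¹ := by
  have := hQ n
  have := geomFact_ne hQ n
  rw [geomFact_succ]; field_simp

/-- The `q`-binomial expansion of an iterated `q`-commutator. -/
theorem qcomm_expand {Q α : k} (hQ : ∀ n, geom Q (n + 1) ≠ 0) (w : ℕ → k) (hw0 : w 0 = 1)
    (hw : ∀ p, geom Q (p + 1) * w (p + 1) = -(α * Q ^ p * w p)) (e g : R) (n : ℕ) :
    qcomm (fun n => α * Q ^ n) e g n = geomFact Q n •
      ∑ x ∈ Finset.HasAntidiagonal.antidiagonal n,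
        ((geomFact Q x.1)⁻¹ * w x.2) • (e ^ x.1 * g * e ^ x.2) := by
  induction n with
  | zero => simp [qcomm, geomFact, hw0]
  | succ n ih =>
    rw [qcomm, ih, geomFact_succ, mul_smul_comm, smul_mul_assoc, smul_comm (α * Q ^ n),
      ← smul_sub, mul_smul (geomFact Q n)]
    congr 1
    have key : geom Q (n + 1) • ∑ x ∈ Finset.HasAntidiagonal.antidiagonal (n + 1),
        ((geomFact Q x.1)⁻¹ * w x.2) • (e ^ x.1 * g * e ^ x.2)
      = (∑ x ∈ Finset.HasAntidiagonal.antidiagonal (n + 1),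
        (geom Q x.1 * (geomFact Q x.1)⁻¹ * w x.2) • (e ^ x.1 * g * e ^ x.2))
       + ∑ x ∈ Finset.HasAntidiagonal.antidiagonal (n + 1),
        (Q ^ x.1 * (geomFact Q x.1)⁻¹ * (geom Q x.2 * w x.2)) • (e ^ x.1 * g * e ^ x.2) := by
      rw [Finset.smul_sum, ← Finset.sum_add_distrib]
      refine Finset.sum_congr rfl fun x hx => ?_
      rw [← Finset.HasAntidiagonal.mem_antidiagonal.1 hx, geom_add, smul_smul, ← add_smul]
      congr 1; ring
    rw [key, Finset.Nat.sum_antidiagonal_succ, Finset.Nat.sum_antidiagonal_succ']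
    simp only [geom_zero, zero_mul, mul_zero, zero_smul, zero_add, sub_eq_add_neg]
    congr 1
    · rw [Finset.mul_sum]
      refine Finset.sum_congr rfl fun x _ => ?_
      rw [geom_mul_inv hQ, mul_smul_comm, pow_succ']
      simp only [mul_assoc]
    · rw [Finset.sum_mul, Finset.smul_sum, ← Finset.sum_neg_distrib]
      refine Finset.sum_congr rfl fun x hx => ?_
      rw [hw, smul_mul_assoc, smul_smul, ← neg_smul, pow_succ, ← Finset.HasAntidiagonal.mem_antidiagonal.1 hx,
        pow_add]
      simp only [mul_assoc]
      congr 1; ring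

theorem qcomm_comm_left {Q α : k} (q : ℕ → k) {e g Y : R} (hYe : Y * e = Q • (e * Y))
    (hYg : Y * g = α • (g * Y)) (n : ℕ) :
    Y * qcomm q e g n = (α * Q ^ n) • (qcomm q e g n * Y) := by
  induction n with
  | zero => simp [qcomm, hYg]
  | succ n ih =>
    have h1 : Y * (e * qcomm q e g n) = (α * Q ^ (n + 1)) • (e * qcomm q e g n * Y) := by
      rw [← mul_assoc, hYe, smul_mul_assoc, mul_assoc, ih, mul_smul_comm, smul_smul, mul_assoc]
      congr 1; ring
    have h2 : Y * (qcomm q e g n * e) = (α * Q ^ (n + 1)) • (qcomm q e g n * e * Y) := by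
      rw [← mul_assoc, ih, smul_mul_assoc, mul_assoc, hYe, mul_smul_comm, smul_smul, ← mul_assoc (qcomm q e g n)]
      congr 1; ring
    rw [qcomm, mul_sub, mul_smul_comm, h1, h2, sub_mul, smul_sub, smul_mul_assoc,
      smul_comm (q n)]

/-- The factor `(1 - z Q ^ r) ⋯ (1 - z Q ^ (r + s - 1))`. -/
def serreProd (z Q : k) (s r : ℕ) : k := ∏ j ∈ Finset.range s, (1 - z * Q ^ (r + j))

theorem serreProd_succ (z Q : k) (s r : ℕ) :
    serreProd z Q (s + 1) r = serreProd z Q s r * (1 - z * Q ^ (r + s)) := by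
  simp [serreProd, Finset.prod_range_succ]

theorem serreProd_succ' (z Q : k) (s r : ℕ) :
    serreProd z Q (s + 1) r = serreProd z Q s (r + 1) * (1 - z * Q ^ r) := by
  simp only [serreProd, Finset.prod_range_succ', add_zero]
  congr 1
  refine Finset.prod_congr rfl fun j _ => ?_
  rw [add_assoc, add_comm 1 j]

theorem serreProd_rec (z Q : k) (s r : ℕ) :
    geom Q (s + r) * serreProd z Q s r = geom Q r * (Q ^ s * serreProd z Q s (r - 1))
      + geom Q s * ((1 - z * Q ^ (s - 1 + r + r)) * serreProd z Q (s - 1) r) := by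
  rcases s with _ | s <;> rcases r with _ | r
  · simp [geom_zero]
  · simp [geom_zero, serreProd]
  · simp only [geom_zero, serreProd_succ, Nat.add_sub_cancel]
    simp only [zero_mul, zero_add, add_zero]; ring
  · simp only [Nat.add_sub_cancel]
    rw [serreProd_succ' z Q s r, serreProd_succ z Q s (r + 1)]
    have h1 := geom_add Q (s + 1) (r + 1)
    have h2 := geom_add Q (r + 1) (s + 1)
    rw [add_comm (r + 1)] at h2
    have e1 : (1 - z * Q ^ (r + 1 + s)) * geom Q (s + 1 + (r + 1)) =
        geom Q (r + 1) * (Q ^ (s + 1) * (1 - z * Q ^ r))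
          + geom Q (s + 1) * (1 - z * Q ^ (s + (r + 1) + (r + 1))) := by
      rw [sub_mul, one_mul]
      nth_rewrite 1 [h1]
      rw [h2]; ring
    linear_combination serreProd z Q s (r + 1) * e1

/-- Additivity of the extremal iterated `q`-commutator on `q`-commuting pairs. -/
theorem qcomm_add_aux {Q α β : k} (hQ : ∀ n, geom Q (n + 1) ≠ 0) {X Y A B : R}
    (hYX : Y * X = Q • (X * Y)) (hYA : Y * A = α • (A * Y)) (hBX : B * X = β • (X * B)) (n : ℕ) :
    qcomm (fun n => α * Q ^ n) (X + Y) (A + B) n = qcomm (fun n => α * Q ^ n) X A n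
      + geomFact Q n • ∑ x ∈ Finset.HasAntidiagonal.antidiagonal n,
        ((geomFact Q x.1)⁻¹ * (geomFact Q x.2)⁻¹ * serreProd (α * β) Q x.1 x.2) •
          (X ^ x.1 * qcomm (fun n => α * Q ^ n) Y B x.2) := by
  have hYXs : ∀ s, Y * X ^ s = Q ^ s • (X ^ s * Y) := by
    intro s
    induction s with
    | zero => simp
    | succ s ih =>
      rw [pow_succ, ← mul_assoc, ih, smul_mul_assoc, mul_assoc, hYX, mul_smul_comm, smul_smul,
        pow_succ, mul_assoc]
  have hDX : ∀ r, qcomm (fun n => α * Q ^ n) Y B r * X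
      = (β * Q ^ r) • (X * qcomm (fun n => α * Q ^ n) Y B r) := by
    intro r
    induction r with
    | zero => simp [qcomm, hBX]
    | succ r ih =>
      set D := qcomm (fun n => α * Q ^ n) Y B r with hD
      have h1 : Y * D * X = (β * Q ^ (r + 1)) • (X * (Y * D)) := by
        rw [mul_assoc, ih, mul_smul_comm, ← mul_assoc, hYX, smul_mul_assoc, smul_smul, mul_assoc X]
        congr 1; ring
      have h2 : D * Y * X = (β * Q ^ (r + 1)) • (X * (D * Y)) := by
        rw [mul_assoc, hYX, mul_smul_comm, ← mul_assoc, ih, smul_mul_assoc, smul_smul, mul_assoc]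
        congr 1; ring
      rw [qcomm, ← hD, sub_mul, smul_mul_assoc, h1, h2, mul_sub, smul_sub, mul_smul_comm,
        smul_comm (α * Q ^ r)]
  induction n with
  | zero => simp [qcomm, geomFact, serreProd]
  | succ n ih =>
    have hX := qcomm_comm_left (fun n => α * Q ^ n) hYX hYA n
    set D := qcomm (fun n => α * Q ^ n) Y B with hD
    have hstep : ∀ s r, s + r = n → (X + Y) * (X ^ s * D r)
        - (α * Q ^ n) • ((X ^ s * D r) * (X + Y))
        = (1 - α * β * Q ^ (s + r + r)) • (X ^ (s + 1) * D r) + Q ^ s • (X ^ s * D (r + 1)) := by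
      intro s r hsr
      have e1 : X ^ s * D r * X = (β * Q ^ r) • (X ^ (s + 1) * D r) := by
        rw [mul_assoc, hDX, mul_smul_comm, ← mul_assoc, ← pow_succ]
      have e2 : Y * (X ^ s * D r) = Q ^ s • (X ^ s * (Y * D r)) := by
        rw [← mul_assoc, hYXs, smul_mul_assoc, mul_assoc]
      have e3 : D (r + 1) = Y * D r - (α * Q ^ r) • (D r * Y) := rfl
      rw [e3, add_mul, mul_add, e1, e2, ← mul_assoc X, ← pow_succ', mul_sub, smul_sub,
        mul_smul_comm, ← hsr, smul_add, smul_smul, smul_smul, sub_smul, one_smul, mul_assoc _ _ Y]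
      have e4 : α * Q ^ (s + r) * (β * Q ^ r) = α * β * Q ^ (s + r + r) := by
        simp only [pow_add]; ring
      have e5 : α * Q ^ (s + r) = Q ^ s * (α * Q ^ r) := by simp only [pow_add]; ring
      rw [e4, ← e5]; abel
    have hsum : ∀ S : R, (X + Y) * (qcomm (fun n => α * Q ^ n) X A n + geomFact Q n • S)
        - (α * Q ^ n) • ((qcomm (fun n => α * Q ^ n) X A n + geomFact Q n • S) * (X + Y))
        = qcomm (fun n => α * Q ^ n) X A (n + 1)
          + geomFact Q n • ((X + Y) * S - (α * Q ^ n) • (S * (X + Y))) := by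
      intro S
      rw [qcomm, mul_add, add_mul X Y (qcomm _ X A n), add_mul _ _ (X + Y), mul_add _ X Y, hX,
        smul_sub, mul_smul_comm, smul_mul_assoc, smul_add, smul_add,
        smul_comm (geomFact Q n) (α * Q ^ n)]
      abel
    rw [qcomm, ih, hsum, geomFact_succ, mul_smul (geomFact Q n)]
    congr 2
    have key : geom Q (n + 1) • ∑ x ∈ Finset.HasAntidiagonal.antidiagonal (n + 1),
        ((geomFact Q x.1)⁻¹ * (geomFact Q x.2)⁻¹ * serreProd (α * β) Q x.1 x.2) •
          (X ^ x.1 * D x.2)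
      = (∑ x ∈ Finset.HasAntidiagonal.antidiagonal (n + 1),
        ((geom Q x.1 * (geomFact Q x.1)⁻¹) * (geomFact Q x.2)⁻¹ *
          ((1 - α * β * Q ^ (x.1 - 1 + x.2 + x.2)) * serreProd (α * β) Q (x.1 - 1) x.2)) •
          (X ^ x.1 * D x.2))
       + ∑ x ∈ Finset.HasAntidiagonal.antidiagonal (n + 1),
        ((geomFact Q x.1)⁻¹ * (geom Q x.2 * (geomFact Q x.2)⁻¹) *
          (Q ^ x.1 * serreProd (α * β) Q x.1 (x.2 - 1))) •
          (X ^ x.1 * D x.2) := by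
      rw [Finset.smul_sum, ← Finset.sum_add_distrib]
      refine Finset.sum_congr rfl fun x hx => ?_
      rw [← Finset.HasAntidiagonal.mem_antidiagonal.1 hx, smul_smul, ← add_smul]
      congr 1
      linear_combination (geomFact Q x.1)⁻¹ * (geomFact Q x.2)⁻¹ *
        serreProd_rec (α * β) Q x.1 x.2
    rw [key, Finset.Nat.sum_antidiagonal_succ, Finset.Nat.sum_antidiagonal_succ']
    simp only [geom_zero, zero_mul, mul_zero, zero_smul, zero_add,
      geom_mul_inv hQ, Nat.add_sub_cancel]
    rw [Finset.mul_sum, Finset.sum_mul, Finset.smul_sum, ← Finset.sum_sub_distrib,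
      ← Finset.sum_add_distrib]
    refine Finset.sum_congr rfl fun x hx => ?_
    rw [mul_smul_comm, smul_mul_assoc, smul_comm (α * Q ^ n), ← smul_sub,
      hstep _ _ (Finset.HasAntidiagonal.mem_antidiagonal.1 hx), smul_add, smul_smul, smul_smul]
    congr 2 <;> ring

theorem qcomm_add {Q α β : k} (hQ : ∀ n, geom Q (n + 1) ≠ 0) {X Y A B : R}
    (hYX : Y * X = Q • (X * Y)) (hYA : Y * A = α • (A * Y)) (hBX : B * X = β • (X * B))
    {m : ℕ} (hm : α * β * Q ^ m = 1) :
    qcomm (fun n => α * Q ^ n) (X + Y) (A + B) (m + 1) =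
      qcomm (fun n => α * Q ^ n) X A (m + 1) + qcomm (fun n => α * Q ^ n) Y B (m + 1) := by
  rw [qcomm_add_aux hQ hYX hYA hBX, Finset.Nat.sum_antidiagonal_succ]
  congr 1
  rw [Finset.sum_eq_zero, add_zero]
  · have h0 : geomFact Q 0 = 1 := by simp [geomFact]
    have hs : serreProd (α * β) Q 0 (m + 1) = 1 := by simp [serreProd]
    rw [h0, hs, inv_one, one_mul, mul_one, pow_zero, one_mul, smul_smul,
      mul_inv_cancel₀ (geomFact_ne hQ _), one_smul]
  · intro x hx
    have : m = x.2 + x.1 := by rw [← Finset.HasAntidiagonal.mem_antidiagonal.1 hx, add_comm]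
    rw [serreProd_succ, ← this, hm]; simp

theorem qcommVar_commutator (q : ℕ → k) (e g f : R) (n : ℕ) :
    qcomm q e g n * f - f * qcomm q e g n
      = qcommVar q e g (e * f - f * e) (g * f - f * g) n := by
  induction n with
  | zero => rfl
  | succ n ih =>
    rw [qcommVar, ← ih, qcomm, sub_mul, mul_sub, smul_mul_assoc, mul_smul_comm, smul_add]
    simp only [mul_sub, sub_mul, smul_sub, mul_assoc]
    abel

theorem qcomm_matrix (q : ℕ → k) (e g x y : R) (n : ℕ) :
    qcomm q (!![e, x; 0, e] : Matrix (Fin 2) (Fin 2) R) !![g, y; 0, g] n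
      = !![qcomm q e g n, qcommVar q e g x y n; 0, qcomm q e g n] := by
  induction n with
  | zero => rfl
  | succ n ih =>
    rw [qcomm, ih, qcomm, qcommVar]
    ext i j
    fin_cases i <;> fin_cases j <;> simp
    abel

theorem qcommVar_zero (q : ℕ → k) (e g : R) (n : ℕ) : qcommVar q e g 0 0 n = 0 := by
  induction n with
  | zero => rfl
  | succ n ih => simp [qcommVar, ih]

theorem qcommVar_left {Q α β : k} (hQ0 : Q ≠ 0) (hβ0 : β ≠ 0) {e g a b : R}
    (hae : a * e = Q • (e * a)) (hag : a * g = α • (g * a))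
    (hbe : b * e = Q⁻¹ • (e * b)) (hbg : b * g = β⁻¹ • (g * b))
    {m : ℕ} (hm : α * β * Q ^ m = 1) :
    qcommVar (fun n => α * Q ^ n) e g (a - b) 0 (m + 1) = 0 := by
  have ha := qcomm_comm_left (fun n => α * Q ^ n) hae hag
  have hb := qcomm_comm_left (fun n => α * Q ^ n) hbe hbg
  have key : ∀ n, qcommVar (fun n => α * Q ^ n) e g (a - b) 0 (n + 1)
      = (∑ j ∈ Finset.range (n + 1), (α * Q ^ j - β⁻¹ * Q⁻¹ ^ j)) •
        (qcomm (fun n => α * Q ^ n) e g n * b) := by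
    intro n
    induction n with
    | zero =>
      simp [qcommVar, qcomm, sub_mul, mul_sub, hag, hbg, sub_smul, smul_sub]
    | succ n ih =>
      rw [qcommVar, ih, Finset.sum_range_succ _ (n + 1), add_smul]
      set c := ∑ j ∈ Finset.range (n + 1), (α * Q ^ j - β⁻¹ * Q⁻¹ ^ j)
      have h : qcomm (fun n => α * Q ^ n) e g (n + 1) * b
          = e * qcomm (fun n => α * Q ^ n) e g n * b
            - (α * Q ^ n) • (qcomm (fun n => α * Q ^ n) e g n * (e * b)) := by
        rw [qcomm, sub_mul, smul_mul_assoc, mul_assoc _ e b]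
      have e1 : α * Q ^ (n + 1) * (c * Q⁻¹) = c * (α * Q ^ n) := by
        rw [pow_succ]; field_simp
      rw [sub_mul, ha, hb, mul_sub, mul_smul_comm, smul_mul_assoc, mul_assoc _ b e, hbe,
        mul_smul_comm, ← mul_assoc e, smul_add, smul_smul c, smul_smul, e1]
      linear_combination (norm := module) (-c) • h
  have hα : α = β⁻¹ * Q⁻¹ ^ m := by
    rw [inv_pow]; field_simp; linear_combination hm
  rw [key, Finset.sum_sub_distrib, ← Finset.sum_range_reflect (fun j => β⁻¹ * Q⁻¹ ^ j),
    ← Finset.sum_sub_distrib, Finset.sum_eq_zero, zero_smul]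
  intro j hj
  obtain ⟨i, rfl⟩ : ∃ i, m = j + i := Nat.exists_eq_add_of_le (by simpa [Nat.lt_succ_iff] using hj)
  rw [hα, show j + i + 1 - 1 - j = i by omega, pow_add, inv_pow, inv_pow]
  field_simp; ring

theorem qcommVar_right {Q α β : k} (hα0 : α ≠ 0) {e g a b : R}
    (hae : a * e = β • (e * a)) (hbe : b * e = α⁻¹ • (e * b))
    {m : ℕ} (hm : α * β * Q ^ m = 1) :
    qcommVar (fun n => α * Q ^ n) e g 0 (a - b) (m + 1) = 0 := by
  have hbn : ∀ n, qcommVar (fun n => α * Q ^ n) e g 0 (a - b) (n + 1)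
      = (∏ j ∈ Finset.range (n + 1), (1 - α * β * Q ^ j)) • (e ^ (n + 1) * a) := by
    intro n
    induction n with
    | zero =>
      simp only [qcommVar, zero_mul, mul_zero, add_zero, pow_zero, mul_one, sub_mul, mul_sub, hae,
        hbe, smul_sub, smul_smul, mul_inv_cancel₀ hα0, one_smul, zero_add, Finset.range_one,
        Finset.prod_singleton, pow_one, sub_smul]
      abel
    | succ n ih =>
      have e1 : e ^ (n + 1) * a * e = β • (e ^ (n + 2) * a) := by
        rw [mul_assoc, hae, mul_smul_comm, ← mul_assoc, ← pow_succ]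
      rw [qcommVar, ih, Finset.prod_range_succ _ (n + 1), zero_mul, mul_zero, add_zero, add_zero,
        mul_smul_comm, smul_mul_assoc, e1, ← mul_assoc, ← pow_succ']
      module
  rw [hbn, Finset.prod_eq_zero (Finset.self_mem_range_succ m), zero_smul]
  rw [hm, sub_self]

end QCommutators


open scoped TensorProduct

noncomputable section

/-! ### The base field `ℚ(v, t)` and its bar involution -/

/-- The field `ℚ(v, t)`, realized as `ℚ(t)(v)`. -/
def Kvt : Type := RatFunc (RatFunc ℚ)

instance : Field Kvt := inferInstanceAs (Field (RatFunc (RatFunc ℚ)))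

instance : CommRing Kvt := inferInstance

instance : CommSemiring Kvt := inferInstance

instance : Semiring Kvt := inferInstance

/-- The indeterminate `v`. -/
def vv : Kvt := (RatFunc.X : RatFunc (RatFunc ℚ))

/-- The indeterminate `t`. -/
def tt : Kvt := (RatFunc.C RatFunc.X : RatFunc (RatFunc ℚ))

theorem vv_ne : vv ≠ 0 := RatFunc.X_ne_zero (K := RatFunc ℚ)

theorem tt_ne : tt ≠ 0 := by
  have : (RatFunc.C RatFunc.X : RatFunc (RatFunc ℚ)) ≠ 0 := by
    rw [Ne, map_eq_zero]
    exact RatFunc.X_ne_zero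
  exact this

theorem aeval_inv_injective : Function.Injective
    (Polynomial.aeval (R := RatFunc ℚ) (RatFunc.X⁻¹ : RatFunc (RatFunc ℚ))) := by
  have hX : Transcendental (RatFunc ℚ) (RatFunc.X : RatFunc (RatFunc ℚ)) := RatFunc.transcendental_X
  have : Transcendental (RatFunc ℚ) (RatFunc.X⁻¹ : RatFunc (RatFunc ℚ)) :=
    fun h => hX (by simpa using h.inv)
  exact transcendental_iff_injective.1 this

/-- The `ℚ(t)`-algebra endomorphism of `ℚ(t)(v)` with `v ↦ v⁻¹`. -/
def barRat : RatFunc (RatFunc ℚ) →+* RatFunc (RatFunc ℚ) :=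
  RatFunc.liftRingHom
    (Polynomial.aeval (R := RatFunc ℚ) (RatFunc.X⁻¹ : RatFunc (RatFunc ℚ))).toRingHom
    (nonZeroDivisors_le_comap_nonZeroDivisors_of_injective _ aeval_inv_injective)

/-- The bar involution of `ℚ(v, t)`: the `ℚ(t)`-algebra endomorphism with `v ↦ v⁻¹`. -/
def barK : Kvt →+* Kvt := barRat

theorem barK_v : barK vv = vv⁻¹ := by
  have h : barRat (algebraMap (Polynomial (RatFunc ℚ)) _ Polynomial.X)
      = Polynomial.aeval (R := RatFunc ℚ) (RatFunc.X⁻¹ : RatFunc (RatFunc ℚ)) Polynomial.X :=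
    RatFunc.liftRingHom_algebraMap _ _ _
  rw [RatFunc.algebraMap_X, Polynomial.aeval_X] at h
  exact h

theorem barK_t : barK tt = tt := by
  have h : barRat (algebraMap (Polynomial (RatFunc ℚ)) _ (Polynomial.C RatFunc.X))
      = Polynomial.aeval (R := RatFunc ℚ) (RatFunc.X⁻¹ : RatFunc (RatFunc ℚ))
        (Polynomial.C RatFunc.X) :=
    RatFunc.liftRingHom_algebraMap _ _ _
  rw [RatFunc.algebraMap_C, Polynomial.aeval_C] at h
  exact h

theorem vv_pow_ne_one {n : ℕ} (hn : n ≠ 0) : vv ^ n ≠ 1 := by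
  have h : (RatFunc.X : RatFunc (RatFunc ℚ)) ^ n ≠ 1 := by
    intro h
    have : Transcendental (RatFunc ℚ) (RatFunc.X : RatFunc (RatFunc ℚ)) := RatFunc.transcendental_X
    refine this ⟨Polynomial.X ^ n - 1, ?_, by simp [h]⟩
    exact Polynomial.X_pow_sub_C_ne_zero (Nat.pos_of_ne_zero hn) 1
  exact h

theorem vv_zpow_ne_one {n : ℤ} (hn : n ≠ 0) : vv ^ n ≠ 1 := by
  rcases Int.natAbs_eq n with h | h
  · rw [h, zpow_natCast]; exact vv_pow_ne_one (by omega)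
  · rw [h, zpow_neg, zpow_natCast, Ne, inv_eq_one]; exact vv_pow_ne_one (by omega)

/-- The quantum integer `[n]_{x,y} = ((xy)^n - (xy⁻¹)^{-n}) / (xy - (xy⁻¹)^{-1})`. -/
def qInt (x y : Kvt) (n : ℕ) : Kvt :=
  ((x * y) ^ n - ((x * y⁻¹) ^ n)⁻¹) / (x * y - (x * y⁻¹)⁻¹)

/-- The quantum factorial `[n]^!_{x,y}`. -/
def qFact (x y : Kvt) (n : ℕ) : Kvt := ∏ j ∈ Finset.range n, qInt x y (j + 1)

theorem barK_qInt (a : ℤ) (n : ℕ) :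
    barK (qInt (vv ^ a) (tt ^ a) n) = qInt (vv ^ a) (tt ^ a) n := by
  simp only [qInt, map_div₀, map_sub, map_mul, map_pow, map_inv₀, map_zpow₀, barK_v, barK_t]
  rw [← neg_div_neg_eq]
  have e1 : (vv⁻¹ ^ a * tt ^ a) = (vv ^ a * (tt ^ a)⁻¹)⁻¹ := by
    rw [mul_inv, inv_inv, inv_zpow]
  have e2 : (vv⁻¹ ^ a * (tt ^ a)⁻¹) = (vv ^ a * tt ^ a)⁻¹ := by
    rw [mul_inv, inv_zpow]
  rw [e1, e2]
  simp only [inv_pow, inv_inv, neg_sub]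

theorem barK_qFact (a : ℤ) (n : ℕ) :
    barK (qFact (vv ^ a) (tt ^ a) n) = qFact (vv ^ a) (tt ^ a) n := by
  simp only [qFact, map_prod, barK_qInt]

theorem geom_ne {a : ℤ} (ha : 0 < a) (n : ℕ) : geom (vv ^ (2 * a)) (n + 1) ≠ 0 := by
  intro h
  have h1 : geom (vv ^ (2 * a)) (n + 1) * (vv ^ (2 * a) - 1) = (vv ^ (2 * a)) ^ (n + 1) - 1 :=
    geom_sum_mul _ _
  rw [h, zero_mul] at h1
  refine vv_zpow_ne_one (n := 2 * a * ((n + 1 : ℕ) : ℤ)) ?_ ?_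
  · positivity
  · rw [zpow_mul, zpow_natCast]; linear_combination -h1

theorem qInt_eq {a : ℤ} (ha : 0 < a) (n : ℕ) :
    qInt (vv ^ a) (tt ^ a) (n + 1) = (tt ^ a * (vv ^ a)⁻¹) ^ n * geom (vv ^ (2 * a)) (n + 1) := by
  have hv := zpow_ne_zero a vv_ne
  have ht := zpow_ne_zero a tt_ne
  have h2 : vv ^ (2 * a) = vv ^ a * vv ^ a := by rw [two_mul, zpow_add₀ vv_ne]
  have h3 : vv ^ a * vv ^ a - 1 ≠ 0 := by
    rw [← h2, sub_ne_zero]; exact vv_zpow_ne_one (by omega)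
  have h1 : geom (vv ^ (2 * a)) (n + 1) * (vv ^ (2 * a) - 1) = (vv ^ (2 * a)) ^ (n + 1) - 1 :=
    geom_sum_mul _ _
  rw [h2] at *
  generalize geom (vv ^ a * vv ^ a) (n + 1) = G at *
  generalize vv ^ a = x at *
  generalize tt ^ a = y at *
  have h4 : x * y - (x * y⁻¹)⁻¹ = y * x⁻¹ * (x * x - 1) := by field_simp
  have h5 : x * y - (x * y⁻¹)⁻¹ ≠ 0 := by
    rw [h4]; exact mul_ne_zero (mul_ne_zero ht (inv_ne_zero hv)) h3
  rw [qInt, div_eq_iff h5, h4]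
  have h6 : ((x * y⁻¹) ^ (n + 1))⁻¹ = (y * x⁻¹) ^ (n + 1) := by
    rw [← inv_pow]; congr 1; field_simp
  have h7 : (x * y) ^ (n + 1) = (y * x⁻¹) ^ (n + 1) * (x * x) ^ (n + 1) := by
    rw [← mul_pow]; congr 1; field_simp
  rw [h6, h7, pow_succ (y * x⁻¹)]
  linear_combination -((y * x⁻¹) ^ n * (y * x⁻¹)) * h1

theorem qFact_eq {a : ℤ} (ha : 0 < a) (n : ℕ) :
    qFact (vv ^ a) (tt ^ a) n
      = (tt ^ a * (vv ^ a)⁻¹) ^ (∑ j ∈ Finset.range n, j) * geomFact (vv ^ (2 * a)) n := by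
  simp only [qFact, geomFact, qInt_eq ha, Finset.prod_mul_distrib]
  rw [Finset.prod_pow_eq_pow_sum (Finset.range n) (fun j => j)]

/-! ### The datum `Ω` -/

/-- An integer matrix `Ω` on a finite index set `I` with positive diagonal, nonpositive off-diagonal entries,
integral quotients `(Ω i j + Ω j i) / Ω i i ≤ 0` for `i ≠ j`, and diagonal entries without common
divisor. -/
structure Datum (I : Type*) [Fintype I] where
  /-- the matrix -/
  Ω : I → I → ℤ
  diag_pos : ∀ i, 0 < Ω i i
  offdiag_nonpos : ∀ i j, i ≠ j → Ω i j ≤ 0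
  quot_nonpos : ∀ i j, i ≠ j → ∃ a : ℤ, a ≤ 0 ∧ Ω i j + Ω j i = a * Ω i i
  gcd_diag : Finset.univ.gcd (fun i => Ω i i) = 1

variable {I : Type*} [Fintype I]

namespace Datum

/-- The transposed datum. -/
def transpose (D : Datum I) : Datum I where
  Ω i j := D.Ω j i
  diag_pos := D.diag_pos
  offdiag_nonpos i j h := D.offdiag_nonpos j i h.symm
  quot_nonpos i j h := by
    obtain ⟨a, ha, h2⟩ := D.quot_nonpos i j h
    exact ⟨a, ha, by rw [← h2, add_comm]⟩
  gcd_diag := D.gcd_diag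

/-- The bilinear form `⟨μ, ν⟩` on `ℤ[I]`, with `⟨i, j⟩ = Ω i j`. -/
def ang (D : Datum I) (μ ν : I → ℤ) : ℤ := ∑ i, ∑ j, μ i * ν j * D.Ω i j

/-- The symmetric form `μ · ν = ⟨μ, ν⟩ + ⟨ν, μ⟩`. -/
def dot (D : Datum I) (μ ν : I → ℤ) : ℤ := D.ang μ ν + D.ang ν μ

/-- `i · j` for `i, j ∈ I`. -/
def dotI (D : Datum I) (i j : I) : ℤ := D.Ω i j + D.Ω j i

/-- `v_i = v ^ (i · i / 2)`. -/
def vi (D : Datum I) (i : I) : Kvt := vv ^ (D.dotI i i / 2)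

/-- `t_i = t ^ (i · i / 2)`. -/
def ti (D : Datum I) (i : I) : Kvt := tt ^ (D.dotI i i / 2)

/-- `{i, j} = v ^ (i · j) * t ^ (⟨j, i⟩ - ⟨i, j⟩)`. -/
def chi (D : Datum I) (i j : I) : Kvt := vv ^ D.dotI i j * tt ^ (D.Ω j i - D.Ω i j)

/-- The number `1 - 2 (i · j) / (i · i)` for `i ≠ j`. -/
def serreNum (D : Datum I) (i j : I) : ℕ := (1 - 2 * D.dotI i j / D.dotI i i).toNat

/-- The coefficient `(-1)^p t_i^{-p (p' - 2⟨i,j⟩/(i·i) + 2⟨j,i⟩/(i·i))}`, where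
`t_i = t ^ (i · i / 2)` and `i · i / 2 = Ω i i`. -/
def serreSign (D : Datum I) (i j : I) (p p' : ℕ) : Kvt :=
  (-1) ^ p * tt ^ (-(p : ℤ) * (p' * D.Ω i i - D.Ω i j + D.Ω j i))

/-- The divided power `x^n / [n]^!_{v_i,t_i}`. -/
def divPow {A : Type*} [Ring A] [Algebra Kvt A] (D : Datum I) (i : I) (x : A) (n : ℕ) : A :=
  (qFact (D.vi i) (D.ti i) n)⁻¹ • x ^ n

/-- The quantum Serre expression of the positive part. -/
def serreE {A : Type*} [Ring A] [Algebra Kvt A] (D : Datum I) (i j : I) (e g : A) : A :=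
  ∑ x ∈ Finset.HasAntidiagonal.antidiagonal (D.serreNum i j),
    D.serreSign i j x.1 x.2 • (D.divPow i e x.1 * g * D.divPow i e x.2)

/-- The quantum Serre expression of the negative part. -/
def serreF {A : Type*} [Ring A] [Algebra Kvt A] (D : Datum I) (i j : I) (f g : A) : A :=
  ∑ x ∈ Finset.HasAntidiagonal.antidiagonal (D.serreNum i j),
    D.serreSign i j x.1 x.2 • (D.divPow i f x.2 * g * D.divPow i f x.1)

theorem dotI_self_half (D : Datum I) (i : I) : D.dotI i i / 2 = D.Ω i i := by
  simp only [dotI]; omega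

theorem vi_eq (D : Datum I) (i : I) : D.vi i = vv ^ D.Ω i i := by rw [vi, dotI_self_half]

theorem ti_eq (D : Datum I) (i : I) : D.ti i = tt ^ D.Ω i i := by rw [ti, dotI_self_half]

theorem chi_ne (D : Datum I) (i j : I) : D.chi i j ≠ 0 :=
  mul_ne_zero (zpow_ne_zero _ vv_ne) (zpow_ne_zero _ tt_ne)

theorem chi_self (D : Datum I) (i : I) : D.chi i i = vv ^ (2 * D.Ω i i) := by
  simp [chi, dotI, two_mul]

theorem geom_chi_ne (D : Datum I) (i : I) (n : ℕ) : geom (D.chi i i) (n + 1) ≠ 0 := by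
  rw [chi_self]; exact geom_ne (D.diag_pos i) n

theorem serreNum_spec (D : Datum I) {i j : I} (h : i ≠ j) :
    ∃ m : ℕ, D.serreNum i j = m + 1 ∧ D.dotI i j = -(m : ℤ) * D.Ω i i := by
  obtain ⟨a, ha, h2⟩ := D.quot_nonpos i j h
  have hp := D.diag_pos i
  refine ⟨a.natAbs, ?_, ?_⟩
  · have : 2 * D.dotI i j / D.dotI i i = a := by
      rw [dotI, dotI, h2]
      exact Int.ediv_eq_of_eq_mul_left (by omega) (by ring)
    rw [serreNum, this]; omega
  · rw [dotI, h2]; congr 1; omega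

theorem chi_mul_chi (D : Datum I) {i j : I} {m : ℕ} (h : D.dotI i j = -(m : ℤ) * D.Ω i i) :
    D.chi i j * D.chi j i * D.chi i i ^ m = 1 := by
  have e : D.dotI j i = D.dotI i j := by simp [dotI, add_comm]
  rw [chi_self, chi, chi, e, h, ← zpow_natCast, ← zpow_mul]
  have : ∀ a b c d : Kvt, a * b * (c * d) = (a * c) * (b * d) := by intros; ring
  rw [this, ← zpow_add₀ tt_ne, ← zpow_add₀ vv_ne, mul_right_comm, ← zpow_add₀ vv_ne]
  have e1 : -(m : ℤ) * D.Ω i i + -(m : ℤ) * D.Ω i i + 2 * D.Ω i i * m = 0 := by ring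
  have e2 : D.Ω j i - D.Ω i j + (D.Ω i j - D.Ω j i) = 0 := by ring
  rw [e1, e2]; simp

theorem serreE_eq {A : Type*} [Ring A] [Algebra Kvt A] (D : Datum I) {i j : I} (h : i ≠ j) :
    ∃ c : Kvt, c ≠ 0 ∧ ∀ e g : A, D.serreE i j e g
      = c • qcomm (fun n => D.chi i j * D.chi i i ^ n) e g (D.serreNum i j) := by
  obtain ⟨m, hm, hd⟩ := D.serreNum_spec h
  have hp := D.diag_pos i
  set a := D.Ω i i with ha
  set δ := D.Ω i j - D.Ω j i with hδ
  set T : ℕ → ℕ := fun n => ∑ j ∈ Finset.range n, j with hT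
  have hTz : ∀ n, ((T n : ℕ) : ℤ) * 2 = n * (n - 1) := by
    intro n
    induction n with
    | zero => simp [hT]
    | succ n ih =>
      have : T (n + 1) = T n + n := Finset.sum_range_succ _ _
      rw [this]; push_cast; linear_combination ih
  have hQ := D.geom_chi_ne i
  set w : ℕ → Kvt := fun n =>
    (-D.chi i j) ^ n * D.chi i i ^ (T n) * (geomFact (D.chi i i) n)⁻¹ with hw
  have hwr : ∀ p, geom (D.chi i i) (p + 1) * w (p + 1)
      = -(D.chi i j * D.chi i i ^ p * w p) := by
    intro p
    have : T (p + 1) = T p + p := Finset.sum_range_succ _ _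
    simp only [hw, this]
    rw [← geom_mul_inv hQ p, pow_add, pow_succ (-D.chi i j)]
    ring
  have hc : ∀ p p' : ℕ, p + p' = m + 1 →
      D.serreSign i j p p' * (qFact (D.vi i) (D.ti i) p)⁻¹ * (qFact (D.vi i) (D.ti i) p')⁻¹
      = ((-1) ^ (m + 1) * tt ^ ((m + 1 : ℕ) * δ - a * T (m + 1)) * vv ^ (a * T (m + 1))) *
        ((geomFact (D.chi i i) p)⁻¹ * w p') := by
    intro p p' hpp
    rw [vi_eq, ti_eq, qFact_eq hp, qFact_eq hp, ← chi_self]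
    have hTp := hTz p
    have hTp' := hTz p'
    have hTm := hTz (m + 1)
    have hz : (p : ℤ) + p' = m + 1 := by exact_mod_cast hpp
    simp only [hw]
    rw [mul_inv, mul_inv]
    have s1 : ((-1 : Kvt) ^ (m + 1)) = (-1) ^ p * (-1) ^ p' := by rw [← hpp, pow_add]
    have s2 : (-D.chi i j) ^ p' = (-1) ^ p' * D.chi i j ^ p' := by rw [neg_pow]
    have s3 : ((-1 : Kvt) ^ p') * (-1) ^ p' = 1 := by rw [← mul_pow]; simp
    have key : tt ^ (-(p : ℤ) * (p' * a - D.Ω i j + D.Ω j i)) *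
        ((tt ^ a * (vv ^ a)⁻¹) ^ T p)⁻¹ * ((tt ^ a * (vv ^ a)⁻¹) ^ T p')⁻¹
        = tt ^ ((m + 1 : ℕ) * δ - a * T (m + 1)) * vv ^ (a * T (m + 1)) *
          (D.chi i j ^ p' * D.chi i i ^ T p') := by
      rw [chi_self, chi, hd, ← ha]
      simp only [← zpow_neg, ← zpow_natCast, mul_zpow, ← zpow_mul, mul_inv]
      have : ∀ x1 x2 x3 x4 x5 : Kvt, x1 * (x2 * x3) * (x4 * x5) = (x1 * x2 * x4) * (x3 * x5) := by
        intros; ring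
      rw [this]
      have : ∀ x1 x2 x3 x4 x5 : Kvt, x1 * x2 * (x3 * x4 * x5) = (x1 * x4) * (x2 * x3 * x5) := by
        intros; ring
      rw [this]
      simp only [← zpow_add₀ tt_ne, ← zpow_add₀ vv_ne]
      congr 2
      · push_cast
        have h1 : (p : ℤ) * p' + T p + T p' = T (m + 1) := by
          have : ((p : ℤ) * p' + T p + T p') * 2 = T (m + 1) * 2 := by
            rw [hTm]; push_cast; rw [← hz]; linear_combination hTp + hTp'
          linarith
        rw [← h1, ← hz]
        simp only [hδ]; ring
      · have h2 : (T p : ℤ) - T p' = T (m + 1) - m * p' := by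
          have : ((T p : ℤ) - T p') * 2 = (T (m + 1) - m * p') * 2 := by
            have hzm : (m : ℤ) = p + p' - 1 := by linarith
            rw [sub_mul, sub_mul, hTm, hTp, hTp']; push_cast; rw [hzm]; ring
          linarith
        have h3 : (T p : ℤ) = T p' + T (m + 1) - m * p' := by linarith
        rw [h3]; ring
    rw [serreSign, s1, s2, ← ha]
    have := congrArg (fun z => z * ((-1 : Kvt) ^ p * (geomFact (D.chi i i) p)⁻¹ *
      (geomFact (D.chi i i) p')⁻¹)) key
    linear_combination this - (tt ^ ((m + 1 : ℕ) * δ - a * T (m + 1)) * vv ^ (a * T (m + 1)) *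
          (D.chi i j ^ p' * D.chi i i ^ T p')) * ((-1 : Kvt) ^ p * (geomFact (D.chi i i) p)⁻¹ *
      (geomFact (D.chi i i) p')⁻¹) * s3
  refine ⟨((-1) ^ (m + 1) * tt ^ ((m + 1 : ℕ) * δ - a * T (m + 1)) * vv ^ (a * T (m + 1))) *
    (geomFact (D.chi i i) (m + 1))⁻¹, ?_, ?_⟩
  · refine mul_ne_zero (mul_ne_zero (mul_ne_zero ?_ (zpow_ne_zero _ tt_ne))
      (zpow_ne_zero _ vv_ne)) (inv_ne_zero (geomFact_ne hQ _))
    exact pow_ne_zero _ (by simp)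
  · intro e g
    rw [hm, qcomm_expand hQ w (by simp [hw, hT, geomFact]) hwr, smul_smul, mul_assoc,
      inv_mul_cancel₀ (geomFact_ne hQ _), mul_one, Finset.smul_sum, serreE, hm]
    refine Finset.sum_congr rfl fun x hx => ?_
    rw [smul_smul, ← hc _ _ (Finset.HasAntidiagonal.mem_antidiagonal.1 hx), divPow, divPow]
    simp only [smul_mul_assoc, mul_smul_comm, smul_smul]
    congr 1; ring

theorem serreF_eq {A : Type*} [Ring A] [Algebra Kvt A] (D : Datum I) (i j : I) :
    ∃ c : Kvt, c ≠ 0 ∧ ∀ f g : A, D.serreF i j f g = c • D.transpose.serreE i j f g := by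
  have hn : D.transpose.serreNum i j = D.serreNum i j := by
    simp [serreNum, dotI, transpose, add_comm]
  have hdp : ∀ (x : A) n, D.transpose.divPow i x n = D.divPow i x n := fun _ _ => rfl
  refine ⟨(-1) ^ D.serreNum i j * tt ^ ((D.serreNum i j : ℤ) * (D.Ω i j - D.Ω j i)),
    mul_ne_zero (pow_ne_zero _ (by simp)) (zpow_ne_zero _ tt_ne), fun f g => ?_⟩
  rw [serreE, serreF, hn, Finset.smul_sum, ← Finset.Nat.sum_antidiagonal_swap]
  refine Finset.sum_congr rfl fun x hx => ?_
  rw [smul_smul, hdp, hdp]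
  congr 1
  simp only [Prod.fst_swap, Prod.snd_swap, serreSign, transpose]
  have hz := Finset.HasAntidiagonal.mem_antidiagonal.1 hx
  rw [← hz]
  have s3 : ((-1 : Kvt) ^ x.1) * (-1) ^ x.1 = 1 := by rw [← mul_pow]; simp
  have : tt ^ (-(x.2 : ℤ) * (x.1 * D.Ω i i - D.Ω i j + D.Ω j i))
      = tt ^ (((x.1 + x.2 : ℕ) : ℤ) * (D.Ω i j - D.Ω j i)) *
        tt ^ (-(x.1 : ℤ) * (x.2 * D.Ω i i - D.Ω j i + D.Ω i j)) := by
    rw [← zpow_add₀ tt_ne]; congr 1; push_cast; ring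
  rw [this, pow_add]
  linear_combination (-(-1 : Kvt) ^ x.2 * (tt ^ (((x.1 + x.2 : ℕ) : ℤ) * (D.Ω i j - D.Ω j i)) *
        tt ^ (-(x.1 : ℤ) * (x.2 * D.Ω i i - D.Ω j i + D.Ω i j)))) * s3

end Datum

/-! ### Algebras presented by generators and relations -/

/-- The `ℚ(v, t)`-algebra generated by `X` subject to the relations `r`. -/
def Pres {X : Type*} (r : FreeAlgebra Kvt X → FreeAlgebra Kvt X → Prop) : Type _ := RingQuot r

namespace Pres

variable {X : Type*} (r : FreeAlgebra Kvt X → FreeAlgebra Kvt X → Prop)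

instance : Ring (Pres r) := inferInstanceAs (Ring (RingQuot r))

instance : Algebra Kvt (Pres r) := inferInstanceAs (Algebra Kvt (RingQuot r))

instance : Semiring (Pres r) := inferInstance

instance : AddCommGroup (Pres r) := inferInstance

instance : AddCommMonoid (Pres r) := inferInstance

instance : Module Kvt (Pres r) := inferInstance

/-- The quotient map from the free algebra. -/
def mk : FreeAlgebra Kvt X →ₐ[Kvt] Pres r := RingQuot.mkAlgHom Kvt r

/-- The image of a generator. -/
def of (x : X) : Pres r := mk r (FreeAlgebra.ι Kvt x)

variable {r}

theorem mk_rel {x y : FreeAlgebra Kvt X} (h : r x y) : mk r x = mk r y :=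
  RingQuot.mkAlgHom_rel Kvt h

theorem mk_surjective : Function.Surjective (mk r) := RingQuot.mkAlgHom_surjective Kvt r

/-- The universal property of a presented algebra. -/
def lift {A : Type*} [Ring A] [Algebra Kvt A] (ρ : X → A)
    (h : ∀ x y, r x y → FreeAlgebra.lift Kvt ρ x = FreeAlgebra.lift Kvt ρ y) : Pres r →ₐ[Kvt] A :=
  RingQuot.liftAlgHom Kvt ⟨FreeAlgebra.lift Kvt ρ, h⟩

theorem lift_of {A : Type*} [Ring A] [Algebra Kvt A] (ρ : X → A)
    (h : ∀ x y, r x y → FreeAlgebra.lift Kvt ρ x = FreeAlgebra.lift Kvt ρ y) (x : X) :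
    lift ρ h (of r x) = ρ x :=
  (RingQuot.liftAlgHom_mkAlgHom_apply Kvt _ _ _).trans (FreeAlgebra.lift_ι_apply _ _)

theorem algHom_ext {A : Type*} [Ring A] [Algebra Kvt A] {φ ψ : Pres r →ₐ[Kvt] A}
    (h : ∀ x, φ (of r x) = ψ (of r x)) : φ = ψ := by
  refine RingQuot.ringQuot_ext' Kvt φ ψ ?_
  apply FreeAlgebra.hom_ext
  funext x
  exact h x

/-- The universal property of a presented algebra, for ring homomorphisms. -/
def liftRing {A : Type*} [Ring A] (φ : FreeAlgebra Kvt X →+* A) (h : ∀ x y, r x y → φ x = φ y) :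
    Pres r →+* A :=
  RingQuot.lift ⟨φ, h⟩

theorem liftRing_mk {A : Type*} [Ring A] (φ : FreeAlgebra Kvt X →+* A)
    (h : ∀ x y, r x y → φ x = φ y) (x : FreeAlgebra Kvt X) : liftRing φ h (mk r x) = φ x := by
  have e : mk r x = RingQuot.mkRingHom r x := by
    rw [← RingQuot.mkAlgHom_coe Kvt]; rfl
  rw [e]
  exact RingQuot.lift_mkRingHom_apply φ h x

/-- A subspace that contains `1` and is stable under left multiplication by the generators is
everything. -/
theorem induction_left {S : Submodule Kvt (Pres r)} (h1 : 1 ∈ S)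
    (h : ∀ x, ∀ a ∈ S, of r x * a ∈ S) (a : Pres r) : a ∈ S := by
  obtain ⟨a, rfl⟩ := mk_surjective a
  suffices H : ∀ b ∈ S, mk r a * b ∈ S by simpa using H 1 h1
  induction a using FreeAlgebra.induction with
  | grade0 c =>
    intro b hb
    rw [AlgHom.commutes, ← Algebra.smul_def]
    exact S.smul_mem c hb
  | grade1 x => exact h x
  | mul a b iha ihb => intro c hc; rw [map_mul, mul_assoc]; exact iha _ (ihb _ hc)
  | add a b iha ihb => intro c hc; rw [map_add, add_mul]; exact S.add_mem (iha _ hc) (ihb _ hc)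

end Pres

/-! ### The algebra `U_{v,t}` -/

/-- The generators `E_i, F_i, K_i^{±1}, K'_i^{±1}`. -/
inductive Gen (I : Type*)
  | E (i : I)
  | F (i : I)
  | K (i : I)
  | Kinv (i : I)
  | K' (i : I)
  | K'inv (i : I)

/-- A generator, as an element of the free algebra. -/
abbrev gen (x : Gen I) : FreeAlgebra Kvt (Gen I) := FreeAlgebra.ι Kvt x

/-- The defining relations of `U_{v,t}`. -/
inductive Rel (D : Datum I) : FreeAlgebra Kvt (Gen I) → FreeAlgebra Kvt (Gen I) → Prop
  | K_Kinv (i) : Rel D (gen (.K i) * gen (.Kinv i)) 1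
  | Kinv_K (i) : Rel D (gen (.Kinv i) * gen (.K i)) 1
  | K'_K'inv (i) : Rel D (gen (.K' i) * gen (.K'inv i)) 1
  | K'inv_K' (i) : Rel D (gen (.K'inv i) * gen (.K' i)) 1
  | K_K (i j) : Rel D (gen (.K i) * gen (.K j)) (gen (.K j) * gen (.K i))
  | K_K' (i j) : Rel D (gen (.K i) * gen (.K' j)) (gen (.K' j) * gen (.K i))
  | K'_K' (i j) : Rel D (gen (.K' i) * gen (.K' j)) (gen (.K' j) * gen (.K' i))
  | K_E (i j) : Rel D (gen (.K i) * gen (.E j) * gen (.Kinv i))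
      ((vv ^ D.dotI i j * tt ^ (D.Ω j i - D.Ω i j)) • gen (.E j))
  | K'_E (i j) : Rel D (gen (.K' i) * gen (.E j) * gen (.K'inv i))
      ((vv ^ (-D.dotI i j) * tt ^ (D.Ω j i - D.Ω i j)) • gen (.E j))
  | K'_F (i j) : Rel D (gen (.K' i) * gen (.F j) * gen (.K'inv i))
      ((vv ^ D.dotI i j * tt ^ (D.Ω i j - D.Ω j i)) • gen (.F j))
  | K_F (i j) : Rel D (gen (.K i) * gen (.F j) * gen (.Kinv i))
      ((vv ^ (-D.dotI i j) * tt ^ (D.Ω i j - D.Ω j i)) • gen (.F j))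
  | E_F_same (i) : Rel D (gen (.E i) * gen (.F i) - gen (.F i) * gen (.E i))
      ((D.vi i - (D.vi i)⁻¹)⁻¹ • (gen (.K i) - gen (.K' i)))
  | E_F_ne (i j) : i ≠ j → Rel D (gen (.E i) * gen (.F j) - gen (.F j) * gen (.E i)) 0
  | serre_E (i j) : i ≠ j → Rel D (D.serreE i j (gen (.E i)) (gen (.E j))) 0
  | serre_F (i j) : i ≠ j → Rel D (D.serreF i j (gen (.F i)) (gen (.F j))) 0

/-- The two-parameter quantum algebra `U_{v,t}`. -/
abbrev U (D : Datum I) : Type _ := Pres (Rel D)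

/-- The image of a generator in `U_{v,t}`. -/
def ug (D : Datum I) (x : Gen I) : U D := Pres.of (Rel D) x

/-- The relations of `U_{v,t}`, for elements of an arbitrary algebra, in a form that is convenient
for constructing homomorphisms. -/
structure IsRep (D : Datum I) {A : Type*} [Ring A] [Algebra Kvt A] (ρ : Gen I → A) : Prop where
  K_Kinv : ∀ i, ρ (.K i) * ρ (.Kinv i) = 1
  Kinv_K : ∀ i, ρ (.Kinv i) * ρ (.K i) = 1
  K'_K'inv : ∀ i, ρ (.K' i) * ρ (.K'inv i) = 1
  K'inv_K' : ∀ i, ρ (.K'inv i) * ρ (.K' i) = 1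
  K_K : ∀ i j, ρ (.K i) * ρ (.K j) = ρ (.K j) * ρ (.K i)
  K_K' : ∀ i j, ρ (.K i) * ρ (.K' j) = ρ (.K' j) * ρ (.K i)
  K'_K' : ∀ i j, ρ (.K' i) * ρ (.K' j) = ρ (.K' j) * ρ (.K' i)
  K_E : ∀ i j, ρ (.K i) * ρ (.E j) = D.chi i j • (ρ (.E j) * ρ (.K i))
  K'_E : ∀ i j, ρ (.K' i) * ρ (.E j) = (D.chi j i)⁻¹ • (ρ (.E j) * ρ (.K' i))
  K'_F : ∀ i j, ρ (.K' i) * ρ (.F j) = D.chi j i • (ρ (.F j) * ρ (.K' i))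
  K_F : ∀ i j, ρ (.K i) * ρ (.F j) = (D.chi i j)⁻¹ • (ρ (.F j) * ρ (.K i))
  E_F_same : ∀ i, ρ (.E i) * ρ (.F i) - ρ (.F i) * ρ (.E i)
      = (D.vi i - (D.vi i)⁻¹)⁻¹ • (ρ (.K i) - ρ (.K' i))
  E_F_ne : ∀ i j, i ≠ j → ρ (.E i) * ρ (.F j) = ρ (.F j) * ρ (.E i)
  serre_E : ∀ i j, i ≠ j → D.serreE i j (ρ (.E i)) (ρ (.E j)) = 0
  serre_F : ∀ i j, i ≠ j → D.serreF i j (ρ (.F i)) (ρ (.F j)) = 0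

theorem Datum.map_serreE {A B : Type*} [Ring A] [Algebra Kvt A] [Ring B] [Algebra Kvt B]
    (D : Datum I) (φ : A →ₐ[Kvt] B) (i j : I) (e g : A) :
    φ (D.serreE i j e g) = D.serreE i j (φ e) (φ g) := by
  simp [Datum.serreE, Datum.divPow]

theorem Datum.map_serreF {A B : Type*} [Ring A] [Algebra Kvt A] [Ring B] [Algebra Kvt B]
    (D : Datum I) (φ : A →ₐ[Kvt] B) (i j : I) (e g : A) :
    φ (D.serreF i j e g) = D.serreF i j (φ e) (φ g) := by
  simp [Datum.serreF, Datum.divPow]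

theorem Datum.chi_eq (D : Datum I) (i j : I) :
    vv ^ D.dotI i j * tt ^ (D.Ω j i - D.Ω i j) = D.chi i j := rfl

theorem Datum.chi_eq2 (D : Datum I) (i j : I) :
    vv ^ D.dotI i j * tt ^ (D.Ω i j - D.Ω j i) = D.chi j i := by
  simp [Datum.chi, Datum.dotI, add_comm]

theorem Datum.chi_eq3 (D : Datum I) (i j : I) :
    vv ^ (-D.dotI i j) * tt ^ (D.Ω i j - D.Ω j i) = (D.chi i j)⁻¹ := by
  rw [Datum.chi, mul_inv, ← zpow_neg, ← zpow_neg, neg_sub]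

theorem Datum.chi_eq4 (D : Datum I) (i j : I) :
    vv ^ (-D.dotI i j) * tt ^ (D.Ω j i - D.Ω i j) = (D.chi j i)⁻¹ := by
  rw [← D.chi_eq2, mul_inv, ← zpow_neg, ← zpow_neg, neg_sub]

theorem conj_iff {A : Type*} [Ring A] [Algebra Kvt A] {a a' x : A} (h1 : a * a' = 1)
    (h2 : a' * a = 1) (c : Kvt) : a * x * a' = c • x ↔ a * x = c • (x * a) := by
  constructor
  · intro h
    rw [← smul_mul_assoc, ← h, mul_assoc _ a' a, h2, mul_one]
  · intro h
    rw [h, smul_mul_assoc, mul_assoc, h1, mul_one]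

theorem ug_isRep (D : Datum I) : IsRep D (ug D) := by
  have h : ∀ {x y}, Rel D x y → Pres.mk (Rel D) x = Pres.mk (Rel D) y := fun r => Pres.mk_rel r
  have hu : ∀ x, ug D x = Pres.mk (Rel D) (gen x) := fun _ => rfl
  have hK1 : ∀ i, ug D (.K i) * ug D (.Kinv i) = 1 := fun i => by
    simpa only [hu, map_mul, map_one] using h (Rel.K_Kinv (D := D) i)
  have hK2 : ∀ i, ug D (.Kinv i) * ug D (.K i) = 1 := fun i => by
    simpa only [hu, map_mul, map_one] using h (Rel.Kinv_K (D := D) i)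
  have hK3 : ∀ i, ug D (.K' i) * ug D (.K'inv i) = 1 := fun i => by
    simpa only [hu, map_mul, map_one] using h (Rel.K'_K'inv (D := D) i)
  have hK4 : ∀ i, ug D (.K'inv i) * ug D (.K' i) = 1 := fun i => by
    simpa only [hu, map_mul, map_one] using h (Rel.K'inv_K' (D := D) i)
  constructor
  · exact hK1
  · exact hK2
  · exact hK3
  · exact hK4
  · intro i j; simpa only [hu, map_mul] using h (Rel.K_K (D := D) i j)
  · intro i j; simpa only [hu, map_mul] using h (Rel.K_K' (D := D) i j)
  · intro i j; simpa only [hu, map_mul] using h (Rel.K'_K' (D := D) i j)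
  · intro i j
    rw [← conj_iff (hK1 i) (hK2 i), ← D.chi_eq]
    simpa only [hu, map_mul, map_smul] using h (Rel.K_E (D := D) i j)
  · intro i j
    rw [← conj_iff (hK3 i) (hK4 i), ← D.chi_eq4]
    simpa only [hu, map_mul, map_smul] using h (Rel.K'_E (D := D) i j)
  · intro i j
    rw [← conj_iff (hK3 i) (hK4 i), ← D.chi_eq2]
    simpa only [hu, map_mul, map_smul] using h (Rel.K'_F (D := D) i j)
  · intro i j
    rw [← conj_iff (hK1 i) (hK2 i), ← D.chi_eq3]
    simpa only [hu, map_mul, map_smul] using h (Rel.K_F (D := D) i j)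
  · intro i; simpa only [hu, map_mul, map_sub, map_smul] using h (Rel.E_F_same (D := D) i)
  · intro i j hij
    rw [← sub_eq_zero]
    simpa only [hu, map_mul, map_sub, map_zero] using h (Rel.E_F_ne (D := D) i j hij)
  · intro i j hij
    have := h (Rel.serre_E (D := D) i j hij)
    rwa [Datum.map_serreE, map_zero] at this
  · intro i j hij
    have := h (Rel.serre_F (D := D) i j hij)
    rwa [Datum.map_serreF, map_zero] at this

/-- The universal property of `U_{v,t}`. -/
def liftU (D : Datum I) {A : Type*} [Ring A] [Algebra Kvt A] (ρ : Gen I → A) (h : IsRep D ρ) :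
    U D →ₐ[Kvt] A :=
  Pres.lift ρ <| by
    intro x y r
    cases r with
    | K_Kinv i => simpa using h.K_Kinv i
    | Kinv_K i => simpa using h.Kinv_K i
    | K'_K'inv i => simpa using h.K'_K'inv i
    | K'inv_K' i => simpa using h.K'inv_K' i
    | K_K i j => simpa using h.K_K i j
    | K_K' i j => simpa using h.K_K' i j
    | K'_K' i j => simpa using h.K'_K' i j
    | K_E i j =>
      simpa only [map_mul, map_smul, FreeAlgebra.lift_ι_apply, D.chi_eq] using
        (conj_iff (h.K_Kinv i) (h.Kinv_K i) _).2 (h.K_E i j)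
    | K'_E i j =>
      simpa only [map_mul, map_smul, FreeAlgebra.lift_ι_apply, D.chi_eq4] using
        (conj_iff (h.K'_K'inv i) (h.K'inv_K' i) _).2 (h.K'_E i j)
    | K'_F i j =>
      simpa only [map_mul, map_smul, FreeAlgebra.lift_ι_apply, D.chi_eq2] using
        (conj_iff (h.K'_K'inv i) (h.K'inv_K' i) _).2 (h.K'_F i j)
    | K_F i j =>
      simpa only [map_mul, map_smul, FreeAlgebra.lift_ι_apply, D.chi_eq3] using
        (conj_iff (h.K_Kinv i) (h.Kinv_K i) _).2 (h.K_F i j)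
    | E_F_same i =>
      simpa only [map_mul, map_sub, map_smul, FreeAlgebra.lift_ι_apply] using h.E_F_same i
    | E_F_ne i j hij =>
      simpa only [map_mul, map_sub, map_zero, FreeAlgebra.lift_ι_apply] using
        sub_eq_zero.2 (h.E_F_ne i j hij)
    | serre_E i j hij =>
      simpa only [Datum.map_serreE, map_zero, FreeAlgebra.lift_ι_apply] using h.serre_E i j hij
    | serre_F i j hij =>
      simpa only [Datum.map_serreF, map_zero, FreeAlgebra.lift_ι_apply] using h.serre_F i j hij

theorem liftU_ug (D : Datum I) {A : Type*} [Ring A] [Algebra Kvt A] (ρ : Gen I → A)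
    (h : IsRep D ρ) (x : Gen I) : liftU D ρ h (ug D x) = ρ x := by
  exact Pres.lift_of _ _ x

/-! ### The bar involution of `U_{v,t}` -/

/-- The ring homomorphism from a free algebra that is semilinear along `τ` and has prescribed
values on the generators. -/
def semiLift {k X A : Type*} [CommRing k] [Ring A] [Algebra k A] (τ : k →+* k) (f : X → A) :
    FreeAlgebra k X →+* A :=
  letI : Algebra k A := ((algebraMap k A).comp τ).toAlgebra' fun c x => Algebra.commutes (τ c) x
  ((FreeAlgebra.lift k f : FreeAlgebra k X →ₐ[k] A) : FreeAlgebra k X →+* A)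

theorem semiLift_ι {k X A : Type*} [CommRing k] [Ring A] [Algebra k A] (τ : k →+* k) (f : X → A)
    (x : X) : semiLift τ f (FreeAlgebra.ι k x) = f x := by
  let _ : Algebra k A := ((algebraMap k A).comp τ).toAlgebra' fun c x => Algebra.commutes (τ c) x
  exact FreeAlgebra.lift_ι_apply f x

theorem semiLift_smul {k X A : Type*} [CommRing k] [Ring A] [inst : Algebra k A] (τ : k →+* k)
    (f : X → A) (c : k) (x : FreeAlgebra k X) : semiLift τ f (c • x) = τ c • semiLift τ f x := by
  rw [@Algebra.smul_def k A _ _ inst, Algebra.smul_def, map_mul]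
  congr 1
  let _ : Algebra k A := ((algebraMap k A).comp τ).toAlgebra' fun c x => Algebra.commutes (τ c) x
  exact AlgHom.commutes (FreeAlgebra.lift k f : FreeAlgebra k X →ₐ[k] A) c

/-- The effect of the bar involution on generators: it exchanges `K_i` and `K'_i`. -/
def barGen : Gen I → Gen I
  | .E i => .E i
  | .F i => .F i
  | .K i => .K' i
  | .Kinv i => .K'inv i
  | .K' i => .K i
  | .K'inv i => .Kinv i

theorem barK_serreSign (D : Datum I) (i j : I) (p p' : ℕ) :
    barK (D.serreSign i j p p') = D.serreSign i j p p' := by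
  simp [Datum.serreSign, barK_t]

theorem barK_qFact_inv (D : Datum I) (i : I) (n : ℕ) :
    barK (qFact (D.vi i) (D.ti i) n)⁻¹ = (qFact (D.vi i) (D.ti i) n)⁻¹ := by
  rw [map_inv₀, Datum.vi, Datum.ti, barK_qFact]

theorem barK_chi (D : Datum I) (i j : I) : barK (D.chi i j) = (D.chi j i)⁻¹ := by
  rw [← D.chi_eq4, Datum.chi, map_mul, map_zpow₀, map_zpow₀, barK_v, barK_t, inv_zpow, zpow_neg]

/-- The bar involution of `U_{v,t}` as a ring homomorphism. -/
def barU (D : Datum I) : U D →+* U D :=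
  Pres.liftRing (semiLift barK fun x => ug D (barGen x)) <| by
    have h := ug_isRep D
    have hs : ∀ i j (e g : FreeAlgebra Kvt (Gen I)), semiLift barK (fun x => ug D (barGen x))
        (D.serreE i j e g) = D.serreE i j (semiLift barK (fun x => ug D (barGen x)) e)
          (semiLift barK (fun x => ug D (barGen x)) g) := by
      intro i j e g
      simp only [Datum.serreE, Datum.divPow, map_sum, semiLift_smul, map_mul, map_pow,
        barK_serreSign, barK_qFact_inv]
    have hs' : ∀ i j (e g : FreeAlgebra Kvt (Gen I)), semiLift barK (fun x => ug D (barGen x))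
        (D.serreF i j e g) = D.serreF i j (semiLift barK (fun x => ug D (barGen x)) e)
          (semiLift barK (fun x => ug D (barGen x)) g) := by
      intro i j e g
      simp only [Datum.serreF, Datum.divPow, map_sum, semiLift_smul, map_mul, map_pow,
        barK_serreSign, barK_qFact_inv]
    intro x y r
    cases r with
    | K_Kinv i => simpa [semiLift_ι, barGen] using h.K'_K'inv i
    | Kinv_K i => simpa [semiLift_ι, barGen] using h.K'inv_K' i
    | K'_K'inv i => simpa [semiLift_ι, barGen] using h.K_Kinv i
    | K'inv_K' i => simpa [semiLift_ι, barGen] using h.Kinv_K i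
    | K_K i j => simpa [semiLift_ι, barGen] using h.K'_K' i j
    | K_K' i j => simpa [semiLift_ι, barGen] using (h.K_K' j i).symm
    | K'_K' i j => simpa [semiLift_ι, barGen] using h.K_K i j
    | K_E i j =>
      simpa only [map_mul, semiLift_smul, semiLift_ι, D.chi_eq, barK_chi, barGen] using
        (conj_iff (h.K'_K'inv i) (h.K'inv_K' i) _).2 (h.K'_E i j)
    | K'_E i j =>
      simpa only [map_mul, semiLift_smul, semiLift_ι, D.chi_eq4, map_inv₀, barK_chi, inv_inv,
        barGen] using (conj_iff (h.K_Kinv i) (h.Kinv_K i) _).2 (h.K_E i j)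
    | K'_F i j =>
      simpa only [map_mul, semiLift_smul, semiLift_ι, D.chi_eq2, barK_chi, barGen] using
        (conj_iff (h.K_Kinv i) (h.Kinv_K i) _).2 (h.K_F i j)
    | K_F i j =>
      simpa only [map_mul, semiLift_smul, semiLift_ι, D.chi_eq3, map_inv₀, barK_chi, inv_inv,
        barGen] using (conj_iff (h.K'_K'inv i) (h.K'inv_K' i) _).2 (h.K'_F i j)
    | E_F_same i =>
      have e1 : barK (D.vi i - (D.vi i)⁻¹)⁻¹ = -(D.vi i - (D.vi i)⁻¹)⁻¹ := by
        rw [map_inv₀, map_sub, map_inv₀, Datum.vi, map_zpow₀, barK_v, inv_zpow, inv_inv, ← inv_neg,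
          neg_sub]
      simp only [map_mul, map_sub, semiLift_smul, semiLift_ι, barGen, e1]
      rw [h.E_F_same i, neg_smul, ← smul_neg, neg_sub]
    | E_F_ne i j hij =>
      simpa only [map_mul, map_sub, map_zero, semiLift_ι, barGen] using
        sub_eq_zero.2 (h.E_F_ne i j hij)
    | serre_E i j hij =>
      rw [hs, semiLift_ι, semiLift_ι, map_zero]
      exact h.serre_E i j hij
    | serre_F i j hij =>
      rw [hs', semiLift_ι, semiLift_ι, map_zero]
      exact h.serre_F i j hij

theorem barU_mk (D : Datum I) (x : FreeAlgebra Kvt (Gen I)) :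
    barU D (Pres.mk (Rel D) x) = semiLift barK (fun x => ug D (barGen x)) x :=
  Pres.liftRing_mk _ _ x

theorem barU_ug (D : Datum I) (x : Gen I) : barU D (ug D x) = ug D (barGen x) := by
  rw [ug, Pres.of, barU_mk, semiLift_ι]

theorem barU_smul (D : Datum I) (c : Kvt) (x : U D) : barU D (c • x) = barK c • barU D x := by
  obtain ⟨x, rfl⟩ := Pres.mk_surjective (r := Rel D) x
  rw [← map_smul, barU_mk, barU_mk, semiLift_smul]

/-- The bar involution of `U_{v,t}` as a semilinear map. -/
def barUₛ (D : Datum I) : U D →ₛₗ[barK] U D where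
  toFun := barU D
  map_add' := map_add _
  map_smul' := barU_smul D

/-- The bar map `\bar{\cdot} ⊗ \bar{\cdot}` on `U ⊗ U`. -/
def barUU (D : Datum I) : U D ⊗[Kvt] U D →ₛₗ[barK] U D ⊗[Kvt] U D :=
  TensorProduct.map (barUₛ D) (barUₛ D)

theorem Datum.serreE_iff (D : Datum I) {A : Type*} [Ring A] [Algebra Kvt A] {i j : I} (h : i ≠ j)
    (e g : A) : D.serreE i j e g = 0 ↔
      qcomm (fun n => D.chi i j * D.chi i i ^ n) e g (D.serreNum i j) = 0 := by
  obtain ⟨c, hc, H⟩ := D.serreE_eq (A := A) h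
  rw [H, smul_eq_zero_iff_right hc]

theorem Datum.serreNum_transpose (D : Datum I) (i j : I) :
    D.transpose.serreNum i j = D.serreNum i j := by
  simp [Datum.serreNum, Datum.dotI, Datum.transpose, add_comm]

theorem Datum.chi_transpose (D : Datum I) (i j : I) : D.transpose.chi i j = D.chi j i :=
  D.chi_eq2 i j ▸ by simp [Datum.chi, Datum.dotI, Datum.transpose, add_comm]

theorem Datum.serreF_iff (D : Datum I) {A : Type*} [Ring A] [Algebra Kvt A] (i j : I)
    (e g : A) : D.serreF i j e g = 0 ↔ D.transpose.serreE i j e g = 0 := by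
  obtain ⟨c, hc, H⟩ := D.serreF_eq (A := A) i j
  rw [H, smul_eq_zero_iff_right hc]

theorem map_qcomm {k A B : Type*} [Field k] [Ring A] [Algebra k A] [Ring B] [Algebra k B]
    (φ : A →ₐ[k] B) (q : ℕ → k) (e g : A) (n : ℕ) :
    φ (qcomm q e g n) = qcomm q (φ e) (φ g) n := by
  induction n with
  | zero => rfl
  | succ n ih => rw [qcomm, qcomm, ← ih]; simp

theorem qcomm_tmul_left {k A B : Type*} [Field k] [Ring A] [Algebra k A] [Ring B] [Algebra k B]
    (q : ℕ → k) {a b : A} (hab : a * b = b * a) (e g : B) (n : ℕ) :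
    qcomm q (a ⊗ₜ[k] e) (b ⊗ₜ[k] g) n = (a ^ n * b) ⊗ₜ[k] qcomm q e g n := by
  induction n with
  | zero => simp [qcomm]
  | succ n ih =>
    have h : a ^ n * b * a = a ^ (n + 1) * b := by rw [mul_assoc, ← hab, ← mul_assoc, ← pow_succ]
    rw [qcomm, qcomm, ih, Algebra.TensorProduct.tmul_mul_tmul, Algebra.TensorProduct.tmul_mul_tmul,
      h, ← mul_assoc, ← pow_succ', TensorProduct.tmul_sub, TensorProduct.tmul_smul]

theorem qcomm_tmul_right {k A B : Type*} [Field k] [Ring A] [Algebra k A] [Ring B] [Algebra k B]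
    (q : ℕ → k) {a b : B} (hab : a * b = b * a) (e g : A) (n : ℕ) :
    qcomm q (e ⊗ₜ[k] a) (g ⊗ₜ[k] b) n = qcomm q e g n ⊗ₜ[k] (a ^ n * b) := by
  induction n with
  | zero => simp [qcomm]
  | succ n ih =>
    have h : a ^ n * b * a = a ^ (n + 1) * b := by rw [mul_assoc, ← hab, ← mul_assoc, ← pow_succ]
    rw [qcomm, qcomm, ih, Algebra.TensorProduct.tmul_mul_tmul, Algebra.TensorProduct.tmul_mul_tmul,
      h, ← mul_assoc, ← pow_succ', TensorProduct.sub_tmul, TensorProduct.smul_tmul']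

/-- Serre relations pass to a comultiplication of the form `e ⊗ 1 + k ⊗ e`. -/
theorem serreE_comul (D : Datum I) {A : Type*} [Ring A] [Algebra Kvt A] {i j : I} (hij : i ≠ j)
    {e g a b : A} (hab : a * b = b * a) (hae : a * e = D.chi i i • (e * a))
    (hag : a * g = D.chi i j • (g * a)) (hbe : b * e = D.chi j i • (e * b))
    (h : D.serreE i j e g = 0) :
    D.serreE i j (e ⊗ₜ[Kvt] (1 : A) + a ⊗ₜ e) (g ⊗ₜ[Kvt] (1 : A) + b ⊗ₜ g) = 0 := by
  rw [D.serreE_iff hij] at h ⊢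
  obtain ⟨m, hm, hd⟩ := D.serreNum_spec hij
  rw [hm] at h ⊢
  rw [qcomm_add (D.geom_chi_ne i) (β := D.chi j i) ?_ ?_ ?_ (D.chi_mul_chi hd),
    qcomm_tmul_left _ hab, qcomm_tmul_right _ rfl, h]
  · simp
  · simp [Algebra.TensorProduct.tmul_mul_tmul, hae, TensorProduct.smul_tmul']
  · simp [Algebra.TensorProduct.tmul_mul_tmul, hag, TensorProduct.smul_tmul']
  · simp [Algebra.TensorProduct.tmul_mul_tmul, hbe, TensorProduct.smul_tmul']

/-! ### The coalgebra structure of `U_{v,t}` -/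

/-- The comultiplication on generators. -/
def comulGen (D : Datum I) : Gen I → U D ⊗[Kvt] U D
  | .E i => ug D (.E i) ⊗ₜ 1 + ug D (.K i) ⊗ₜ ug D (.E i)
  | .F i => 1 ⊗ₜ ug D (.F i) + ug D (.F i) ⊗ₜ ug D (.K' i)
  | .K i => ug D (.K i) ⊗ₜ ug D (.K i)
  | .Kinv i => ug D (.Kinv i) ⊗ₜ ug D (.Kinv i)
  | .K' i => ug D (.K' i) ⊗ₜ ug D (.K' i)
  | .K'inv i => ug D (.K'inv i) ⊗ₜ ug D (.K'inv i)

theorem comulGen_isRep (D : Datum I) : IsRep D (comulGen D) := by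
  have h := ug_isRep D
  constructor
  · intro i; simp [comulGen, h.K_Kinv, Algebra.TensorProduct.one_def]
  · intro i; simp [comulGen, h.Kinv_K, Algebra.TensorProduct.one_def]
  · intro i; simp [comulGen, h.K'_K'inv, Algebra.TensorProduct.one_def]
  · intro i; simp [comulGen, h.K'inv_K', Algebra.TensorProduct.one_def]
  · intro i j; simp [comulGen, h.K_K i j]
  · intro i j; simp [comulGen, h.K_K' i j]
  · intro i j; simp [comulGen, h.K'_K' i j]
  · intro i j
    simp [comulGen, mul_add, add_mul, h.K_E i j, h.K_K i j, TensorProduct.smul_tmul']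
  · intro i j
    simp [comulGen, mul_add, add_mul, h.K'_E i j, h.K_K' j i, TensorProduct.smul_tmul']
  · intro i j
    simp [comulGen, mul_add, add_mul, h.K'_F i j, h.K'_K' i j, TensorProduct.smul_tmul']
  · intro i j
    simp [comulGen, mul_add, add_mul, h.K_F i j, h.K_K' i j, TensorProduct.smul_tmul']
  · intro i
    have e1 : ug D (.K i) * ug D (.F i) = (D.chi i i)⁻¹ • (ug D (.F i) * ug D (.K i)) := h.K_F i i
    have e2 : ug D (.E i) * ug D (.K' i) = (D.chi i i) • (ug D (.K' i) * ug D (.E i)) := by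
      rw [h.K'_E i i, smul_smul, mul_inv_cancel₀ (D.chi_ne i i), one_smul]
    have e3 := h.E_F_same i
    have e4 := eq_add_of_sub_eq e3
    simp only [comulGen, mul_add, add_mul, Algebra.TensorProduct.tmul_mul_tmul, one_mul, mul_one,
      e1, e2, e4]
    simp only [TensorProduct.tmul_smul, ← TensorProduct.smul_tmul', smul_smul,
      inv_mul_cancel₀ (D.chi_ne i i), mul_inv_cancel₀ (D.chi_ne i i), one_smul,
      TensorProduct.add_tmul, TensorProduct.tmul_add, TensorProduct.tmul_sub,
      TensorProduct.sub_tmul, smul_sub]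
    abel
  · intro i j hij
    have e1 : ug D (.K i) * ug D (.F j) = (D.chi i j)⁻¹ • (ug D (.F j) * ug D (.K i)) := h.K_F i j
    have e2 : ug D (.E i) * ug D (.K' j) = (D.chi i j) • (ug D (.K' j) * ug D (.E i)) := by
      rw [h.K'_E j i, smul_smul, mul_inv_cancel₀ (D.chi_ne i j), one_smul]
    simp only [comulGen, mul_add, add_mul, Algebra.TensorProduct.tmul_mul_tmul, one_mul, mul_one,
      e1, e2, h.E_F_ne i j hij]
    simp only [TensorProduct.tmul_smul, ← TensorProduct.smul_tmul', smul_smul,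
      inv_mul_cancel₀ (D.chi_ne i j), mul_inv_cancel₀ (D.chi_ne i j), one_smul]
    abel
  · intro i j hij
    exact serreE_comul D hij (h.K_K i j) (h.K_E i i) (h.K_E i j) (h.K_E j i) (h.serre_E i j hij)
  · intro i j hij
    have h0 := h.serre_F i j hij
    rw [D.serreF_iff] at h0 ⊢
    have := serreE_comul D.transpose hij (h.K'_K' i j) (e := ug D (.F i)) (g := ug D (.F j))
      (by rw [D.chi_transpose]; exact h.K'_F i i) (by rw [D.chi_transpose]; exact h.K'_F i j)
      (by rw [D.chi_transpose]; exact h.K'_F j i) h0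
    have h2 := congrArg (Algebra.TensorProduct.comm Kvt (U D) (U D)).toAlgHom this
    rw [Datum.map_serreE, map_zero] at h2
    simpa [comulGen] using h2

/-- The comultiplication `Δ : U → U ⊗ U`. -/
def comul (D : Datum I) : U D →ₐ[Kvt] U D ⊗[Kvt] U D := liftU D (comulGen D) (comulGen_isRep D)

/-- The counit on generators. -/
def counitGen : Gen I → Kvt
  | .E _ => 0
  | .F _ => 0
  | _ => 1

theorem Datum.serre_zero (D : Datum I) {A : Type*} [Ring A] [Algebra Kvt A] (i j : I) (e : A) :
    D.serreE i j e 0 = 0 ∧ D.serreF i j e 0 = 0 := by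
  simp [Datum.serreE, Datum.serreF]

theorem counitGen_isRep (D : Datum I) : IsRep D (counitGen (I := I)) := by
  constructor <;> intros <;> simp [counitGen, Datum.serre_zero]

/-- The counit `ε : U → ℚ(v, t)`. -/
def counit (D : Datum I) : U D →ₐ[Kvt] Kvt := liftU D counitGen (counitGen_isRep D)

/-! ### The algebra presented by the `E_i` and `K_i^{±1}` -/

/-- The generators `E_i, K_i^{±1}`. -/
inductive PGen (I : Type*)
  | E (i : I)
  | K (i : I)
  | Kinv (i : I)

/-- The defining relations of the Borel algebra. -/
inductive PRel (D : Datum I) : FreeAlgebra Kvt (PGen I) → FreeAlgebra Kvt (PGen I) → Prop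
  | K_Kinv (i) : PRel D (FreeAlgebra.ι Kvt (.K i) * FreeAlgebra.ι Kvt (.Kinv i)) 1
  | Kinv_K (i) : PRel D (FreeAlgebra.ι Kvt (.Kinv i) * FreeAlgebra.ι Kvt (.K i)) 1
  | K_K (i j) : PRel D (FreeAlgebra.ι Kvt (.K i) * FreeAlgebra.ι Kvt (.K j))
      (FreeAlgebra.ι Kvt (.K j) * FreeAlgebra.ι Kvt (.K i))
  | K_E (i j) : PRel D (FreeAlgebra.ι Kvt (.K i) * FreeAlgebra.ι Kvt (.E j))
      (D.chi i j • (FreeAlgebra.ι Kvt (.E j) * FreeAlgebra.ι Kvt (.K i)))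
  | serre (i j) : i ≠ j →
      PRel D (D.serreE i j (FreeAlgebra.ι Kvt (.E i)) (FreeAlgebra.ι Kvt (.E j))) 0

/-- The Borel algebra, by generators and relations. -/
abbrev P (D : Datum I) : Type _ := Pres (PRel D)

/-- The image of a generator in the Borel algebra. -/
def pg (D : Datum I) (x : PGen I) : P D := Pres.of (PRel D) x

/-- The relations of the Borel algebra, for elements of an arbitrary algebra. -/
structure IsPRep (D : Datum I) {A : Type*} [Ring A] [Algebra Kvt A] (ρ : PGen I → A) : Prop where
  K_Kinv : ∀ i, ρ (.K i) * ρ (.Kinv i) = 1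
  Kinv_K : ∀ i, ρ (.Kinv i) * ρ (.K i) = 1
  K_K : ∀ i j, ρ (.K i) * ρ (.K j) = ρ (.K j) * ρ (.K i)
  K_E : ∀ i j, ρ (.K i) * ρ (.E j) = D.chi i j • (ρ (.E j) * ρ (.K i))
  serre : ∀ i j, i ≠ j → D.serreE i j (ρ (.E i)) (ρ (.E j)) = 0

theorem pg_isPRep (D : Datum I) : IsPRep D (pg D) := by
  have h : ∀ {x y}, PRel D x y → Pres.mk (PRel D) x = Pres.mk (PRel D) y := fun r => Pres.mk_rel r
  have hu : ∀ x, pg D x = Pres.mk (PRel D) (FreeAlgebra.ι Kvt x) := fun _ => rfl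
  constructor
  · intro i; simpa only [hu, map_mul, map_one] using h (PRel.K_Kinv (D := D) i)
  · intro i; simpa only [hu, map_mul, map_one] using h (PRel.Kinv_K (D := D) i)
  · intro i j; simpa only [hu, map_mul] using h (PRel.K_K (D := D) i j)
  · intro i j; simpa only [hu, map_mul, map_smul] using h (PRel.K_E (D := D) i j)
  · intro i j hij
    have := h (PRel.serre (D := D) i j hij)
    rwa [Datum.map_serreE, map_zero] at this

/-- The universal property of the Borel algebra. -/
def liftP (D : Datum I) {A : Type*} [Ring A] [Algebra Kvt A] (ρ : PGen I → A) (h : IsPRep D ρ) :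
    P D →ₐ[Kvt] A :=
  Pres.lift ρ <| by
    intro x y r
    cases r with
    | K_Kinv i => simpa using h.K_Kinv i
    | Kinv_K i => simpa using h.Kinv_K i
    | K_K i j => simpa using h.K_K i j
    | K_E i j => simpa using h.K_E i j
    | serre i j hij =>
      simpa only [Datum.map_serreE, map_zero, FreeAlgebra.lift_ι_apply] using h.serre i j hij

theorem liftP_pg (D : Datum I) {A : Type*} [Ring A] [Algebra Kvt A] (ρ : PGen I → A)
    (h : IsPRep D ρ) (x : PGen I) : liftP D ρ h (pg D x) = ρ x := by
  exact Pres.lift_of _ _ x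

theorem P.hom_ext {D : Datum I} {A : Type*} [Ring A] [Algebra Kvt A] {φ ψ : P D →ₐ[Kvt] A}
    (h : ∀ x, φ (pg D x) = ψ (pg D x)) : φ = ψ := Pres.algHom_ext h

/-- Two linear maps on the Borel algebra agree if they agree at `1` and agreement persists under
left multiplication by generators. -/
theorem P.lin_ext {D : Datum I} {M : Type*} [AddCommGroup M] [Module Kvt M]
    {f g : P D →ₗ[Kvt] M} (h1 : f 1 = g 1)
    (h : ∀ x a, f a = g a → f (pg D x * a) = g (pg D x * a)) : f = g := by
  ext a
  exact Pres.induction_left (S := LinearMap.eqLocus f g) h1 (fun x a ha => h x a ha) a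

/-- If `Kinv` inverts `K` and `K x = c • x K'`, then `Kinv x = c⁻¹ • x K'inv`. -/
theorem inv_comm {A : Type*} [Ring A] [Algebra Kvt A] {a a' b b' x : A} (h1 : a' * a = 1)
    (h2 : b * b' = 1) {c : Kvt} (hc : c ≠ 0) (h : a * x = c • (x * b)) :
    a' * x = c⁻¹ • (x * b') := by
  have h3 : a' * (a * x) * b' = x * b' := by rw [← mul_assoc a', h1, one_mul]
  rw [h, mul_smul_comm, smul_mul_assoc, mul_assoc, mul_assoc x, h2, mul_one] at h3
  rw [← h3, smul_smul, inv_mul_cancel₀ hc, one_smul]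

theorem P.Kinv_E (D : Datum I) (i j : I) :
    pg D (.Kinv i) * pg D (.E j) = (D.chi i j)⁻¹ • (pg D (.E j) * pg D (.Kinv i)) :=
  inv_comm ((pg_isPRep D).Kinv_K i) ((pg_isPRep D).K_Kinv i) (D.chi_ne i j) ((pg_isPRep D).K_E i j)

theorem qcomm_smul {k A : Type*} [Field k] [Ring A] [Algebra k A]
    (q : ℕ → k) (c d : k) (e g : A) (n : ℕ) :
    qcomm q (c • e) (d • g) n = (c ^ n * d) • qcomm q e g n := by
  induction n with
  | zero => simp [qcomm]
  | succ n ih =>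
    rw [qcomm, qcomm, ih]
    simp only [smul_mul_smul_comm, smul_sub, smul_smul]
    congr 2 <;> ring

theorem Datum.serreE_smul (D : Datum I) {A : Type*} [Ring A] [Algebra Kvt A] {i j : I} (hij : i ≠ j)
    (c d : Kvt) {e g : A} (h : D.serreE i j e g = 0) : D.serreE i j (c • e) (d • g) = 0 := by
  rw [D.serreE_iff hij] at h ⊢
  rw [qcomm_smul, h, smul_zero]

/-- Rescaling of generators. -/
def scaleGen (D : Datum I) (a : I → Kvt) (b : I → Kvt) : PGen I → P D
  | .E j => a j • pg D (.E j)
  | .K j => b j • pg D (.K j)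
  | .Kinv j => (b j)⁻¹ • pg D (.Kinv j)

theorem scaleGen_isPRep (D : Datum I) (a b : I → Kvt) (hb : ∀ j, b j ≠ 0) :
    IsPRep D (scaleGen D a b) := by
  have h := pg_isPRep D
  constructor
  · intro i; simp [scaleGen, h.K_Kinv, smul_smul, hb]
  · intro i; simp [scaleGen, h.Kinv_K, smul_smul, hb]
  · intro i j; simp only [scaleGen, smul_mul_smul_comm, h.K_K i j, mul_comm (b i)]
  · intro i j
    simp only [scaleGen, smul_mul_smul_comm, h.K_E i j, smul_smul]
    congr 1; ring
  · intro i j hij; exact D.serreE_smul hij _ _ (h.serre i j hij)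

/-- The endomorphism of the Borel algebra that rescales the generators. -/
def scale (D : Datum I) (a b : I → Kvt) (hb : ∀ j, b j ≠ 0) : P D →ₐ[Kvt] P D :=
  liftP D _ (scaleGen_isPRep D a b hb)

theorem scale_pg (D : Datum I) (a b : I → Kvt) (hb : ∀ j, b j ≠ 0) (x : PGen I) :
    scale D a b hb (pg D x) = scaleGen D a b x := liftP_pg _ _ _ _

theorem scale_scale (D : Datum I) (a b : I → Kvt) (hb : ∀ j, b j ≠ 0) (a' b' : I → Kvt)
    (hb' : ∀ j, b' j ≠ 0) : (scale D a b hb).comp (scale D a' b' hb')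
      = scale D (fun j => a j * a' j) (fun j => b j * b' j) (fun j => mul_ne_zero (hb j) (hb' j)) := by
  apply P.hom_ext
  intro x
  cases x <;> simp [scale_pg, scaleGen, smul_smul, mul_comm]

theorem scale_one (D : Datum I) (hb : ∀ _ : I, (1 : Kvt) ≠ 0) :
    scale D (fun _ => 1) (fun _ => 1) hb = AlgHom.id Kvt (P D) := by
  apply P.hom_ext
  intro x
  cases x <;> simp [scale_pg, scaleGen]

/-- The action of `K'_i` on the Borel algebra by conjugation. -/
def kapP (D : Datum I) (i : I) : P D →ₐ[Kvt] P D :=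
  scale D (fun j => (D.chi j i)⁻¹) (fun _ => 1) (fun _ => one_ne_zero)

/-- The inverse of `kapP`. -/
def kapPinv (D : Datum I) (i : I) : P D →ₐ[Kvt] P D :=
  scale D (fun j => D.chi j i) (fun _ => 1) (fun _ => one_ne_zero)

/-- The action of `K'_i` on the Borel algebra through the pairing. -/
def kap (D : Datum I) (i : I) : P D →ₐ[Kvt] P D :=
  scale D (fun _ => 1) (fun j => D.chi j i) (fun j => D.chi_ne j i)

/-- The inverse of `kap`. -/
def kapInv (D : Datum I) (i : I) : P D →ₐ[Kvt] P D :=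
  scale D (fun _ => 1) (fun j => (D.chi j i)⁻¹) (fun j => inv_ne_zero (D.chi_ne j i))

/-! ### Skew derivations of the Borel algebra -/

/-- Left multiplication on the Borel algebra. -/
def LP (D : Datum I) : P D →ₐ[Kvt] Module.End Kvt (P D) := Algebra.lmul Kvt (P D)

theorem LP_apply (D : Datum I) (a b : P D) : LP D a b = a * b := rfl

theorem LP_isPRep (D : Datum I) : IsPRep D (fun x => LP D (pg D x)) := by
  have h := pg_isPRep D
  constructor
  · intro i; rw [← map_mul, h.K_Kinv, map_one]
  · intro i; rw [← map_mul, h.Kinv_K, map_one]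
  · intro i j; rw [← map_mul, h.K_K, map_mul]
  · intro i j; rw [← map_mul, h.K_E, map_smul, map_mul]
  · intro i j hij; rw [← Datum.map_serreE, h.serre i j hij, map_zero]

/-- An algebra endomorphism as a linear operator. -/
abbrev toEnd {A : Type*} [Ring A] [Algebra Kvt A] (f : A →ₐ[Kvt] A) : Module.End Kvt A :=
  f.toLinearMap

theorem toEnd_mul_L (D : Datum I) (f : P D →ₐ[Kvt] P D) (a : P D) :
    toEnd f * LP D a = LP D (f a) * toEnd f := by
  ext b; simp [LP_apply]

/-- `c_i = (v_i⁻¹ - v_i)⁻¹`. -/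
def Datum.cc (D : Datum I) (i : I) : Kvt := ((D.vi i)⁻¹ - D.vi i)⁻¹

/-- The operator `c_i (K_i - y κ'_i)`. -/
def xop (D : Datum I) (y : Kvt) (i : I) : Module.End Kvt (P D) :=
  D.cc i • LP D (pg D (.K i)) - (D.cc i * y) • toEnd (kapP D i)

theorem xop_eq (D : Datum I) (y : Kvt) (i : I) : xop D y i =
    (-(D.cc i * y)) • toEnd (kapP D i) - (-D.cc i) • LP D (pg D (.K i)) := by
  rw [xop]; ext a
  simp only [LinearMap.sub_apply, LinearMap.smul_apply, neg_smul]; abel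

open Classical in
/-- The representation by triangular matrices whose off-diagonal entry is a skew derivation. -/
def gamGen (D : Datum I) (y : Kvt) (i : I) :
    PGen I → Matrix (Fin 2) (Fin 2) (Module.End Kvt (P D))
  | .E j => !![LP D (pg D (.E j)), if j = i then xop D y i else 0; 0, LP D (pg D (.E j))]
  | .K j => !![D.chi j i • LP D (pg D (.K j)), 0; 0, LP D (pg D (.K j))]
  | .Kinv j => !![(D.chi j i)⁻¹ • LP D (pg D (.Kinv j)), 0; 0, LP D (pg D (.Kinv j))]

theorem kapP_L_E (D : Datum I) (i j : I) : toEnd (kapP D i) * LP D (pg D (.E j))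
    = (D.chi j i)⁻¹ • (LP D (pg D (.E j)) * toEnd (kapP D i)) := by
  rw [toEnd_mul_L, kapP, scale_pg, scaleGen, map_smul, smul_mul_assoc]

theorem kapP_L_K (D : Datum I) (i j : I) : toEnd (kapP D i) * LP D (pg D (.K j))
    = LP D (pg D (.K j)) * toEnd (kapP D i) := by
  rw [toEnd_mul_L, kapP, scale_pg, scaleGen, one_smul]

theorem xop_L_K (D : Datum I) (y : Kvt) (i j : I) : LP D (pg D (.K j)) * xop D y i
    = xop D y i * LP D (pg D (.K j)) := by
  rw [xop, mul_sub, sub_mul, mul_smul_comm, mul_smul_comm, smul_mul_assoc, smul_mul_assoc,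
    kapP_L_K, (LP_isPRep D).K_K]

open Classical in
theorem gamGen_isPRep (D : Datum I) (y : Kvt) (i : I) : IsPRep D (gamGen D y i) := by
  have h := LP_isPRep D
  have e1 : (1 : Matrix (Fin 2) (Fin 2) (Module.End Kvt (P D))) = !![1, 0; 0, 1] :=
    Matrix.one_fin_two
  constructor
  · intro j
    have := h.K_Kinv j
    simp [gamGen, this, e1, smul_smul, D.chi_ne]
  · intro j
    have := h.Kinv_K j
    simp [gamGen, this, e1, smul_smul, D.chi_ne]
  · intro j l
    have := h.K_K j l
    simp [gamGen, this, smul_smul, mul_comm]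
  · intro j l
    have := h.K_E j l
    have h2 := xop_L_K D y i j
    by_cases hl : l = i
    · subst hl
      simp [gamGen, this, h2, smul_smul, mul_comm]
    · simp [gamGen, this, hl, smul_smul, mul_comm]
  · intro p q hpq
    obtain ⟨m, hm, hd⟩ := D.serreNum_spec hpq
    have h0 := h.serre p q hpq
    have hne : D.chi q p ≠ 0 := D.chi_ne _ _
    rw [D.serreE_iff hpq] at h0 ⊢
    rw [gamGen, gamGen, qcomm_matrix, h0, hm]
    have : qcommVar (fun n => D.chi p q * D.chi p p ^ n) (LP D (pg D (.E p)))
        (LP D (pg D (.E q))) (if p = i then xop D y i else 0) (if q = i then xop D y i else 0)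
          (m + 1) = 0 := by
      by_cases hp : p = i
      · subst hp
        rw [if_pos rfl, if_neg (Ne.symm hpq), xop]
        refine qcommVar_left (D.chi_ne _ _) hne ?_ ?_ ?_ ?_ (D.chi_mul_chi hd)
        · rw [smul_mul_assoc, h.K_E, mul_smul_comm, smul_comm]
        · rw [smul_mul_assoc, h.K_E, mul_smul_comm, smul_comm]
        · rw [smul_mul_assoc, kapP_L_E, mul_smul_comm, smul_comm]
        · rw [smul_mul_assoc, kapP_L_E, mul_smul_comm, smul_comm]
      · rw [if_neg hp]
        by_cases hq : q = i
        · subst hq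
          rw [if_pos rfl, xop]
          refine qcommVar_right (D.chi_ne _ _) ?_ ?_ (D.chi_mul_chi hd)
          · rw [smul_mul_assoc, h.K_E, mul_smul_comm, smul_comm]
          · rw [smul_mul_assoc, kapP_L_E, mul_smul_comm, smul_comm]
        · rw [if_neg hq]; exact qcommVar_zero _ _ _ _
    rw [this]
    ext a b; fin_cases a <;> fin_cases b <;> rfl

/-- The matrix representation defining the skew derivation. -/
def gamRep (D : Datum I) (y : Kvt) (i : I) :
    P D →ₐ[Kvt] Matrix (Fin 2) (Fin 2) (Module.End Kvt (P D)) := liftP D _ (gamGen_isPRep D y i)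

theorem gamRep_diag (D : Datum I) (y : Kvt) (i : I) (a : P D) :
    gamRep D y i a 1 0 = 0 ∧ gamRep D y i a 1 1 = LP D a := by
  let f : P D →ₗ[Kvt] (Module.End Kvt (P D) × Module.End Kvt (P D)) :=
    { toFun := fun a => (gamRep D y i a 1 0, gamRep D y i a 1 1)
      map_add' := fun a b => by simp
      map_smul' := fun c a => by simp }
  let g : P D →ₗ[Kvt] (Module.End Kvt (P D) × Module.End Kvt (P D)) :=
    { toFun := fun a => (0, LP D a)
      map_add' := fun a b => by simp
      map_smul' := fun c a => by simp }
  have : f = g := by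
    apply P.lin_ext
    · simp [f, g]
    · intro x a ha
      simp only [f, g, LinearMap.coe_mk, AddHom.coe_mk, Prod.mk.injEq] at ha ⊢
      obtain ⟨h1, h2⟩ := ha
      rw [map_mul, map_mul, gamRep, liftP_pg, ← gamRep, Matrix.mul_apply, Matrix.mul_apply,
        Fin.sum_univ_two, Fin.sum_univ_two, h1, h2]
      cases x <;> simp [gamGen]
  have := LinearMap.congr_fun this a
  simpa [f, g] using this

/-- The skew derivation `Γ_i`, depending on a parameter `y`: `Γ_i(1) = 0` and
`Γ_i(E_j a) = E_j Γ_i(a) + δ_{ij} c_i (K_i a - y κ'_i(a))`. -/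
def gam (D : Datum I) (y : Kvt) (i : I) : Module.End Kvt (P D) where
  toFun a := gamRep D y i a 0 1 1
  map_add' a b := by simp
  map_smul' c a := by simp

theorem gam_one (D : Datum I) (y : Kvt) (i : I) : gam D y i 1 = 0 := by
  simp [gam]

theorem gam_mul (D : Datum I) (y : Kvt) (i : I) (x : PGen I) (a : P D) :
    gam D y i (pg D x * a) = gamGen D y i x 0 0 (gam D y i a) + gamGen D y i x 0 1 a := by
  have h := gamRep_diag D y i a
  simp only [gam, LinearMap.coe_mk, AddHom.coe_mk]
  rw [map_mul, gamRep, liftP_pg, ← gamRep, Matrix.mul_apply, Fin.sum_univ_two, h.2]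
  simp [LP_apply]

theorem gam_E_same (D : Datum I) (y : Kvt) (i : I) (a : P D) :
    gam D y i (pg D (.E i) * a) = pg D (.E i) * gam D y i a + xop D y i a := by
  rw [gam_mul]; simp [gamGen, LP_apply]

theorem gam_E_ne (D : Datum I) (y : Kvt) {i j : I} (h : j ≠ i) (a : P D) :
    gam D y i (pg D (.E j) * a) = pg D (.E j) * gam D y i a := by
  rw [gam_mul]; simp [gamGen, h, LP_apply]

theorem gam_K (D : Datum I) (y : Kvt) (i j : I) (a : P D) :
    gam D y i (pg D (.K j) * a) = D.chi j i • (pg D (.K j) * gam D y i a) := by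
  rw [gam_mul]; simp [gamGen, LP_apply]

theorem gam_Kinv (D : Datum I) (y : Kvt) (i j : I) (a : P D) :
    gam D y i (pg D (.Kinv j) * a) = (D.chi j i)⁻¹ • (pg D (.Kinv j) * gam D y i a) := by
  rw [gam_mul]; simp [gamGen, LP_apply]

/-- A scaling of generators commutes with `Γ_i` up to a scalar. -/
theorem scale_gam (D : Datum I) (y : Kvt) (i : I) (a b : I → Kvt) (hb : ∀ j, b j ≠ 0) (c : Kvt)
    (hc : c * a i = b i) (hy : y = 0 ∨ c * a i = 1) :
    toEnd (scale D a b hb) * gam D y i = c • (gam D y i * toEnd (scale D a b hb)) := by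
  apply P.lin_ext
  · simp [gam_one]
  · intro x p hp
    simp only [Module.End.mul_apply, LinearMap.smul_apply, AlgHom.toLinearMap_apply] at hp ⊢
    rw [map_mul (scale D a b hb), scale_pg]
    cases x with
    | E j =>
      by_cases hj : j = i
      · subst hj
        have hk : (c * a j) • (y • kapP D j (scale D a b hb p)) =
            y • scale D a b hb (kapP D j p) := by
          rcases hy with rfl | hy
          · simp
          · rw [hy, one_smul]
            congr 1
            have : (kapP D j).comp (scale D a b hb) = (scale D a b hb).comp (kapP D j) := by
              rw [kapP, scale_scale, scale_scale]
              congr 1 <;> (funext; ring)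
            exact DFunLike.congr_fun this p
        rw [gam_E_same, scaleGen, smul_mul_assoc, map_smul, gam_E_same, map_add, map_mul, hp,
          scale_pg, scaleGen]
        simp only [xop, LinearMap.sub_apply, LinearMap.smul_apply, AlgHom.toLinearMap_apply,
          LP_apply, map_sub, map_smul, map_mul, scale_pg, scaleGen, smul_add, smul_sub,
          smul_mul_assoc, mul_smul_comm, smul_smul]
        rw [mul_smul (D.cc j) y, ← hk, ← hc]
        simp only [smul_smul]
        have e1 : D.cc j * (c * a j) = c * a j * D.cc j := mul_comm _ _
        have e2 : D.cc j * (c * a j * y) = c * (a j * (D.cc j * y)) := by ring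
        have e3 : c * (a j * D.cc j) = c * a j * D.cc j := (mul_assoc _ _ _).symm
        simp only [e1, e2, e3]
      · rw [gam_E_ne _ _ hj, scaleGen, smul_mul_assoc, map_smul, gam_E_ne _ _ hj, map_mul, hp,
          scale_pg, scaleGen]
        simp only [smul_mul_assoc, mul_smul_comm, smul_smul]
    | K j =>
      rw [gam_K, scaleGen, smul_mul_assoc, map_smul, map_smul, gam_K, map_mul, hp, scale_pg, scaleGen]
      simp only [smul_mul_assoc, mul_smul_comm, smul_smul]
      congr 1; ring
    | Kinv j =>
      rw [gam_Kinv, scaleGen, smul_mul_assoc, map_smul, map_smul, gam_Kinv, map_mul, hp, scale_pg, scaleGen]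
      simp only [smul_mul_assoc, mul_smul_comm, smul_smul]
      congr 1; ring

theorem gam_kapP (D : Datum I) (y : Kvt) (i j : I) :
    toEnd (kapP D i) * gam D y j = D.chi j i • (gam D y j * toEnd (kapP D i)) :=
  scale_gam D y j _ _ _ _ (mul_inv_cancel₀ (D.chi_ne j i))
    (Or.inr (mul_inv_cancel₀ (D.chi_ne j i)))

theorem gam_kap (D : Datum I) (i j : I) :
    toEnd (kap D i) * gam D 0 j = D.chi j i • (gam D 0 j * toEnd (kap D i)) :=
  scale_gam D 0 j _ _ _ _ (mul_one _) (Or.inl rfl)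

theorem gam_L_K (D : Datum I) (y : Kvt) (i j : I) :
    LP D (pg D (.K i)) * gam D y j = (D.chi i j)⁻¹ • (gam D y j * LP D (pg D (.K i))) := by
  ext a
  simp [gam_K, smul_smul, D.chi_ne, LP_apply]

theorem gam_L_E_same (D : Datum I) (y : Kvt) (i : I) :
    gam D y i * LP D (pg D (.E i)) - LP D (pg D (.E i)) * gam D y i = xop D y i := by
  ext a
  simp [gam_E_same, LP_apply]

theorem gam_L_E_ne (D : Datum I) (y : Kvt) {i j : I} (h : j ≠ i) :
    gam D y i * LP D (pg D (.E j)) - LP D (pg D (.E j)) * gam D y i = 0 := by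
  ext a
  simp [gam_E_ne, h, LP_apply]

theorem gam_serre (D : Datum I) (y : Kvt) {i j : I} (hij : i ≠ j) :
    D.transpose.serreE i j (gam D y i) (gam D y j) = 0 := by
  rw [D.transpose.serreE_iff hij]
  obtain ⟨m, hm, hd⟩ := D.transpose.serreNum_spec hij
  have hab := D.transpose.chi_mul_chi hd
  rw [hm]
  have hne := D.chi_ne
  have hE : ∀ l, qcomm (fun n => D.transpose.chi i j * D.transpose.chi i i ^ n) (gam D y i)
      (gam D y j) (m + 1) * LP D (pg D (.E l)) = LP D (pg D (.E l)) *
        qcomm (fun n => D.transpose.chi i j * D.transpose.chi i i ^ n) (gam D y i)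
      (gam D y j) (m + 1) := by
    intro l
    rw [← sub_eq_zero, qcommVar_commutator]
    by_cases hi : l = i
    · subst hi
      rw [gam_L_E_same, gam_L_E_ne _ _ hij, xop_eq]
      refine qcommVar_left (D.transpose.chi_ne _ _) (D.transpose.chi_ne j l) ?_ ?_ ?_ ?_ hab
      · rw [smul_mul_assoc, gam_kapP, mul_smul_comm, smul_comm]; rfl
      · rw [smul_mul_assoc, gam_kapP, mul_smul_comm, smul_comm,
          D.chi_transpose]
      · rw [smul_mul_assoc, gam_L_K, mul_smul_comm, smul_comm]; rfl
      · rw [smul_mul_assoc, gam_L_K, mul_smul_comm, smul_comm,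
          D.chi_transpose]
    · rw [gam_L_E_ne _ _ hi]
      by_cases hj : l = j
      · subst hj
        rw [gam_L_E_same, xop_eq]
        refine qcommVar_right (D.transpose.chi_ne _ _) ?_ ?_ hab
        · rw [smul_mul_assoc, gam_kapP, mul_smul_comm, smul_comm,
            D.chi_transpose]
        · rw [smul_mul_assoc, gam_L_K, mul_smul_comm, smul_comm,
            D.chi_transpose]
      · rw [gam_L_E_ne _ _ hj]; exact qcommVar_zero _ _ _ _
  have hK := fun l => qcomm_comm_left (fun n => D.transpose.chi i j * D.transpose.chi i i ^ n)
    (gam_L_K D y l i) (gam_L_K D y l j) (m + 1)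
  have h1 : ∀ n, qcomm (fun n => D.transpose.chi i j * D.transpose.chi i i ^ n) (gam D y i)
      (gam D y j) n 1 = 0 := by
    intro n
    induction n with
    | zero => exact gam_one D y j
    | succ n ih => simp [qcomm, ih, gam_one]
  have h1 := h1 (m + 1)
  generalize qcomm (fun n => D.transpose.chi i j * D.transpose.chi i i ^ n) (gam D y i)
      (gam D y j) (m + 1) = S at *
  have hKK : ∀ l a, S (pg D (.K l) * a) = 0 ↔ S a = 0 := by
    intro l a
    have h2 := LinearMap.congr_fun (hK l) a
    simp only [Module.End.mul_apply, LinearMap.smul_apply, LP_apply] at h2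
    constructor
    · intro h3
      rw [h3, smul_zero] at h2
      have := congrArg (fun z => pg D (.Kinv l) * z) h2
      simpa only [← mul_assoc, (pg_isPRep D).Kinv_K, one_mul, mul_zero] using this
    · intro h3
      rw [h3, mul_zero] at h2
      refine (smul_eq_zero.1 h2.symm).resolve_left ?_
      exact mul_ne_zero (inv_ne_zero (hne _ _)) (pow_ne_zero _ (inv_ne_zero (hne _ _)))
  apply P.lin_ext
  · exact h1
  · intro x a ha
    rw [LinearMap.zero_apply] at ha ⊢
    cases x with
    | E l =>
      have := LinearMap.congr_fun (hE l) a
      simpa [LP_apply, ha] using this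
    | K l => exact (hKK l a).2 ha
    | Kinv l =>
      rw [← hKK l, ← mul_assoc, (pg_isPRep D).K_Kinv, one_mul]
      exact ha

/-! ### The Borel algebras embed into `U_{v,t}` -/

theorem toEnd_comp (D : Datum I) (f g : P D →ₐ[Kvt] P D) : toEnd f * toEnd g = toEnd (f.comp g) :=
  rfl

theorem scale_congr (D : Datum I) {a b a' b' : I → Kvt} (hb : ∀ j, b j ≠ 0) (hb' : ∀ j, b' j ≠ 0)
    (h1 : a = a') (h2 : b = b') : scale D a b hb = scale D a' b' hb' := by
  subst h1 h2; rfl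

theorem scale_eq_one (D : Datum I) {a b : I → Kvt} (hb : ∀ j, b j ≠ 0)
    (h1 : ∀ j, a j = 1) (h2 : ∀ j, b j = 1) : toEnd (scale D a b hb) = 1 := by
  rw [scale_congr D hb (fun _ => one_ne_zero) (funext h1) (funext h2), scale_one]; rfl

theorem scale_comm (D : Datum I) {a b a' b' : I → Kvt} (hb : ∀ j, b j ≠ 0) (hb' : ∀ j, b' j ≠ 0) :
    toEnd (scale D a b hb) * toEnd (scale D a' b' hb')
      = toEnd (scale D a' b' hb') * toEnd (scale D a b hb) := by
  rw [toEnd_comp, toEnd_comp, scale_scale, scale_scale]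
  congr 1
  exact scale_congr D _ _ (by funext; ring) (by funext; ring)

/-- The action of `U_{v,t}` on the Borel algebra, on generators. -/
def actUGen (D : Datum I) : Gen I → Module.End Kvt (P D)
  | .E i => LP D (pg D (.E i))
  | .F i => gam D 1 i
  | .K i => LP D (pg D (.K i))
  | .Kinv i => LP D (pg D (.Kinv i))
  | .K' i => toEnd (kapP D i)
  | .K'inv i => toEnd (kapPinv D i)

theorem actUGen_isRep (D : Datum I) : IsRep D (actUGen D) := by
  have h := LP_isPRep D
  constructor
  · exact h.K_Kinv
  · exact h.Kinv_K
  · intro i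
    simp only [actUGen, kapP, kapPinv]
    rw [toEnd_comp, scale_scale]
    exact scale_eq_one D _ (fun j => by simp [D.chi_ne]) (fun j => by simp)
  · intro i
    simp only [actUGen, kapP, kapPinv]
    rw [toEnd_comp, scale_scale]
    exact scale_eq_one D _ (fun j => by simp [D.chi_ne]) (fun j => by simp)
  · exact h.K_K
  · intro i j; exact (kapP_L_K D j i).symm
  · intro i j; exact scale_comm D _ _
  · exact h.K_E
  · intro i j; exact kapP_L_E D i j
  · intro i j; exact gam_kapP D 1 i j
  · intro i j; exact gam_L_K D 1 i j
  · intro i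
    have h1 := gam_L_E_same D 1 i
    simp only [actUGen]
    have h2 : D.cc i = -(D.vi i - (D.vi i)⁻¹)⁻¹ := by rw [Datum.cc, ← inv_neg, neg_sub]
    rw [← neg_sub, h1, xop, h2]
    ext a
    simp only [LinearMap.neg_apply, LinearMap.sub_apply, LinearMap.smul_apply, neg_smul, mul_one,
      smul_sub]
    abel
  · intro i j hij
    exact (sub_eq_zero.1 (gam_L_E_ne D 1 hij)).symm
  · exact h.serre
  · intro i j hij
    rw [D.serreF_iff]
    exact gam_serre D 1 hij

/-- The action of `U_{v,t}` on the Borel algebra. -/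
def actU (D : Datum I) : U D →ₐ[Kvt] Module.End Kvt (P D) := liftU D _ (actUGen_isRep D)

/-- The embedding of the presented Borel algebra onto `U^{≥0}`, on generators. -/
def inGeqGen (D : Datum I) : PGen I → U D
  | .E i => ug D (.E i)
  | .K i => ug D (.K i)
  | .Kinv i => ug D (.Kinv i)

theorem inGeqGen_isPRep (D : Datum I) : IsPRep D (inGeqGen D) := by
  have h := ug_isRep D
  exact ⟨h.K_Kinv, h.Kinv_K, h.K_K, h.K_E, h.serre_E⟩

/-- The embedding of the presented Borel algebra onto `U^{≥0}`. -/
def inGeq (D : Datum I) : P D →ₐ[Kvt] U D := liftP D _ (inGeqGen_isPRep D)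

/-- A retraction of `inGeq`. -/
def retGeq (D : Datum I) : U D →ₗ[Kvt] P D :=
  (LinearMap.applyₗ (1 : P D)).comp (actU D).toLinearMap

theorem retGeq_inGeq (D : Datum I) (a : P D) : retGeq D (inGeq D a) = a := by
  have : (actU D).comp (inGeq D) = LP D := by
    apply P.hom_ext
    intro x
    rw [AlgHom.comp_apply, inGeq, liftP_pg]
    cases x <;> exact liftU_ug _ _ _ _
  have h := DFunLike.congr_fun this a
  rw [AlgHom.comp_apply] at h
  simp only [retGeq, LinearMap.comp_apply, AlgHom.toLinearMap_apply, h]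
  simp [LP_apply]

/-- The isomorphism exchanging `E` and `F`, on generators. -/
def swapGen : Gen I → Gen I
  | .E i => .F i
  | .F i => .E i
  | .K i => .K' i
  | .Kinv i => .K'inv i
  | .K' i => .K i
  | .K'inv i => .Kinv i

theorem swap_isRep (D : Datum I) : IsRep D (fun x => ug D.transpose (swapGen x)) := by
  have h := ug_isRep D.transpose
  have hc := D.chi_transpose
  constructor
  · exact h.K'_K'inv
  · exact h.K'inv_K'
  · exact h.K_Kinv
  · exact h.Kinv_K
  · exact h.K'_K'
  · intro i j; exact (h.K_K' j i).symm
  · exact h.K_K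
  · intro i j; simpa [swapGen, hc] using h.K'_F i j
  · intro i j; simpa [swapGen, hc] using h.K_F i j
  · intro i j; simpa [swapGen, hc] using h.K_E i j
  · intro i j; simpa [swapGen, hc] using h.K'_E i j
  · intro i
    have := h.E_F_same i
    simp only [swapGen]
    rw [← neg_sub, this, ← smul_neg, neg_sub]; rfl
  · intro i j hij; exact (h.E_F_ne j i hij.symm).symm
  · intro i j hij
    have := h.serre_F i j hij
    rwa [D.transpose.serreF_iff] at this
  · intro i j hij
    rw [D.serreF_iff]; exact h.serre_E i j hij

/-- The isomorphism exchanging `E` and `F`. -/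
def swapU (D : Datum I) : U D →ₐ[Kvt] U D.transpose := liftU D _ (swap_isRep D)

/-- The embedding of the presented Borel algebra onto `U^{≤0}`, on generators. -/
def inLeqGen (D : Datum I) : PGen I → U D
  | .E i => ug D (.F i)
  | .K i => ug D (.K' i)
  | .Kinv i => ug D (.K'inv i)

theorem inLeqGen_isPRep (D : Datum I) : IsPRep D.transpose (inLeqGen D) := by
  have h := ug_isRep D
  refine ⟨h.K'_K'inv, h.K'inv_K', h.K'_K', fun i j => ?_, fun i j hij => ?_⟩
  · rw [D.chi_transpose]; exact h.K'_F i j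
  · rw [← D.serreF_iff]; exact h.serre_F i j hij

/-- The embedding of the presented Borel algebra onto `U^{≤0}`. -/
def inLeq (D : Datum I) : P D.transpose →ₐ[Kvt] U D := liftP D.transpose _ (inLeqGen_isPRep D)

/-- A retraction of `inLeq`. -/
def retLeq (D : Datum I) : U D →ₗ[Kvt] P D.transpose :=
  (retGeq D.transpose).comp (swapU D).toLinearMap

theorem retLeq_inLeq (D : Datum I) (a : P D.transpose) : retLeq D (inLeq D a) = a := by
  have : (swapU D).comp (inLeq D) = inGeq D.transpose := by
    apply P.hom_ext
    intro x
    rw [AlgHom.comp_apply, inLeq, liftP_pg, inGeq, liftP_pg]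
    cases x <;> exact liftU_ug _ _ _ _
  have h := DFunLike.congr_fun this a
  rw [AlgHom.comp_apply] at h
  rw [retLeq, LinearMap.comp_apply, AlgHom.toLinearMap_apply, h, retGeq_inGeq]

/-! ### The pairing of the presented Borel algebras -/

/-- The comultiplication of the Borel algebra on generators. -/
def comulPGen (D : Datum I) : PGen I → P D ⊗[Kvt] P D
  | .E i => pg D (.E i) ⊗ₜ 1 + pg D (.K i) ⊗ₜ pg D (.E i)
  | .K i => pg D (.K i) ⊗ₜ pg D (.K i)
  | .Kinv i => pg D (.Kinv i) ⊗ₜ pg D (.Kinv i)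

theorem comulPGen_isPRep (D : Datum I) : IsPRep D (comulPGen D) := by
  have h := pg_isPRep D
  constructor
  · intro i; simp [comulPGen, h.K_Kinv, Algebra.TensorProduct.one_def]
  · intro i; simp [comulPGen, h.Kinv_K, Algebra.TensorProduct.one_def]
  · intro i j; simp [comulPGen, h.K_K i j]
  · intro i j
    simp [comulPGen, mul_add, add_mul, h.K_E i j, h.K_K i j, TensorProduct.smul_tmul']
  · intro i j hij
    exact serreE_comul D hij (h.K_K i j) (h.K_E i i) (h.K_E i j) (h.K_E j i) (h.serre i j hij)

/-- The comultiplication of the Borel algebra. -/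
def comulP (D : Datum I) : P D →ₐ[Kvt] P D ⊗[Kvt] P D := liftP D _ (comulPGen_isPRep D)

theorem comulP_pg (D : Datum I) (x : PGen I) : comulP D (pg D x) = comulPGen D x :=
  liftP_pg _ _ _ _

/-- The counit of the Borel algebra on generators. -/
def counitPGen : PGen I → Kvt
  | .E _ => 0
  | _ => 1

theorem counitPGen_isPRep (D : Datum I) : IsPRep D (counitPGen (I := I)) := by
  constructor <;> intros <;> simp [counitPGen, Datum.serre_zero]

/-- The counit of the Borel algebra. -/
def counitP (D : Datum I) : P D →ₐ[Kvt] Kvt := liftP D _ (counitPGen_isPRep D)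

theorem counitP_pg (D : Datum I) (x : PGen I) : counitP D (pg D x) = counitPGen x :=
  liftP_pg _ _ _ _

/-- The action of the opposite Borel algebra through the pairing, on generators. -/
def actGen (D : Datum I) : PGen I → Module.End Kvt (P D)
  | .E i => gam D 0 i
  | .K i => toEnd (kap D i)
  | .Kinv i => toEnd (kapInv D i)

theorem actGen_isPRep (D : Datum I) : IsPRep D.transpose (actGen D) := by
  constructor
  · intro i
    simp only [actGen, kap, kapInv]
    rw [toEnd_comp, scale_scale]
    exact scale_eq_one D _ (fun j => by simp) (fun j => by simp [D.chi_ne])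
  · intro i
    simp only [actGen, kap, kapInv]
    rw [toEnd_comp, scale_scale]
    exact scale_eq_one D _ (fun j => by simp) (fun j => by simp [D.chi_ne])
  · intro i j; exact scale_comm D _ _
  · intro i j; rw [D.chi_transpose]; exact gam_kap D i j
  · intro i j hij; exact gam_serre D 0 hij

/-- The action of the opposite Borel algebra through the pairing. -/
def actP (D : Datum I) : P D.transpose →ₐ[Kvt] Module.End Kvt (P D) := liftP _ _ (actGen_isPRep D)

theorem actP_pg (D : Datum I) (x : PGen I) : actP D (pg D.transpose x) = actGen D x :=
  liftP_pg _ _ _ _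

theorem xop_zero (D : Datum I) (i : I) (a : P D) :
    xop D 0 i a = D.cc i • (pg D (.K i) * a) := by simp [xop, LP_apply]

theorem gam_prod (D : Datum I) (i : I) (a b : P D) :
    gam D 0 i (a * b) = gam D 0 i a * b + kap D i a * gam D 0 i b := by
  let f : P D →ₗ[Kvt] P D := (gam D 0 i).comp (LinearMap.mulRight Kvt b)
  let g : P D →ₗ[Kvt] P D := (LinearMap.mulRight Kvt b).comp (gam D 0 i) +
    (LinearMap.mulRight Kvt (gam D 0 i b)).comp (kap D i).toLinearMap
  have : f = g := by
    apply P.lin_ext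
    · simp [f, g, gam_one]
    · intro x a ha
      simp only [f, g, LinearMap.comp_apply, LinearMap.mulRight_apply, LinearMap.add_apply,
        AlgHom.toLinearMap_apply] at ha ⊢
      rw [map_mul (kap D i), kap, scale_pg, ← kap, mul_assoc]
      cases x with
      | E j =>
        by_cases hj : j = i
        · subst hj
          rw [gam_E_same, gam_E_same, ha, scaleGen, xop_zero, xop_zero]
          simp only [mul_add, add_mul, mul_assoc, one_smul, smul_mul_assoc]
          abel
        · rw [gam_E_ne _ _ hj, gam_E_ne _ _ hj, ha, scaleGen]
          simp only [mul_add, mul_assoc, one_smul]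
      | K j =>
        rw [gam_K, gam_K, ha, scaleGen]
        simp only [mul_add, mul_assoc, smul_mul_assoc, smul_add]
      | Kinv j =>
        rw [gam_Kinv, gam_Kinv, ha, scaleGen]
        simp only [mul_add, mul_assoc, smul_mul_assoc, smul_add]
  exact LinearMap.congr_fun this a

/-- The diagonal action on the tensor square. -/
def actP2 (D : Datum I) : P D.transpose →ₐ[Kvt] Module.End Kvt (P D ⊗[Kvt] P D) :=
  (Module.endTensorEndAlgHom (R := Kvt) (S := Kvt) (A := Kvt)).comp
    ((Algebra.TensorProduct.map (actP D) (actP D)).comp (comulP D.transpose))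

theorem actP2_pg (D : Datum I) (x : PGen I) (a b : P D) :
    LinearMap.mul' Kvt (P D) (actP2 D (pg D.transpose x) (a ⊗ₜ b)) = actGen D x (a * b) := by
  simp only [actP2, AlgHom.comp_apply, comulP_pg]
  cases x with
  | E i =>
    simp [comulPGen, actP_pg, actGen, Module.endTensorEndAlgHom_apply, gam_prod]
  | K i => simp [comulPGen, actP_pg, actGen, Module.endTensorEndAlgHom_apply]
  | Kinv i => simp [comulPGen, actP_pg, actGen, Module.endTensorEndAlgHom_apply]

theorem act_mul (D : Datum I) (b : P D.transpose) :
    (LinearMap.mul' Kvt (P D)).comp (actP2 D b) = (actP D b).comp (LinearMap.mul' Kvt (P D)) := by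
  let f : P D.transpose →ₗ[Kvt] (P D ⊗[Kvt] P D →ₗ[Kvt] P D) :=
    (LinearMap.llcomp Kvt _ _ _ (LinearMap.mul' Kvt (P D))).comp (actP2 D).toLinearMap
  let g : P D.transpose →ₗ[Kvt] (P D ⊗[Kvt] P D →ₗ[Kvt] P D) :=
    ((LinearMap.llcomp Kvt _ _ _).flip (LinearMap.mul' Kvt (P D))).comp (actP D).toLinearMap
  have : f = g := by
    apply P.lin_ext
    · ext; simp [f, g]
    · intro x b hb
      ext a a'
      have h1 : ∀ z, LinearMap.mul' Kvt (P D) (actP2 D (pg D.transpose x) z)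
          = actGen D x (LinearMap.mul' Kvt (P D) z) := by
        intro z
        induction z using TensorProduct.induction_on with
        | zero => simp
        | tmul a b => rw [actP2_pg]; simp
        | add a b ha hb => simp only [map_add, ha, hb]
      have h2 := LinearMap.congr_fun hb (a ⊗ₜ a')
      simp only [f, g, LinearMap.comp_apply, LinearMap.llcomp_apply, AlgHom.toLinearMap_apply,
        LinearMap.flip_apply] at h2
      simp only [f, g, TensorProduct.AlgebraTensorModule.curry_apply, TensorProduct.curry_apply,
        LinearMap.restrictScalars_self, LinearMap.comp_apply, LinearMap.llcomp_apply,
        AlgHom.toLinearMap_apply, LinearMap.flip_apply, map_mul, Module.End.mul_apply, h1, h2, actP_pg]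
  exact LinearMap.congr_fun this b

theorem act_comul (D : Datum I) (b : P D.transpose) :
    (comulP D).toLinearMap.comp (actP D b)
      = (TensorProduct.map LinearMap.id (actP D b)).comp (comulP D).toLinearMap := by
  have hscale : ∀ (c : I → Kvt) (hc : ∀ j, c j ≠ 0) (a : P D),
      comulP D (scale D (fun _ => 1) c hc a)
        = Algebra.TensorProduct.map (AlgHom.id Kvt (P D)) (scale D (fun _ => 1) c hc)
          (comulP D a) := by
    intro c hc a
    have : (comulP D).comp (scale D (fun _ => 1) c hc) = (Algebra.TensorProduct.map
        (AlgHom.id Kvt (P D)) (scale D (fun _ => 1) c hc)).comp (comulP D) := by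
      apply P.hom_ext
      intro x
      rw [AlgHom.comp_apply, AlgHom.comp_apply, comulP_pg, scale_pg]
      cases x <;> simp [scaleGen, comulPGen, comulP_pg, scale_pg]
    exact DFunLike.congr_fun this a
  have hgam : ∀ i a, comulP D (gam D 0 i a)
      = TensorProduct.map LinearMap.id (gam D 0 i) (comulP D a) := by
    intro i a
    have hz1 : ∀ (p : P D) z, TensorProduct.map LinearMap.id (gam D 0 i) (p ⊗ₜ 1 * z)
        = p ⊗ₜ[Kvt] (1 : P D) * TensorProduct.map LinearMap.id (gam D 0 i) z := by
      intro p z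
      induction z using TensorProduct.induction_on with
      | zero => simp
      | tmul a b => simp
      | add a b ha hb => simp only [mul_add, map_add, ha, hb]
    have hz2 : ∀ (p : P D) (j) z, TensorProduct.map LinearMap.id (gam D 0 i)
        (p ⊗ₜ pg D (.K j) * z) = D.chi j i • (p ⊗ₜ[Kvt] pg D (.K j) *
          TensorProduct.map LinearMap.id (gam D 0 i) z) := by
      intro p j z
      induction z using TensorProduct.induction_on with
      | zero => simp
      | tmul a b => simp [gam_K]
      | add a b ha hb => simp only [mul_add, map_add, ha, hb, smul_add]
    have hz3 : ∀ (p : P D) (j) z, TensorProduct.map LinearMap.id (gam D 0 i)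
        (p ⊗ₜ pg D (.Kinv j) * z) = (D.chi j i)⁻¹ • (p ⊗ₜ[Kvt] pg D (.Kinv j) *
          TensorProduct.map LinearMap.id (gam D 0 i) z) := by
      intro p j z
      induction z using TensorProduct.induction_on with
      | zero => simp
      | tmul a b => simp [gam_Kinv]
      | add a b ha hb => simp only [mul_add, map_add, ha, hb, smul_add]
    have hz4 : ∀ (p : P D) (j) (_ : j ≠ i) z, TensorProduct.map LinearMap.id (gam D 0 i)
        (p ⊗ₜ pg D (.E j) * z) = (p ⊗ₜ[Kvt] pg D (.E j) *
          TensorProduct.map LinearMap.id (gam D 0 i) z) := by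
      intro p j hj z
      induction z using TensorProduct.induction_on with
      | zero => simp
      | tmul a b => simp [gam_E_ne _ _ hj]
      | add a b ha hb => simp only [mul_add, map_add, ha, hb]
    have hz5 : ∀ (p : P D) z, TensorProduct.map LinearMap.id (gam D 0 i)
        (p ⊗ₜ pg D (.E i) * z) = p ⊗ₜ[Kvt] pg D (.E i) *
          TensorProduct.map LinearMap.id (gam D 0 i) z
            + D.cc i • (p ⊗ₜ pg D (.K i) * z) := by
      intro p z
      induction z using TensorProduct.induction_on with
      | zero => simp
      | tmul a b => simp [gam_E_same, xop_zero, TensorProduct.tmul_add]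
      | add a b ha hb => simp only [mul_add, map_add, ha, hb, smul_add]; abel
    have : (comulP D).toLinearMap.comp (gam D 0 i)
        = (TensorProduct.map LinearMap.id (gam D 0 i)).comp (comulP D).toLinearMap := by
      apply P.lin_ext
      · simp [gam_one, Algebra.TensorProduct.one_def]
      · intro x a ha
        simp only [LinearMap.comp_apply, AlgHom.toLinearMap_apply] at ha ⊢
        rw [map_mul (comulP D), comulP_pg]
        cases x with
        | E j =>
          by_cases hj : j = i
          · subst hj
            rw [gam_E_same, map_add, map_mul, ha, comulP_pg, xop_zero, comulPGen, add_mul, add_mul,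
              map_add, hz1, hz5, map_smul, map_mul, comulP_pg, comulPGen, add_assoc]
          · rw [gam_E_ne _ _ hj, map_mul, ha, comulP_pg, comulPGen, add_mul, add_mul,
              map_add, hz1, hz4 _ _ hj]
        | K j => rw [gam_K, map_smul, map_mul, ha, comulP_pg, comulPGen, hz2]
        | Kinv j => rw [gam_Kinv, map_smul, map_mul, ha, comulP_pg, comulPGen, hz3]
    exact LinearMap.congr_fun this a
  let f : P D.transpose →ₗ[Kvt] (P D →ₗ[Kvt] P D ⊗[Kvt] P D) :=
    (LinearMap.llcomp Kvt _ _ _ (comulP D).toLinearMap).comp (actP D).toLinearMap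
  let g : P D.transpose →ₗ[Kvt] (P D →ₗ[Kvt] P D ⊗[Kvt] P D) :=
    ((LinearMap.llcomp Kvt _ _ _).flip (comulP D).toLinearMap).comp
      ((TensorProduct.mapBilinear (RingHom.id Kvt) _ _ _ _ LinearMap.id).comp (actP D).toLinearMap)
  have : f = g := by
    apply P.lin_ext
    · ext a
      simp only [f, g, LinearMap.comp_apply, LinearMap.llcomp_apply, AlgHom.toLinearMap_apply,
        LinearMap.flip_apply, TensorProduct.mapBilinear_apply, map_one]
      have : TensorProduct.map (LinearMap.id (R := Kvt) (M := P D)) (1 : Module.End Kvt (P D))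
          = LinearMap.id := TensorProduct.map_id
      rw [this]; rfl
    · intro x b hb
      have h1 : ∀ a, comulP D (actGen D x a)
          = TensorProduct.map LinearMap.id (actGen D x) (comulP D a) := by
        intro a
        cases x with
        | E i => exact hgam i a
        | K i => exact hscale _ _ a
        | Kinv i => exact hscale _ _ a
      ext a
      have h2 := LinearMap.congr_fun hb a
      simp only [f, g, LinearMap.comp_apply, LinearMap.llcomp_apply, AlgHom.toLinearMap_apply,
        LinearMap.flip_apply, TensorProduct.mapBilinear_apply] at h2 ⊢
      rw [map_mul, actP_pg, Module.End.mul_apply, h1, h2, ← LinearMap.comp_apply,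
        ← TensorProduct.map_comp]
      rfl
  exact LinearMap.congr_fun this b

/-- The pairing of the presented Borel algebras. -/
def pairP (D : Datum I) : P D →ₗ[Kvt] P D.transpose →ₗ[Kvt] Kvt :=
  LinearMap.flip ((LinearMap.llcomp Kvt _ _ _ (counitP D).toLinearMap).comp (actP D).toLinearMap)

theorem pairP_apply (D : Datum I) (a : P D) (b : P D.transpose) :
    pairP D a b = counitP D (actP D b a) := rfl

theorem pairP_mul_left (D : Datum I) (a a' : P D) (b : P D.transpose) :
    pairP D (a * a') b = LinearMap.mul' Kvt Kvt
      (TensorProduct.map (pairP D a) (pairP D a') (comulP D.transpose b)) := by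
  have h := LinearMap.congr_fun (act_mul D b) (a ⊗ₜ a')
  simp only [LinearMap.comp_apply, LinearMap.mul'_apply] at h
  rw [pairP_apply, ← h, actP2]
  simp only [AlgHom.comp_apply]
  generalize comulP D.transpose b = z
  induction z using TensorProduct.induction_on with
  | zero => simp
  | tmul x y => simp [Module.endTensorEndAlgHom_apply, pairP_apply]
  | add x y hx hy => simp only [map_add, LinearMap.add_apply, hx, hy]

theorem counit_comulP (D : Datum I) (a : P D) :
    TensorProduct.lid Kvt (P D) (TensorProduct.map (counitP D).toLinearMap LinearMap.id
      (comulP D a)) = a := by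
  have : ((Algebra.TensorProduct.lid Kvt (P D)).toAlgHom.comp (Algebra.TensorProduct.map
      (counitP D) (AlgHom.id Kvt (P D)))).comp (comulP D) = AlgHom.id Kvt (P D) := by
    apply P.hom_ext
    intro x
    rw [AlgHom.comp_apply, comulP_pg]
    cases x <;> simp [comulPGen, counitP_pg, counitPGen]
  exact DFunLike.congr_fun this a

theorem comul_counitP (D : Datum I) (a : P D) :
    TensorProduct.rid Kvt (P D) (TensorProduct.map LinearMap.id (counitP D).toLinearMap
      (comulP D a)) = a := by
  have : ((Algebra.TensorProduct.rid Kvt Kvt (P D)).toAlgHom.comp (Algebra.TensorProduct.map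
      (AlgHom.id Kvt (P D)) (counitP D))).comp (comulP D) = AlgHom.id Kvt (P D) := by
    apply P.hom_ext
    intro x
    rw [AlgHom.comp_apply, comulP_pg]
    cases x <;> simp [comulPGen, counitP_pg, counitPGen]
  exact DFunLike.congr_fun this a

theorem pairP_mul_right (D : Datum I) (a : P D) (b b' : P D.transpose) :
    pairP D a (b * b') = LinearMap.mul' Kvt Kvt
      (TensorProduct.map ((pairP D).flip b) ((pairP D).flip b') (comulP D a)) := by
  have h := LinearMap.congr_fun (act_comul D b') a
  simp only [LinearMap.comp_apply, AlgHom.toLinearMap_apply] at h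
  rw [pairP_apply, map_mul, Module.End.mul_apply, ← comul_counitP D (actP D b' a), h]
  generalize comulP D a = z
  induction z using TensorProduct.induction_on with
  | zero => simp
  | tmul x y => simp [pairP_apply, mul_comm]
  | add x y hx hy => simp only [map_add, hx, hy]

theorem pairP_one_right (D : Datum I) (a : P D) : pairP D a 1 = counitP D a := by
  simp [pairP_apply]

theorem pairP_one_left (D : Datum I) (b : P D.transpose) : pairP D 1 b = counitP D.transpose b := by
  have : (pairP D 1) = (counitP D.transpose).toLinearMap := by
    have key : ∀ b, actP D b 1 = counitP D.transpose b • 1 := by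
      intro b
      let f : P D.transpose →ₗ[Kvt] P D := (LinearMap.applyₗ (1 : P D)).comp (actP D).toLinearMap
      let g : P D.transpose →ₗ[Kvt] P D :=
        (LinearMap.toSpanSingleton Kvt _ 1).comp (counitP D.transpose).toLinearMap
      have : f = g := by
        apply P.lin_ext
        · simp [f, g]
        · intro x b hb
          simp only [f, g, LinearMap.comp_apply, AlgHom.toLinearMap_apply,
            LinearMap.applyₗ_apply_apply, LinearMap.toSpanSingleton_apply] at hb ⊢
          rw [map_mul, Module.End.mul_apply, hb, map_mul, actP_pg, counitP_pg, map_smul]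
          cases x <;> simp [actGen, counitPGen, gam_one]
      exact LinearMap.congr_fun this b
    ext b
    simp [pairP_apply, key]
  exact LinearMap.congr_fun this b

/-! ### Subalgebras of `U_{v,t}` and the skew-Hopf pairing -/

/-- The subalgebra `U_{≥0}` generated by the `E_i` and `K_i^{±1}`. -/
def Ugeq (D : Datum I) : Subalgebra Kvt (U D) :=
  Algebra.adjoin Kvt (Set.range (fun i => ug D (.E i)) ∪ Set.range (fun i => ug D (.K i)) ∪
    Set.range (fun i => ug D (.Kinv i)))

/-- The subalgebra `U_{≤0}` generated by the `F_i` and `K'_i^{±1}`. -/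
def Uleq (D : Datum I) : Subalgebra Kvt (U D) :=
  Algebra.adjoin Kvt (Set.range (fun i => ug D (.F i)) ∪ Set.range (fun i => ug D (.K' i)) ∪
    Set.range (fun i => ug D (.K'inv i)))

theorem E_mem_Ugeq (D : Datum I) (i : I) : ug D (.E i) ∈ Ugeq D :=
  Algebra.subset_adjoin (Or.inl (Or.inl ⟨i, rfl⟩))

theorem K_mem_Ugeq (D : Datum I) (i : I) : ug D (.K i) ∈ Ugeq D :=
  Algebra.subset_adjoin (Or.inl (Or.inr ⟨i, rfl⟩))

theorem Kinv_mem_Ugeq (D : Datum I) (i : I) : ug D (.Kinv i) ∈ Ugeq D :=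
  Algebra.subset_adjoin (Or.inr ⟨i, rfl⟩)

theorem F_mem_Uleq (D : Datum I) (i : I) : ug D (.F i) ∈ Uleq D :=
  Algebra.subset_adjoin (Or.inl (Or.inl ⟨i, rfl⟩))

theorem K'_mem_Uleq (D : Datum I) (i : I) : ug D (.K' i) ∈ Uleq D :=
  Algebra.subset_adjoin (Or.inl (Or.inr ⟨i, rfl⟩))

theorem K'inv_mem_Uleq (D : Datum I) (i : I) : ug D (.K'inv i) ∈ Uleq D :=
  Algebra.subset_adjoin (Or.inr ⟨i, rfl⟩)

open Classical in
/-- A skew-Hopf pairing between `U_{≥0}` and `U_{≤0}` with the prescribed values on generators: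
`(a, b b') = (Δ(a), b ⊗ b')`, `(a a', b) = (a ⊗ a', Δ^{op}(b))`, `(a, 1) = ε(a)`, `(1, b) = ε(b)`,
`(E_i, F_j) = δ_{ij} (v_i⁻¹ - v_i)⁻¹`, `(K_i, K'_j) = {i, j}`, `(E_i, K'_j) = (K_i, F_j) = 0`. -/
structure IsSkewHopfPairing (D : Datum I) (φ : Ugeq D →ₗ[Kvt] Uleq D →ₗ[Kvt] Kvt) : Prop where
  one_right : ∀ a, φ a 1 = counit D a
  one_left : ∀ b, φ 1 b = counit D b
  mul_right : ∀ a : Ugeq D, ∃ z : Ugeq D ⊗[Kvt] Ugeq D,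
    TensorProduct.map (Ugeq D).val.toLinearMap (Ugeq D).val.toLinearMap z = comul D a ∧
    ∀ b b', φ a (b * b') = LinearMap.mul' Kvt Kvt (TensorProduct.map (φ.flip b) (φ.flip b') z)
  mul_left : ∀ b : Uleq D, ∃ z : Uleq D ⊗[Kvt] Uleq D,
    TensorProduct.map (Uleq D).val.toLinearMap (Uleq D).val.toLinearMap z = comul D b ∧
    ∀ a a', φ (a * a') b = LinearMap.mul' Kvt Kvt (TensorProduct.map (φ a') (φ a) z)
  E_F : ∀ i j, φ ⟨ug D (.E i), E_mem_Ugeq D i⟩ ⟨ug D (.F j), F_mem_Uleq D j⟩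
    = if i = j then ((D.vi i)⁻¹ - D.vi i)⁻¹ else 0
  K_K' : ∀ i j, φ ⟨ug D (.K i), K_mem_Ugeq D i⟩ ⟨ug D (.K' j), K'_mem_Uleq D j⟩ = D.chi i j
  E_K' : ∀ i j, φ ⟨ug D (.E i), E_mem_Ugeq D i⟩ ⟨ug D (.K' j), K'_mem_Uleq D j⟩ = 0
  K_F : ∀ i j, φ ⟨ug D (.K i), K_mem_Ugeq D i⟩ ⟨ug D (.F j), F_mem_Uleq D j⟩ = 0

/-- The skew-Hopf pairing `(,)_φ : U_{≥0} × U_{≤0} → ℚ(v, t)`. -/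
def phi (D : Datum I) : Ugeq D →ₗ[Kvt] Uleq D →ₗ[Kvt] Kvt :=
  (pairP D).compl₁₂ ((retGeq D).comp (Ugeq D).val.toLinearMap)
    ((retLeq D).comp (Uleq D).val.toLinearMap)

theorem inGeq_mem (D : Datum I) (p : P D) : inGeq D p ∈ Ugeq D := by
  refine Pres.induction_left (S := (Subalgebra.toSubmodule (Ugeq D)).comap (inGeq D).toLinearMap)
    ?_ ?_ p
  · simp [one_mem]
  · intro x a ha
    simp only [Submodule.mem_comap, AlgHom.toLinearMap_apply, Subalgebra.mem_toSubmodule,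
      map_mul] at ha ⊢
    refine mul_mem ?_ ha
    have : inGeq D (Pres.of (PRel D) x) = inGeqGen D x := liftP_pg _ _ _ _
    rw [this]
    cases x with
    | E i => exact E_mem_Ugeq D i
    | K i => exact K_mem_Ugeq D i
    | Kinv i => exact Kinv_mem_Ugeq D i

theorem inLeq_mem (D : Datum I) (p : P D.transpose) : inLeq D p ∈ Uleq D := by
  refine Pres.induction_left (S := (Subalgebra.toSubmodule (Uleq D)).comap (inLeq D).toLinearMap)
    ?_ ?_ p
  · simp [one_mem]
  · intro x a ha
    simp only [Submodule.mem_comap, AlgHom.toLinearMap_apply, Subalgebra.mem_toSubmodule,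
      map_mul] at ha ⊢
    refine mul_mem ?_ ha
    have : inLeq D (Pres.of (PRel D.transpose) x) = inLeqGen D x := liftP_pg _ _ _ _
    rw [this]
    cases x with
    | E i => exact F_mem_Uleq D i
    | K i => exact K'_mem_Uleq D i
    | Kinv i => exact K'inv_mem_Uleq D i

/-- The presented Borel algebra maps to `U_{≥0}`. -/
def toGeq (D : Datum I) : P D →ₐ[Kvt] Ugeq D := (inGeq D).codRestrict _ (inGeq_mem D)

/-- The presented Borel algebra maps to `U_{≤0}`. -/
def toLeq (D : Datum I) : P D.transpose →ₐ[Kvt] Uleq D := (inLeq D).codRestrict _ (inLeq_mem D)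

theorem inGeq_pg (D : Datum I) (x : PGen I) : inGeq D (pg D x) = inGeqGen D x := liftP_pg _ _ _ _

theorem inLeq_pg (D : Datum I) (x : PGen I) : inLeq D (pg D.transpose x) = inLeqGen D x :=
  liftP_pg _ _ _ _

theorem toGeq_surjective (D : Datum I) : Function.Surjective (toGeq D) := by
  rintro ⟨a, ha⟩
  have : Ugeq D ≤ (inGeq D).range := by
    apply Algebra.adjoin_le
    rintro x ((⟨i, rfl⟩ | ⟨i, rfl⟩) | ⟨i, rfl⟩)
    · exact ⟨pg D (.E i), inGeq_pg D _⟩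
    · exact ⟨pg D (.K i), inGeq_pg D _⟩
    · exact ⟨pg D (.Kinv i), inGeq_pg D _⟩
  obtain ⟨p, hp⟩ := this ha
  exact ⟨p, Subtype.ext hp⟩

theorem toLeq_surjective (D : Datum I) : Function.Surjective (toLeq D) := by
  rintro ⟨a, ha⟩
  have : Uleq D ≤ (inLeq D).range := by
    apply Algebra.adjoin_le
    rintro x ((⟨i, rfl⟩ | ⟨i, rfl⟩) | ⟨i, rfl⟩)
    · exact ⟨pg D.transpose (.E i), inLeq_pg D _⟩
    · exact ⟨pg D.transpose (.K i), inLeq_pg D _⟩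
    · exact ⟨pg D.transpose (.Kinv i), inLeq_pg D _⟩
  obtain ⟨p, hp⟩ := this ha
  exact ⟨p, Subtype.ext hp⟩

theorem phi_toGeq_toLeq (D : Datum I) (p : P D) (q : P D.transpose) :
    phi D (toGeq D p) (toLeq D q) = pairP D p q := by
  change pairP D (retGeq D (inGeq D p)) (retLeq D (inLeq D q)) = _
  rw [retGeq_inGeq, retLeq_inLeq]

theorem comul_inGeq (D : Datum I) (p : P D) : comul D (inGeq D p)
    = Algebra.TensorProduct.map (inGeq D) (inGeq D) (comulP D p) := by
  have : (comul D).comp (inGeq D)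
      = (Algebra.TensorProduct.map (inGeq D) (inGeq D)).comp (comulP D) := by
    apply P.hom_ext
    intro x
    rw [AlgHom.comp_apply, AlgHom.comp_apply, comulP_pg, inGeq_pg]
    cases x <;> simp [inGeqGen, comulPGen, comul, liftU_ug, comulGen, inGeq_pg]
  exact DFunLike.congr_fun this p

theorem comul_inLeq (D : Datum I) (p : P D.transpose) : comul D (inLeq D p)
    = Algebra.TensorProduct.comm Kvt (U D) (U D)
      (Algebra.TensorProduct.map (inLeq D) (inLeq D) (comulP D.transpose p)) := by
  have : (comul D).comp (inLeq D) = (Algebra.TensorProduct.comm Kvt (U D) (U D)).toAlgHom.comp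
      ((Algebra.TensorProduct.map (inLeq D) (inLeq D)).comp (comulP D.transpose)) := by
    apply P.hom_ext
    intro x
    rw [AlgHom.comp_apply, AlgHom.comp_apply, AlgHom.comp_apply, comulP_pg, inLeq_pg]
    cases x <;> simp [inLeqGen, comulPGen, comul, liftU_ug, comulGen, inLeq_pg]
  exact DFunLike.congr_fun this p

theorem counit_inGeq (D : Datum I) (p : P D) : counit D (inGeq D p) = counitP D p := by
  have : (counit D).comp (inGeq D) = counitP D := by
    apply P.hom_ext
    intro x
    rw [AlgHom.comp_apply, counitP_pg, inGeq_pg]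
    cases x <;> simp [inGeqGen, counitPGen, counit, liftU_ug, counitGen]
  exact DFunLike.congr_fun this p

theorem counit_inLeq (D : Datum I) (p : P D.transpose) :
    counit D (inLeq D p) = counitP D.transpose p := by
  have : (counit D).comp (inLeq D) = counitP D.transpose := by
    apply P.hom_ext
    intro x
    rw [AlgHom.comp_apply, counitP_pg, inLeq_pg]
    cases x <;> simp [inLeqGen, counitPGen, counit, liftU_ug, counitGen]
  exact DFunLike.congr_fun this p

theorem phi_isSkewHopfPairing (D : Datum I) : IsSkewHopfPairing D (phi D) := by
  have hgE : ∀ i, (⟨ug D (.E i), E_mem_Ugeq D i⟩ : Ugeq D) = toGeq D (pg D (.E i)) :=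
    fun i => Subtype.ext (inGeq_pg D (.E i)).symm
  have hgK : ∀ i, (⟨ug D (.K i), K_mem_Ugeq D i⟩ : Ugeq D) = toGeq D (pg D (.K i)) :=
    fun i => Subtype.ext (inGeq_pg D (.K i)).symm
  have hlF : ∀ i, (⟨ug D (.F i), F_mem_Uleq D i⟩ : Uleq D) = toLeq D (pg D.transpose (.E i)) :=
    fun i => Subtype.ext (inLeq_pg D (.E i)).symm
  have hlK : ∀ i, (⟨ug D (.K' i), K'_mem_Uleq D i⟩ : Uleq D) = toLeq D (pg D.transpose (.K i)) :=
    fun i => Subtype.ext (inLeq_pg D (.K i)).symm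
  have act_pg : ∀ (x y : PGen I), pairP D (pg D x) (pg D.transpose y)
      = counitP D (actGen D y (pg D x)) := by
    intro x y; rw [pairP_apply, actP_pg]
  refine ⟨?_, ?_, ?_, ?_, ?_, ?_, ?_, ?_⟩
  · intro a
    obtain ⟨p, rfl⟩ := toGeq_surjective D a
    rw [← map_one (toLeq D), phi_toGeq_toLeq, pairP_one_right]
    exact (counit_inGeq D p).symm
  · intro b
    obtain ⟨q, rfl⟩ := toLeq_surjective D b
    rw [← map_one (toGeq D), phi_toGeq_toLeq, pairP_one_left]
    exact (counit_inLeq D q).symm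
  · intro a
    obtain ⟨p, rfl⟩ := toGeq_surjective D a
    refine ⟨TensorProduct.map (toGeq D).toLinearMap (toGeq D).toLinearMap (comulP D p), ?_, ?_⟩
    · refine Eq.trans ?_ (comul_inGeq D p).symm
      rw [← LinearMap.comp_apply, ← TensorProduct.map_comp]
      rfl
    · intro b b'
      obtain ⟨q, rfl⟩ := toLeq_surjective D b
      obtain ⟨q', rfl⟩ := toLeq_surjective D b'
      rw [← map_mul, phi_toGeq_toLeq, pairP_mul_right]
      generalize comulP D p = z
      induction z using TensorProduct.induction_on with
      | zero => simp
      | tmul x y => simp [phi_toGeq_toLeq]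
      | add x y hx hy => simp only [map_add, hx, hy]
  · intro b
    obtain ⟨q, rfl⟩ := toLeq_surjective D b
    refine ⟨TensorProduct.comm Kvt _ _ (TensorProduct.map (toLeq D).toLinearMap
      (toLeq D).toLinearMap (comulP D.transpose q)), ?_, ?_⟩
    · refine Eq.trans ?_ (comul_inLeq D q).symm
      generalize comulP D.transpose q = z
      induction z using TensorProduct.induction_on with
      | zero => simp
      | tmul x y => simp [toLeq]
      | add x y hx hy => simp only [map_add, hx, hy]
    · intro a a'
      obtain ⟨p, rfl⟩ := toGeq_surjective D a
      obtain ⟨p', rfl⟩ := toGeq_surjective D a'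
      rw [← map_mul, phi_toGeq_toLeq, pairP_mul_left]
      generalize comulP D.transpose q = z
      induction z using TensorProduct.induction_on with
      | zero => simp
      | tmul x y => simp [phi_toGeq_toLeq, mul_comm]
      | add x y hx hy => simp only [map_add, hx, hy]
  · intro i j
    rw [hgE, hlF, phi_toGeq_toLeq, act_pg, actGen]
    by_cases hij : i = j
    · subst hij
      rw [if_pos rfl, ← mul_one (pg D (.E i)), gam_E_same, gam_one, mul_zero, zero_add, xop_zero,
        mul_one, map_smul, counitP_pg, counitPGen]
      · simp [Datum.cc]
      · simp
    · rw [if_neg hij, ← mul_one (pg D (.E i)), gam_E_ne _ _ hij, gam_one, mul_zero, map_zero]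
  · intro i j
    rw [hgK, hlK, phi_toGeq_toLeq, act_pg, actGen]
    simp [kap, scale_pg, scaleGen, counitP_pg, counitPGen]
  · intro i j
    rw [hgE, hlK, phi_toGeq_toLeq, act_pg, actGen]
    simp [kap, scale_pg, scaleGen, counitP_pg, counitPGen]
  · intro i j
    rw [hgK, hlF, phi_toGeq_toLeq, act_pg, actGen, ← mul_one (pg D (.K i)), gam_K, gam_one,
      mul_zero, smul_zero, map_zero]

/-! ### Words, weights and the twisted anti-involution -/

open Classical in
/-- The element `i` of `ℤ[I]`. -/
def eI (i : I) : I → ℤ := fun j => if j = i then 1 else 0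

/-- The weight of a word, as an element of `ℤ[I]`: the number of occurrences of each letter. -/
def wtZ : List I → (I → ℤ)
  | [] => 0
  | i :: w => eI i + wtZ w

/-- The factor `t^{⟨ν, μ⟩ - ⟨μ, ν⟩}` by which `σ` is twisted:
`σ(x y) = t^{⟨|y|, |x|⟩ - ⟨|x|, |y|⟩} σ(y) σ(x)`. -/
def Datum.tw (D : Datum I) (μ ν : I → ℤ) : Kvt := tt ^ (D.ang ν μ - D.ang μ ν)

/-- The factor with `σ(θ_{i_1} ⋯ θ_{i_n}) = twist • θ_{i_n} ⋯ θ_{i_1}`. -/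
def Datum.twist (D : Datum I) : List I → Kvt
  | [] => 1
  | i :: w => D.tw (eI i) (wtZ w) * D.twist w

/-- The monomial `x_{i_1} ⋯ x_{i_n}`. -/
def word {A : Type*} [Ring A] (x : I → A) (w : List I) : A := (w.map x).prod

theorem word_append {A : Type*} [Ring A] (x : I → A) (w w' : List I) :
    word x (w ++ w') = word x w * word x w' := by simp [word]

/-- The free algebra on the generators `θ_i`. -/
abbrev Free (I : Type*) : Type _ := FreeAlgebra Kvt I

/-- The generator `θ_i`. -/
abbrev θ (i : I) : Free I := FreeAlgebra.ι Kvt i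

/-- The twisted anti-involution `σ` of the free algebra, on the basis of monomials. -/
def sigma (D : Datum I) : Free I →ₗ[Kvt] Free I :=
  (FreeAlgebra.basisFreeMonoid Kvt I).constr Kvt
    fun w => D.twist w.toList • word θ w.toList.reverse

theorem basis_word (w : FreeMonoid I) :
    FreeAlgebra.basisFreeMonoid Kvt I w = word θ w.toList := by
  have h : FreeAlgebra.equivMonoidAlgebraFreeMonoid (R := Kvt) (word θ w.toList)
      = MonoidAlgebra.of Kvt (FreeMonoid I) w := by
    induction w using FreeMonoid.inductionOn' with
    | one => rw [map_one (MonoidAlgebra.of Kvt (FreeMonoid I))]; simp [word]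
    | of_mul i w ih =>
      rw [FreeMonoid.toList_mul, word_append, map_mul, ih, map_mul]
      congr 1
      simp [word, FreeAlgebra.equivMonoidAlgebraFreeMonoid]
  rw [← FreeAlgebra.equivMonoidAlgebraFreeMonoid.symm_apply_apply (word θ w.toList), h]
  rfl

theorem sigma_word (D : Datum I) (w : List I) :
    sigma D (word θ w) = D.twist w • word θ w.reverse := by
  have h := basis_word (FreeMonoid.ofList w)
  rw [FreeMonoid.toList_ofList] at h
  rw [← h, sigma, Module.Basis.constr_basis, FreeMonoid.toList_ofList]

theorem ang_add_left (D : Datum I) (μ μ' ν : I → ℤ) :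
    D.ang (μ + μ') ν = D.ang μ ν + D.ang μ' ν := by
  simp [Datum.ang, add_mul, Finset.sum_add_distrib]

theorem ang_add_right (D : Datum I) (μ ν ν' : I → ℤ) :
    D.ang μ (ν + ν') = D.ang μ ν + D.ang μ ν' := by
  simp [Datum.ang, mul_add, add_mul, Finset.sum_add_distrib]

theorem ang_zero_left (D : Datum I) (ν : I → ℤ) : D.ang 0 ν = 0 := by simp [Datum.ang]

theorem ang_zero_right (D : Datum I) (ν : I → ℤ) : D.ang ν 0 = 0 := by simp [Datum.ang]

theorem ang_eI (D : Datum I) (i j : I) : D.ang (eI i) (eI j) = D.Ω i j := by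
  simp only [Datum.ang, eI]
  rw [Finset.sum_eq_single i, Finset.sum_eq_single j]
  · simp
  · intro b _ hb; simp [hb]
  · simp
  · intro b _ hb; simp [hb]
  · simp

theorem Datum.tw_add_left (D : Datum I) (μ μ' ν : I → ℤ) :
    D.tw (μ + μ') ν = D.tw μ ν * D.tw μ' ν := by
  rw [Datum.tw, Datum.tw, Datum.tw, ← zpow_add₀ tt_ne, ang_add_left, ang_add_right]
  congr 1; ring

theorem Datum.tw_add_right (D : Datum I) (μ ν ν' : I → ℤ) :
    D.tw μ (ν + ν') = D.tw μ ν * D.tw μ ν' := by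
  rw [Datum.tw, Datum.tw, Datum.tw, ← zpow_add₀ tt_ne, ang_add_left, ang_add_right]
  congr 1; ring

theorem wtZ_append (w w' : List I) : wtZ (w ++ w') = wtZ w + wtZ w' := by
  induction w with
  | nil => simp [wtZ]
  | cons i w ih => simp [wtZ, ih, add_assoc]

theorem Datum.twist_append (D : Datum I) (w w' : List I) :
    D.twist (w ++ w') = D.tw (wtZ w) (wtZ w') * D.twist w' * D.twist w := by
  induction w with
  | nil => simp [Datum.twist, wtZ, Datum.tw, ang_zero_left, ang_zero_right]
  | cons i w ih =>
    rw [List.cons_append, Datum.twist, ih, wtZ_append, Datum.twist, wtZ, D.tw_add_left,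
      D.tw_add_right]
    ring

theorem sigma_θ (D : Datum I) (i : I) : sigma D (θ i) = θ i := by
  have := sigma_word D [i]
  simpa [word, Datum.twist, wtZ, Datum.tw, ang_zero_left, ang_zero_right] using this

/-- `σ` is a twisted anti-homomorphism; monomials span, so this characterizes it. -/
theorem sigma_mul_word (D : Datum I) (w w' : List I) :
    sigma D (word θ w * word θ w') = tt ^ (D.ang (wtZ w') (wtZ w) - D.ang (wtZ w) (wtZ w')) •
      (sigma D (word θ w') * sigma D (word θ w)) := by
  rw [← word_append, sigma_word, sigma_word, sigma_word, List.reverse_append, word_append,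
    D.twist_append, smul_mul_smul_comm, smul_smul, Datum.tw, mul_assoc]

/-! ### The anti-involution `σ⁺` of `U⁺` -/

theorem qcomm_tmul_twist {k A B : Type*} [Field k] [Ring A] [Algebra k A] [Ring B] [Algebra k B]
    (q : ℕ → k) (c : k) {x y : A} (hxy : y * x = c • (x * y)) (e g : B) (n : ℕ) :
    qcomm q (x ⊗ₜ[k] e) (y ⊗ₜ[k] g) n = (x ^ n * y) ⊗ₜ[k] qcomm (fun n => c * q n) e g n := by
  induction n with
  | zero => simp [qcomm]
  | succ n ih =>
    have h : x ^ n * y * x = c • (x ^ (n + 1) * y) := by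
      rw [mul_assoc, hxy, mul_smul_comm, ← mul_assoc, ← pow_succ]
    rw [qcomm, qcomm, ih, Algebra.TensorProduct.tmul_mul_tmul, Algebra.TensorProduct.tmul_mul_tmul,
      h, ← mul_assoc, ← pow_succ', TensorProduct.tmul_sub, TensorProduct.tmul_smul,
      ← TensorProduct.smul_tmul', smul_smul, mul_comm c]

theorem Datum.serreE_op (D : Datum I) {A : Type*} [Ring A] [Algebra Kvt A] (i j : I) (e g : A) :
    D.serreE i j (MulOpposite.op e) (MulOpposite.op g) = MulOpposite.op (D.serreF i j e g) := by
  have h : ∀ x : A, MulOpposite.op x = MulOpposite.opLinearEquiv Kvt x := fun _ => rfl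
  rw [Datum.serreE, Datum.serreF, h (∑ x ∈ _, _), map_sum]
  refine Finset.sum_congr rfl fun x _ => ?_
  rw [← h]
  simp only [Datum.divPow, MulOpposite.op_smul, MulOpposite.op_mul, MulOpposite.op_pow, mul_assoc]

/-- The shift operators used to construct `σ⁺`. -/
def shiftE (D : Datum I) (i : I) : Module.End Kvt ((I → ℤ) → Kvt) where
  toFun f μ := D.tw μ (eI i) * f (μ + eI i)
  map_add' f g := by funext μ; simp [mul_add]
  map_smul' c f := by funext μ; simp; ring

/-- The diagonal operators used to construct `σ⁺`. -/
def diagE (c : I → Kvt) : Module.End Kvt ((I → ℤ) → Kvt) where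
  toFun f μ := (∏ l, c l ^ μ l) * f μ
  map_add' f g := by funext μ; simp [mul_add]
  map_smul' c f := by funext μ; simp; ring

/-- The representation used to construct `σ⁺`, on generators. -/
def sgGen (D : Datum I) :
    PGen I → Module.End Kvt ((I → ℤ) → Kvt) ⊗[Kvt] (U D)ᵐᵒᵖ
  | .E i => shiftE D i ⊗ₜ MulOpposite.op (ug D (.E i))
  | .K i => diagE (fun l => (D.chi i l)⁻¹) ⊗ₜ 1
  | .Kinv i => diagE (fun l => D.chi i l) ⊗ₜ 1

theorem diagE_shiftE (D : Datum I) (c : I → Kvt) (hc : ∀ l, c l ≠ 0) (i : I) :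
    diagE c * shiftE D i = (c i)⁻¹ • (shiftE D i * diagE c) := by
  ext f μ
  have : ∏ l, c l ^ (μ + eI i) l = (∏ l, c l ^ μ l) * c i := by
    have h2 : ∏ l, c l ^ (eI i l) = c i := by
      rw [Finset.prod_eq_single i]
      · simp [eI]
      · intro l _ hl; simp [eI, hl]
      · simp
    rw [← h2, ← Finset.prod_mul_distrib]
    exact Finset.prod_congr rfl fun l _ => by rw [Pi.add_apply, zpow_add₀ (hc l)]
  simp only [Module.End.mul_apply, diagE, shiftE, LinearMap.coe_mk, AddHom.coe_mk,
    LinearMap.smul_apply, Pi.smul_apply, smul_eq_mul, this]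
  have := hc i
  field_simp

theorem shiftE_comm (D : Datum I) (i j : I) :
    shiftE D j * shiftE D i = tt ^ (2 * (D.Ω i j - D.Ω j i)) • (shiftE D i * shiftE D j) := by
  ext f μ
  simp only [Module.End.mul_apply, shiftE, LinearMap.coe_mk, AddHom.coe_mk,
    LinearMap.smul_apply, Pi.smul_apply, smul_eq_mul, D.tw_add_left]
  have h1 : D.tw (eI j) (eI i) = tt ^ (2 * (D.Ω i j - D.Ω j i)) * D.tw (eI i) (eI j) := by
    rw [Datum.tw, Datum.tw, ← zpow_add₀ tt_ne, ang_eI, ang_eI]; congr 1; ring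
  rw [h1, add_right_comm μ]
  ring

theorem sgGen_isPRep (D : Datum I) : IsPRep D (sgGen D) := by
  have h := ug_isRep D
  constructor
  · intro i
    have : diagE (fun l => (D.chi i l)⁻¹) * diagE (fun l => D.chi i l) = 1 := by
      ext f μ
      simp only [Module.End.mul_apply, diagE, LinearMap.coe_mk, AddHom.coe_mk,
        Module.End.one_apply, ← mul_assoc, ← Finset.prod_mul_distrib]
      have hz : ∀ l, D.chi i l ^ μ l ≠ 0 := fun l => zpow_ne_zero _ (D.chi_ne i l)
      simp [hz]
    simp [sgGen, this, Algebra.TensorProduct.one_def]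
  · intro i
    have : diagE (fun l => D.chi i l) * diagE (fun l => (D.chi i l)⁻¹) = 1 := by
      ext f μ
      simp only [Module.End.mul_apply, diagE, LinearMap.coe_mk, AddHom.coe_mk,
        Module.End.one_apply, ← mul_assoc, ← Finset.prod_mul_distrib]
      have hz : ∀ l, D.chi i l ^ μ l ≠ 0 := fun l => zpow_ne_zero _ (D.chi_ne i l)
      simp [hz]
    simp [sgGen, this, Algebra.TensorProduct.one_def]
  · intro i j
    simp only [sgGen, Algebra.TensorProduct.tmul_mul_tmul, mul_one]
    congr 1
    ext f μ
    simp only [Module.End.mul_apply, diagE, LinearMap.coe_mk, AddHom.coe_mk]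
    ring
  · intro i j
    simp only [sgGen, Algebra.TensorProduct.tmul_mul_tmul, mul_one, one_mul]
    rw [diagE_shiftE D _ (fun l => inv_ne_zero (D.chi_ne i l)), inv_inv, TensorProduct.smul_tmul']
  · intro i j hij
    have h0 := h.serre_E i j hij
    have h1 : D.transpose.serreE i j (MulOpposite.op (ug D (.E i))) (MulOpposite.op (ug D (.E j)))
        = 0 := by
      rw [Datum.serreE_op, MulOpposite.op_eq_zero_iff, D.transpose.serreF_iff]
      exact h0
    rw [D.transpose.serreE_iff hij, D.serreNum_transpose] at h1
    rw [D.serreE_iff hij, sgGen, sgGen, qcomm_tmul_twist _ _ (shiftE_comm D i j)]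
    have h2 : (fun n => tt ^ (2 * (D.Ω i j - D.Ω j i)) * (D.chi i j * D.chi i i ^ n))
        = fun n => D.transpose.chi i j * D.transpose.chi i i ^ n := by
      funext n
      rw [D.chi_transpose, D.chi_transpose, ← mul_assoc]
      congr 1
      rw [← D.chi_eq2, Datum.chi, mul_left_comm, ← zpow_add₀ tt_ne]
      congr 2; ring
    rw [h2, h1, TensorProduct.tmul_zero]

/-- The representation used to construct `σ⁺`. -/
def sgRep (D : Datum I) : P D →ₐ[Kvt] Module.End Kvt ((I → ℤ) → Kvt) ⊗[Kvt] (U D)ᵐᵒᵖ :=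
  liftP D _ (sgGen_isPRep D)

/-- The evaluation used to construct `σ⁺`. -/
def sgEv (D : Datum I) : Module.End Kvt ((I → ℤ) → Kvt) ⊗[Kvt] (U D)ᵐᵒᵖ →ₗ[Kvt] U D :=
  (TensorProduct.lid Kvt (U D)).toLinearMap.comp
    (TensorProduct.map ((LinearMap.proj 0).comp (LinearMap.applyₗ (fun _ => 1)))
      (MulOpposite.opLinearEquiv Kvt).symm.toLinearMap)

/-- A linear endomorphism of `U` whose restriction to `U⁺` is `σ⁺`. -/
def sigmaU (D : Datum I) : U D →ₗ[Kvt] U D :=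
  (sgEv D).comp ((sgRep D).toLinearMap.comp (retGeq D))

/-- The monomial `E_{i_1} ⋯ E_{i_n}`. -/
abbrev wordE (D : Datum I) (w : List I) : U D := word (fun i => ug D (.E i)) w

/-- The monomial `F_{i_1} ⋯ F_{i_n}`. -/
abbrev wordF (D : Datum I) (w : List I) : U D := word (fun i => ug D (.F i)) w

theorem sigmaU_wordE (D : Datum I) (w : List I) :
    sigmaU D (wordE D w) = D.twist w • wordE D w.reverse := by
  have h1 : wordE D w = inGeq D (word (fun i => pg D (.E i)) w) := by
    induction w with
    | nil => simp [word]
    | cons i w ih =>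
      rw [wordE, ← List.singleton_append, word_append, word_append, map_mul, ← ih]
      congr 1
      simp [word, inGeq_pg, inGeqGen]
  have h2 : ∀ w : List I, sgRep D (word (fun i => pg D (.E i)) w)
      = word (shiftE D) w ⊗ₜ MulOpposite.op (wordE D w.reverse) := by
    intro w
    induction w with
    | nil =>
      simp only [word, List.map_nil, List.prod_nil, List.reverse_nil, MulOpposite.op_one]
      exact (sgRep D).map_one'
    | cons i w ih =>
      rw [← List.singleton_append, word_append, word_append, map_mul, ih, List.reverse_append,
        wordE, wordE, word_append _ w.reverse, MulOpposite.op_mul, ← Algebra.TensorProduct.tmul_mul_tmul]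
      congr 1
      simp [word, sgRep, liftP_pg, sgGen]
  have h3 : ∀ (w : List I) (μ : I → ℤ), word (shiftE D) w (fun _ => 1) μ
      = D.twist w * D.tw μ (wtZ w) := by
    intro w
    induction w with
    | nil => intro μ; simp [word, Datum.twist, wtZ, Datum.tw, ang_zero_left, ang_zero_right]
    | cons i w ih =>
      intro μ
      rw [← List.singleton_append, word_append]
      simp only [word, List.map_cons, List.map_nil, List.prod_cons, List.prod_nil, mul_one,
        Module.End.mul_apply, List.singleton_append]
      simp only [word] at ih
      rw [shiftE, LinearMap.coe_mk, AddHom.coe_mk, ih, Datum.twist, wtZ, D.tw_add_left,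
        D.tw_add_right]
      ring
  rw [sigmaU, LinearMap.comp_apply, LinearMap.comp_apply, h1, retGeq_inGeq,
    AlgHom.toLinearMap_apply, h2, sgEv]
  simp [h3, Datum.tw, ang_zero_left, ang_zero_right]

/-- The subalgebra `U⁺` generated by the `E_i`. -/
def Uplus (D : Datum I) : Subalgebra Kvt (U D) :=
  Algebra.adjoin Kvt (Set.range fun i => ug D (.E i))

/-- The subalgebra `U⁻` generated by the `F_i`. -/
def Uminus (D : Datum I) : Subalgebra Kvt (U D) :=
  Algebra.adjoin Kvt (Set.range fun i => ug D (.F i))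

/-- The subalgebra `U⁰` generated by the `K_i^{±1}` and `K'_i^{±1}`. -/
def Uzero (D : Datum I) : Subalgebra Kvt (U D) :=
  Algebra.adjoin Kvt (Set.range (fun i => ug D (.K i)) ∪ Set.range (fun i => ug D (.Kinv i)) ∪
    Set.range (fun i => ug D (.K' i)) ∪ Set.range (fun i => ug D (.K'inv i)))

/-- The homomorphism `x ↦ x⁺` from the free algebra to `U`, `θ_i ↦ E_i`; its image is `U⁺`. -/
def plus (D : Datum I) : Free I →ₐ[Kvt] U D := FreeAlgebra.lift Kvt fun i => ug D (.E i)

theorem plus_word (D : Datum I) (w : List I) : plus D (word θ w) = wordE D w := by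
  rw [word, map_list_prod, List.map_map, wordE, word]
  congr 2
  funext i
  simp [plus]

theorem plus_range (D : Datum I) : (plus D).range = Uplus D := by
  rw [plus, Uplus, Algebra.adjoin_range_eq_range_freeAlgebra_lift]

theorem sigmaU_plus (D : Datum I) (x : Free I) : sigmaU D (plus D x) = plus D (sigma D x) := by
  have : (sigmaU D).comp (plus D).toLinearMap = (plus D).toLinearMap.comp (sigma D) := by
    apply (FreeAlgebra.basisFreeMonoid Kvt I).ext
    intro w
    rw [basis_word, LinearMap.comp_apply, LinearMap.comp_apply, AlgHom.toLinearMap_apply,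
      AlgHom.toLinearMap_apply, plus_word, sigmaU_wordE, sigma_word, map_smul, plus_word]
  exact LinearMap.congr_fun this x

theorem plus_mem (D : Datum I) (x : Free I) : plus D x ∈ Uplus D := by
  rw [← plus_range]; exact ⟨x, rfl⟩

/-- The anti-involution `σ⁺` of `U⁺`. -/
def sigmaPlus (D : Datum I) : Uplus D →ₗ[Kvt] Uplus D :=
  LinearMap.codRestrict (Subalgebra.toSubmodule (Uplus D))
    ((sigmaU D).comp (Uplus D).val.toLinearMap) <| by
      rintro ⟨x, hx⟩
      rw [← plus_range] at hx
      obtain ⟨y, rfl⟩ := hx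
      change sigmaU D (plus D y) ∈ Uplus D
      rw [sigmaU_plus]
      exact plus_mem D _

/-- The defining property `σ⁺(x⁺) = σ(x)⁺`. -/
theorem sigmaPlus_plus (D : Datum I) (x : Free I) :
    sigmaPlus D ⟨plus D x, plus_mem D x⟩ = ⟨plus D (sigma D x), plus_mem D _⟩ :=
  Subtype.ext (sigmaU_plus D x)

/-! ### Weight spaces and dual bases -/

/-- An element of `ℕ[I]` as an element of `ℤ[I]`. -/
def natZ (ν : I → ℕ) : I → ℤ := fun i => (ν i : ℤ)

/-- `tr ν = ∑ ν_i`. -/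
def tr (ν : I → ℕ) : ℕ := ∑ i, ν i

/-- The weight space `U⁺_ν`, spanned by the monomials `E_{i_1} ⋯ E_{i_n}` of weight `ν`. -/
def UplusWt (D : Datum I) (ν : I → ℕ) : Submodule Kvt (U D) :=
  Submodule.span Kvt {x | ∃ w : List I, wtZ w = natZ ν ∧ x = wordE D w}

/-- The weight space `U⁻_{-ν}`, spanned by the monomials `F_{i_1} ⋯ F_{i_n}` of weight `-ν`. -/
def UminusWt (D : Datum I) (ν : I → ℕ) : Submodule Kvt (U D) :=
  Submodule.span Kvt {x | ∃ w : List I, wtZ w = natZ ν ∧ x = wordF D w}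

theorem word_mem {A : Type*} [Ring A] [Algebra Kvt A] {S : Subalgebra Kvt A} {x : I → A}
    (h : ∀ i, x i ∈ S) (w : List I) : word x w ∈ S := by
  refine list_prod_mem fun y hy => ?_
  obtain ⟨i, _, rfl⟩ := List.mem_map.1 hy
  exact h i

theorem UplusWt_le_Uplus (D : Datum I) {ν : I → ℕ} {x : U D} (hx : x ∈ UplusWt D ν) :
    x ∈ Uplus D := by
  have : UplusWt D ν ≤ Subalgebra.toSubmodule (Uplus D) := by
    refine Submodule.span_le.2 ?_
    rintro x ⟨w, _, rfl⟩
    exact word_mem (S := Uplus D) (fun i => Algebra.subset_adjoin (Set.mem_range_self i)) w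
  exact this hx

theorem UplusWt_le_Ugeq (D : Datum I) {ν : I → ℕ} {x : U D} (hx : x ∈ UplusWt D ν) :
    x ∈ Ugeq D := by
  have : UplusWt D ν ≤ Subalgebra.toSubmodule (Ugeq D) := by
    refine Submodule.span_le.2 ?_
    rintro x ⟨w, _, rfl⟩
    exact word_mem (E_mem_Ugeq D) w
  exact this hx

theorem UminusWt_le_Uleq (D : Datum I) {ν : I → ℕ} {x : U D} (hx : x ∈ UminusWt D ν) :
    x ∈ Uleq D := by
  have : UminusWt D ν ≤ Subalgebra.toSubmodule (Uleq D) := by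
    refine Submodule.span_le.2 ?_
    rintro x ⟨w, _, rfl⟩
    exact word_mem (F_mem_Uleq D) w
  exact this hx

open Classical in
/-- A basis `B_ν = {b}` of `U⁻_{-ν}`, together with the basis `{b^*}` of `U⁺_ν` that is dual to it
under the skew-Hopf pairing. -/
structure DualBases (D : Datum I) (ν : I → ℕ) (β : Type*) where
  /-- the basis `B_ν` of `U⁻_{-ν}` -/
  b : Module.Basis β Kvt (UminusWt D ν)
  /-- the dual basis of `U⁺_ν` -/
  bstar : Module.Basis β Kvt (UplusWt D ν)
  dual : ∀ x y, phi D ⟨bstar x, UplusWt_le_Ugeq D (bstar x).2⟩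
    ⟨b y, UminusWt_le_Uleq D (b y).2⟩ = if x = y then 1 else 0

/-- `Θ_ν = ∑_{b ∈ B_ν} b ⊗ b^*`. -/
def theta {D : Datum I} {ν : I → ℕ} {β : Type*} [Fintype β] (B : DualBases D ν β) :
    U D ⊗[Kvt] U D :=
  ∑ x, (B.b x : U D) ⊗ₜ (B.bstar x : U D)

/-- `v_μ = ∏ v_i^{μ_i}` for `μ ∈ ℤ[I]`. -/
def Datum.vwt (D : Datum I) (μ : I → ℤ) : Kvt := ∏ i, D.vi i ^ μ i

/-- `(-1)^{tr ν} v^{ν·ν/2} v_{-ν} ∑_{b ∈ B_ν} b ⊗ σ⁺(b^*)`. -/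
def thetaSigma {D : Datum I} {ν : I → ℕ} {β : Type*} [Fintype β] (B : DualBases D ν β) :
    U D ⊗[Kvt] U D :=
  ((-1) ^ tr ν * vv ^ (D.dot (natZ ν) (natZ ν) / 2) * D.vwt (-natZ ν)) •
    ∑ x, (B.b x : U D) ⊗ₜ
      ((sigmaPlus D ⟨B.bstar x, UplusWt_le_Uplus D (B.bstar x).2⟩ : Uplus D) : U D)

/-! ### The completion of `U ⊗ U` -/

/-- `U⁺ U⁰ (∑_{tr ν ≥ N} U⁻_{-ν})`. -/
def leftN (D : Datum I) (N : ℕ) : Submodule Kvt (U D) :=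
  Subalgebra.toSubmodule (Uplus D) * Subalgebra.toSubmodule (Uzero D) *
    ⨆ ν : {ν : I → ℕ // N ≤ tr ν}, UminusWt D ν

/-- `U⁻ U⁰ (∑_{tr ν ≥ N} U⁺_ν)`. -/
def rightN (D : Datum I) (N : ℕ) : Submodule Kvt (U D) :=
  Subalgebra.toSubmodule (Uminus D) * Subalgebra.toSubmodule (Uzero D) *
    ⨆ ν : {ν : I → ℕ // N ≤ tr ν}, UplusWt D ν

/-- The subspace `H_N = (U⁺ U⁰ (∑_{tr ν ≥ N} U⁻_{-ν})) ⊗ U + U ⊗ (U⁻ U⁰ (∑_{tr ν ≥ N} U⁺_ν))`. -/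
def HN (D : Datum I) (N : ℕ) : Submodule Kvt (U D ⊗[Kvt] U D) :=
  Submodule.map₂ (TensorProduct.mk Kvt (U D) (U D)) (leftN D N) ⊤ ⊔
    Submodule.map₂ (TensorProduct.mk Kvt (U D) (U D)) ⊤ (rightN D N)

theorem HN_succ_le (D : Datum I) (N : ℕ) : HN D (N + 1) ≤ HN D N := by
  have h : ∀ V : (I → ℕ) → Submodule Kvt (U D),
      (⨆ ν : {ν : I → ℕ // N + 1 ≤ tr ν}, V ν) ≤ ⨆ ν : {ν : I → ℕ // N ≤ tr ν}, V ν := by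
    intro V
    refine iSup_le fun ν => ?_
    exact le_iSup (fun ν : {ν : I → ℕ // N ≤ tr ν} => V ν) ⟨ν.1, by have := ν.2; omega⟩
  exact sup_le_sup (Submodule.map₂_le_map₂ (mul_le_mul' le_rfl (h _)) le_rfl)
    (Submodule.map₂_le_map₂ le_rfl (mul_le_mul' le_rfl (h _)))

/-- The completion `(U ⊗ U)^` with respect to the `H_N`: compatible families of classes. -/
def UUhat (D : Datum I) : Submodule Kvt (∀ N : ℕ, (U D ⊗[Kvt] U D) ⧸ HN D N) where
  carrier := {x | ∀ N, Submodule.factor (HN_succ_le D N) (x (N + 1)) = x N}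
  zero_mem' N := by simp
  add_mem' hx hy N := by simp [hx N, hy N]
  smul_mem' c x hx N := by simp [hx N]

theorem barU_span_le (D : Datum I) {S : Set (U D)} {T : Submodule Kvt (U D)}
    (h : ∀ x ∈ S, barU D x ∈ T) : Submodule.span Kvt S ≤ T.comap (barUₛ D) :=
  Submodule.span_le.2 fun x hx => h x hx

theorem barU_adjoin_le (D : Datum I) {S : Set (U D)} (h : ∀ x ∈ S, barU D x ∈ S) :
    Subalgebra.toSubmodule (Algebra.adjoin Kvt S)
      ≤ (Subalgebra.toSubmodule (Algebra.adjoin Kvt S)).comap (barUₛ D) := by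
  intro x hx
  change barU D x ∈ Algebra.adjoin Kvt S
  refine Algebra.adjoin_induction (p := fun x _ => barU D x ∈ Algebra.adjoin Kvt S)
    ?_ ?_ ?_ ?_ hx
  · intro x hx; exact Algebra.subset_adjoin (h x hx)
  · intro c
    rw [Algebra.algebraMap_eq_smul_one, barU_smul, map_one]
    exact Subalgebra.smul_mem _ (one_mem _) _
  · intro x y _ _ hx hy; rw [map_add]; exact add_mem hx hy
  · intro x y _ _ hx hy; rw [map_mul]; exact mul_mem hx hy

theorem barU_word (D : Datum I) (x : I → U D) (h : ∀ i, barU D (x i) = x i) (w : List I) :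
    barU D (word x w) = word x w := by
  rw [word, map_list_prod, List.map_map]
  congr 2
  funext i
  exact h i

theorem barU_UplusWt (D : Datum I) (ν : I → ℕ) :
    UplusWt D ν ≤ (UplusWt D ν).comap (barUₛ D) := by
  refine barU_span_le D ?_
  rintro x ⟨w, hw, rfl⟩
  rw [barU_word D _ (fun i => barU_ug D _)]
  exact Submodule.subset_span ⟨w, hw, rfl⟩

theorem barU_UminusWt (D : Datum I) (ν : I → ℕ) :
    UminusWt D ν ≤ (UminusWt D ν).comap (barUₛ D) := by
  refine barU_span_le D ?_
  rintro x ⟨w, hw, rfl⟩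
  rw [barU_word D _ (fun i => barU_ug D _)]
  exact Submodule.subset_span ⟨w, hw, rfl⟩

theorem barU_mul_le (D : Datum I) {S T : Submodule Kvt (U D)} (hS : S ≤ S.comap (barUₛ D))
    (hT : T ≤ T.comap (barUₛ D)) : S * T ≤ (S * T).comap (barUₛ D) := by
  refine Submodule.mul_le.2 fun x hx y hy => ?_
  change barU D (x * y) ∈ S * T
  rw [map_mul]
  exact Submodule.mul_mem_mul (hS hx) (hT hy)

theorem barU_iSup_le (D : Datum I) {κ : Type*} {V : κ → Submodule Kvt (U D)}
    (hV : ∀ k, V k ≤ (V k).comap (barUₛ D)) : (⨆ k, V k) ≤ (⨆ k, V k).comap (barUₛ D) :=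
  iSup_le fun k => (hV k).trans (Submodule.comap_mono (le_iSup V k))

theorem barU_Uzero (D : Datum I) : Subalgebra.toSubmodule (Uzero D)
    ≤ (Subalgebra.toSubmodule (Uzero D)).comap (barUₛ D) := by
  refine barU_adjoin_le D ?_
  rintro x (((⟨i, rfl⟩ | ⟨i, rfl⟩) | ⟨i, rfl⟩) | ⟨i, rfl⟩) <;> simp only [barU_ug, barGen]
  · exact Or.inl (Or.inr ⟨i, rfl⟩)
  · exact Or.inr ⟨i, rfl⟩
  · exact Or.inl (Or.inl (Or.inl ⟨i, rfl⟩))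
  · exact Or.inl (Or.inl (Or.inr ⟨i, rfl⟩))

theorem barUU_HN (D : Datum I) (N : ℕ) : HN D N ≤ (HN D N).comap (barUU D) := by
  have hp : Subalgebra.toSubmodule (Uplus D)
      ≤ (Subalgebra.toSubmodule (Uplus D)).comap (barUₛ D) := by
    refine barU_adjoin_le D ?_
    rintro x ⟨i, rfl⟩; exact ⟨i, (barU_ug D (.E i)).symm⟩
  have hm : Subalgebra.toSubmodule (Uminus D)
      ≤ (Subalgebra.toSubmodule (Uminus D)).comap (barUₛ D) := by
    refine barU_adjoin_le D ?_
    rintro x ⟨i, rfl⟩; exact ⟨i, (barU_ug D (.F i)).symm⟩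
  have hl : leftN D N ≤ (leftN D N).comap (barUₛ D) :=
    barU_mul_le D (barU_mul_le D hp (barU_Uzero D)) (barU_iSup_le D fun _ => barU_UminusWt D _)
  have hr : rightN D N ≤ (rightN D N).comap (barUₛ D) :=
    barU_mul_le D (barU_mul_le D hm (barU_Uzero D)) (barU_iSup_le D fun _ => barU_UplusWt D _)
  refine sup_le (Submodule.map₂_le.2 fun x hx y _ => ?_) (Submodule.map₂_le.2 fun x _ y hy => ?_)
  · exact Submodule.mem_sup_left (Submodule.apply_mem_map₂ _ (hl hx) Submodule.mem_top)
  · exact Submodule.mem_sup_right (Submodule.apply_mem_map₂ _ Submodule.mem_top (hr hy))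

/-- The bar map of `(U ⊗ U)^` induced by the bar map of `U ⊗ U`. -/
def barHat (D : Datum I) (x : UUhat D) : UUhat D :=
  ⟨fun N => Submodule.mapQ (HN D N) (HN D N) (barUU D) (barUU_HN D N) (x.1 N), by
    intro N
    have hx := x.2 N
    obtain ⟨y, hy⟩ := Submodule.Quotient.mk_surjective _ (x.1 (N + 1))
    change Submodule.factor (HN_succ_le D N) (Submodule.mapQ _ _ _ _ (x.1 (N + 1))) =
      Submodule.mapQ _ _ _ _ (x.1 N)
    rw [← hx, ← hy, Submodule.mapQ_apply, ← Submodule.mkQ_apply, ← Submodule.mkQ_apply,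
      Submodule.factor_mk, Submodule.factor_mk, Submodule.mkQ_apply, Submodule.mkQ_apply,
      Submodule.mapQ_apply]⟩

open Classical in
/-- The finite set of all `ν ∈ ℕ[I]` with `tr ν < N`. -/
def below (N : ℕ) : Finset (I → ℕ) :=
  (Fintype.piFinset fun _ => Finset.range N).filter fun ν => tr ν < N

theorem mem_below (N : ℕ) (ν : I → ℕ) : ν ∈ below N ↔ tr ν < N := by
  classical
  rw [below, Finset.mem_filter, and_iff_right_iff_imp]
  intro h
  rw [Fintype.mem_piFinset]
  intro i
  rw [Finset.mem_range]
  exact lt_of_le_of_lt (Finset.single_le_sum (f := ν) (fun _ _ => Nat.zero_le _)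
    (Finset.mem_univ i)) h

/-- The element `∑_ν x_ν` of the completion, for `x_ν ∈ H_{tr ν}`: its class modulo `H_N` is that
of the finite sum over `tr ν < N`. -/
def hatSum (D : Datum I) (x : (I → ℕ) → U D ⊗[Kvt] U D) (hx : ∀ ν, x ν ∈ HN D (tr ν)) : UUhat D :=
  ⟨fun N => Submodule.Quotient.mk (∑ ν ∈ below N, x ν), by
    classical
    intro N
    change Submodule.Quotient.mk (∑ ν ∈ below (N + 1), x ν) = _
    rw [Submodule.Quotient.eq]
    have hs : below (I := I) N ⊆ below (N + 1) := by
      intro ν; rw [mem_below, mem_below]; omega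
    rw [← Finset.sum_sdiff hs, add_sub_cancel_right]
    refine Submodule.sum_mem _ fun ν hν => ?_
    rw [Finset.mem_sdiff, mem_below, mem_below] at hν
    have : tr ν = N := by omega
    exact this ▸ hx ν⟩

theorem tmul_mem_HN (D : Datum I) {ν : I → ℕ} {x : U D} (hx : x ∈ UminusWt D ν) (y : U D) :
    x ⊗ₜ y ∈ HN D (tr ν) := by
  refine Submodule.mem_sup_left (Submodule.apply_mem_map₂ _ ?_ Submodule.mem_top)
  rw [leftN, ← one_mul x]
  refine Submodule.mul_mem_mul ?_ ?_
  · rw [← one_mul (1 : U D)]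
    exact Submodule.mul_mem_mul (one_mem (Uplus D)) (one_mem (Uzero D))
  · exact Submodule.mem_iSup_of_mem (p := fun ν' : {ν' : I → ℕ // tr ν ≤ tr ν'} => UminusWt D ν')
      ⟨ν, le_rfl⟩ hx

theorem theta_mem_HN {D : Datum I} {ν : I → ℕ} {β : Type*} [Fintype β] (B : DualBases D ν β) :
    theta B ∈ HN D (tr ν) :=
  Submodule.sum_mem _ fun x _ => tmul_mem_HN D (B.b x).2 _

theorem thetaSigma_mem_HN {D : Datum I} {ν : I → ℕ} {β : Type*} [Fintype β]
    (B : DualBases D ν β) : thetaSigma B ∈ HN D (tr ν) :=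
  Submodule.smul_mem _ _ (Submodule.sum_mem _ fun x _ => tmul_mem_HN D (B.b x).2 _)

/-- The quasi-`R`-matrix `Θ = ∑_ν Θ_ν` in the completion. -/
def quasiR {D : Datum I} {β : (I → ℕ) → Type*} [∀ ν, Fintype (β ν)]
    (B : ∀ ν, DualBases D ν (β ν)) : UUhat D :=
  hatSum D (fun ν => theta (B ν)) fun ν => theta_mem_HN (B ν)

end

end TwoParam

/-! $\Theta_\nu$ is the canonical element of the pairing between $\mathbf U^-_{-\nu}$ and $\mathbf
U^+_\nu$, so its bar image is controlled by the behaviour of the pairing under bar conjugation. Put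
$\kappa_\nu=(-1)^{\operatorname{tr}\nu}v^{\nu\cdot\nu/2}v_{-\nu}$. Everything rests on the identity
$(x,y)_\phi=\kappa_\nu\,\overline{(\overline{\sigma^+(x)},\overline y)_\phi}$ for $x\in\mathbf
U^+_\nu$, $y\in\mathbf U^-_{-\nu}$ (`phiU_bar`). Given it, expand each $\overline b$ in $\mathbf
B_\nu$, move the coefficients to the second tensor factor, and recognize the resulting sum there as
the bar image of the expansion of $\overline{\sigma^+(b^*)}$ in the dual basis (`sum_bar_bstar`,
`barUU_theta`).

The identity is linear in $x$ and in $y$, monomials are bar invariant, and $\sigma^+$ reverses a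
monomial up to the power of $t$ called `twist`. It therefore reduces to a statement on words:
$(E_w,F_{w'})$ equals `pairCoeff` of $w$ times the bar conjugate of $(E_{\mathrm{rev}\,w},F_{w'})$
(`pairP_wordP_bar`), where for $w=i_1\cdots i_n$ the coefficient is $(-1)^n\prod_{a<b}\{i_a,i_b\}$.
The proof is by induction on $w'$. Its last letter $F_i$ acts on $E_w$ as a skew derivation: it
deletes the letters $i$ of $w$ one at a time, each with weight $c_i\prod\{i,l\}$ over the letters
$l$ to the right (`pairP_wordP_append`). Since $\overline{\{i,l\}}=\{l,i\}^{-1}$, reversing the word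
and conjugating turns this weight into $-c_i\prod\{l,i\}^{-1}$ over the letters $l$ to the left.
Deleting an occurrence of $i$ also changes the coefficient by minus the product of $\{i,l\}$ over
the right and $\{l,i\}$ over the left, which is exactly the ratio of the two weights
(`removeR_pairCoeff`).

Finally $\sum_{a<b}i_a\cdot i_b=\nu\cdot\nu/2-\sum_a i_a\cdot i_a/2$ gives the $v$-part of
$\kappa_\nu$, and the $t$-part of the coefficient is `twist`, the same scalar that $\sigma^+$
produces (`pairCoeff_eq`). In the completion, both sides modulo $\mathcal H_N$ are finite sums, so
the global statement follows term by term. -/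

namespace TwoParam

open scoped TensorProduct

noncomputable section

variable {I : Type*} [Fintype I]

/-! ### The bar involution of the base field is an involution -/

/-- The square of the bar map fixes the constants $\mathbb Q(t)$ and the variable $v$, hence all
polynomials in $v$, hence their fractions. It makes expressions lying under two bars linear rather
than semilinear. -/
theorem barK_barK (c : Kvt) : barK (barK c) = c := by
  have h : (barRat.comp barRat).comp (algebraMap (Polynomial (RatFunc ℚ)) (RatFunc (RatFunc ℚ)))
      = algebraMap (Polynomial (RatFunc ℚ)) (RatFunc (RatFunc ℚ)) := by
    have hC : ∀ a : RatFunc ℚ, barRat (RatFunc.C a) = RatFunc.C a := by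
      intro a
      have h : barRat (algebraMap (Polynomial (RatFunc ℚ)) _ (Polynomial.C a))
          = Polynomial.aeval (R := RatFunc ℚ) (RatFunc.X⁻¹ : RatFunc (RatFunc ℚ))
            (Polynomial.C a) := RatFunc.liftRingHom_algebraMap _ _ _
      rwa [RatFunc.algebraMap_C, Polynomial.aeval_C] at h
    have hX : barRat RatFunc.X = RatFunc.X⁻¹ := barK_v
    refine Polynomial.ringHom_ext (fun a => ?_) ?_
    · simp [hC]
    · simp [hX]
  have h2 : barRat.comp barRat = RingHom.id _ :=
    -- A ring homomorphism out of the fraction field is determined by its restriction to $\mathbb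
    -- Q(t)[v]$.
    IsLocalization.ringHom_ext (nonZeroDivisors (Polynomial (RatFunc ℚ))) h
  exact RingHom.congr_fun h2 c

/-- Conjugation exchanges $v_i$ and $v_i^{-1}$. This sign, one for each letter, is the origin of
$(-1)^{\operatorname{tr}\nu}$. -/
theorem barK_cc (D : Datum I) (i : I) : barK (D.cc i) = -D.cc i := by
  rw [Datum.cc, map_inv₀, map_sub, map_inv₀, Datum.vi, map_zpow₀, barK_v, inv_zpow, inv_inv,
    ← inv_neg, neg_sub]

/-! ### Removing a letter from a word -/

/-- The product of the `{i, l}` over the letters `l` of a word. -/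
def chiWord (D : Datum I) (i : I) (w : List I) : Kvt := (w.map (D.chi i)).prod

theorem chiWord_cons (D : Datum I) (i j : I) (w : List I) :
    chiWord D i (j :: w) = D.chi i j * chiWord D i w := by simp [chiWord]

theorem chiWord_append_singleton (D : Datum I) (i j : I) (w : List I) :
    chiWord D i (w ++ [j]) = chiWord D i w * D.chi i j := by simp [chiWord]

open Classical in
/-- The sum of `h u` over the words `u` obtained from a word by removing a letter `i`, weighted by
the product of the `{i, l}` over the letters `l` to the right of it. -/
def removeR (D : Datum I) {M : Type*} [AddCommGroup M] [Module Kvt M] (i : I) :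
    (List I → M) → List I → M
  | _, [] => 0
  | h, j :: w => (if j = i then chiWord D i w • h w else 0) + removeR D i (fun u => h (j :: u)) w

open Classical in
/-- The sum of `h u` over the words `u` obtained from a word by removing a letter `i`, weighted by
the product of the `{l, i}⁻¹` over the letters `l` to the left of it. -/
def removeL (D : Datum I) (i : I) : (List I → Kvt) → List I → Kvt
  | _, [] => 0
  | h, j :: w => (if j = i then h w else 0) + (D.chi j i)⁻¹ * removeL D i (fun u => h (j :: u)) w

/-- The weights are scalars, so linear maps pass through the sum. This transports the deletion sum
along left multiplication by $E_j$ in the Borel algebra, and then along the pairing with a fixed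
word, which makes it scalar valued. -/
theorem map_removeR (D : Datum I) {M N : Type*} [AddCommGroup M] [Module Kvt M] [AddCommGroup N]
    [Module Kvt N] (φ : M →ₗ[Kvt] N) (i : I) (h : List I → M) (w : List I) :
    φ (removeR D i h w) = removeR D i (fun u => φ (h u)) w := by
  -- The recursion stores the prefix already read inside the function, replacing `h` by `fun u => h
  -- (j :: u)`; inductions on the word must therefore leave `h` free.
  induction w generalizing h with
  | nil => simp [removeR]
  | cons j w ih => rw [removeR, removeR, map_add, ih]; split_ifs <;> simp

open Classical in
-- The appended letter stands to the right of all others: it multiplies the weight of every earlier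
-- deletion by $\{i,j\}$, while its own deletion has an empty product as weight. This is the
-- recursion seen from the other end, needed because reversal sends a first letter to the last
-- place.
theorem removeR_append_singleton (D : Datum I) {M : Type*} [AddCommGroup M] [Module Kvt M]
    (i j : I) (h : List I → M) (w : List I) :
    removeR D i h (w ++ [j])
      = (if j = i then h w else 0) + D.chi i j • removeR D i (fun u => h (u ++ [j])) w := by
  induction w generalizing h with
  | nil => simp [removeR, chiWord]
  | cons l w ih =>
    rw [List.cons_append, removeR, removeR, ih, chiWord_append_singleton, smul_add]
    split_ifs <;> simp [smul_smul, mul_comm, add_left_comm]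

/-- Reversal exchanges the letters to the right of a deleted letter with those to its left, and
$\overline{\{i,l\}}=\{l,i\}^{-1}$. So the conjugated right weights of the reversed word are the left
weights of the word itself. -/
theorem barK_removeR_reverse (D : Datum I) (i : I) (h : List I → Kvt) (w : List I) :
    barK (removeR D i h w.reverse) = removeL D i (fun u => barK (h u.reverse)) w := by
  induction w generalizing h with
  | nil => simp [removeR, removeL]
  | cons j w ih =>
    rw [List.reverse_cons, removeR_append_singleton, removeL, map_add, smul_eq_mul, map_mul,
      barK_chi, ih]
    split_ifs <;> simp

theorem removeL_smul (D : Datum I) (i : I) (c : Kvt) (h : List I → Kvt) (w : List I) :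
    removeL D i (fun u => c * h u) w = c * removeL D i h w := by
  induction w generalizing h with
  | nil => simp [removeL]
  | cons j w ih => rw [removeL, removeL, ih]; split_ifs <;> ring

/-- Every word `u` in the sum arises from `w` by deleting one letter $i$, so its product of the
$\{j,l\}$ is that of `w` divided by $\{j,i\}$. The factor is the same in all terms and can be taken
out. -/
theorem removeL_chiWord (D : Datum I) (i j : I) (h : List I → Kvt) (w : List I) :
    removeL D i (fun u => chiWord D j u * h u) w
      = (D.chi j i)⁻¹ * chiWord D j w * removeL D i h w := by
  induction w generalizing h with
  | nil => simp [removeL]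
  | cons l w ih =>
    simp only [removeL, chiWord_cons, mul_assoc, removeL_smul, ih]
    split_ifs with hl
    · subst hl
      have := D.chi_ne j l
      field_simp
    · ring

/-- The coefficient `∏_{a < b} {i_a, i_b}` of a word of length `n`, with the sign `(-1) ^ n`. -/
def pairCoeff (D : Datum I) : List I → Kvt
  | [] => 1
  | j :: w => -(chiWord D j w * pairCoeff D w)

/-- If `u` is `w` with one occurrence of $i$ deleted, then the coefficient of `w` is minus that of
`u`, times $\prod\{l,i\}$ over the letters to the left of the occurrence, times $\prod\{i,l\}$ over
those to the right. Hence the right weight times the coefficient of `u` is minus the left weight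
times the coefficient of `w`, and the latter coefficient no longer depends on which occurrence was
deleted. The pair `f`, `g` is linked by a hypothesis so that both can change along the recursion. -/
theorem removeR_pairCoeff (D : Datum I) (i : I) (f g : List I → Kvt)
    (h : ∀ u, f u = pairCoeff D u * g u) (w : List I) :
    removeR D i f w = -(pairCoeff D w * removeL D i g w) := by
  induction w generalizing f g with
  | nil => simp [removeR, removeL]
  | cons j w ih =>
    -- Reading the letter $j$ splits off its factor of the coefficient. That factor depends on `u`,
    -- so it is absorbed into the new `g` before the induction hypothesis is applied.
    have h' : ∀ u, f (j :: u) = pairCoeff D u * (-1 * (chiWord D j u * g (j :: u))) := by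
      intro u; rw [h, pairCoeff]; ring
    -- `removeL_chiWord` restores the factor of $j$ for the full word and leaves $\{j,i\}^{-1}$,
    -- which is the weight that `removeL` attaches to passing $j$.
    rw [removeR, removeL, ih _ _ h', removeL_smul, removeL_chiWord, pairCoeff, h]
    split_ifs with hj
    · subst hj; rw [smul_eq_mul]; ring
    · ring

/-! ### The pairing on words -/

/-- The monomial `E_{i_1} ⋯ E_{i_n}` of the Borel algebra. -/
abbrev wordP (D : Datum I) (w : List I) : P D := word (fun i => pg D (.E i)) w

theorem word_cons {X A : Type*} [Ring A] (x : X → A) (i : X) (w : List X) :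
    word x (i :: w) = x i * word x w := by simp [word]

theorem K_wordP (D : Datum I) (i : I) (w : List I) :
    pg D (.K i) * wordP D w = chiWord D i w • (wordP D w * pg D (.K i)) := by
  induction w with
  | nil => simp [word, chiWord]
  | cons j w ih =>
    rw [wordP, word_cons, ← mul_assoc, (pg_isPRep D).K_E, smul_mul_assoc, mul_assoc, ih,
      mul_smul_comm, smul_smul, mul_assoc, chiWord_cons]

/-- At the parameter value $0$ the skew derivation replaces each letter $E_i$ in turn by $c_iK_i$.
Moving this $K_i$ to the right end of the word past the letters $E_l$ produces the factors $\{i,l\}$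
(`K_wordP`), which are the right weights of `removeR`. -/
theorem gam_wordP (D : Datum I) (i : I) (w : List I) :
    gam D 0 i (wordP D w) = D.cc i • removeR D i (fun u => wordP D u * pg D (.K i)) w := by
  induction w with
  | nil => simp [word, removeR, gam_one]
  | cons j w ih =>
    -- Left multiplication by $E_j$ carries the deletion sum of the tail to the part of the sum for
    -- `j :: w` in which the first letter is kept.
    have hm := map_removeR D (LinearMap.mulLeft Kvt (pg D (.E j))) i
      (fun u => wordP D u * pg D (.K i)) w
    simp only [LinearMap.mulLeft_apply, ← mul_assoc] at hm
    rw [wordP, word_cons, removeR]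
    simp only [wordP, word_cons]
    by_cases hj : j = i
    · subst hj
      rw [gam_E_same, xop_zero, ih, K_wordP, if_pos rfl, mul_smul_comm, hm, smul_add, add_comm]
    · rw [gam_E_ne _ _ hj, ih, if_neg hj, mul_smul_comm, hm, zero_add]

/-- The skew derivations kill $K_i$, so by the product rule `gam_prod` they act only on the left
factor $a$. The right factor $K_i$ survives until the counit sends it to $1$. The second argument
contains no $K'$, whose action would rescale $K_i$. -/
theorem pairP_mul_K (D : Datum I) (a : P D) (i : I) (w : List I) :
    pairP D (a * pg D (.K i)) (wordP D.transpose w) = pairP D a (wordP D.transpose w) := by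
  have hg : ∀ (j : I) (a : P D), gam D 0 j (a * pg D (.K i)) = gam D 0 j a * pg D (.K i) := by
    intro j a
    -- Taking the argument $1$ shows that the derivation vanishes on $K_i$, because it vanishes on
    -- $1$.
    have h := gam_K D 0 j i 1
    rw [mul_one, gam_one, mul_zero, smul_zero] at h
    rw [gam_prod, h, mul_zero, add_zero]
  have ha : ∀ w : List I, actP D (wordP D.transpose w) (a * pg D (.K i))
      = actP D (wordP D.transpose w) a * pg D (.K i) := by
    intro w
    induction w with
    | nil => simp [word]
    | cons j w ih =>
      rw [wordP, word_cons, map_mul (actP D), Module.End.mul_apply, Module.End.mul_apply, ih,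
        actP_pg]
      exact hg j _
  rw [pairP_apply, pairP_apply, ha, map_mul, counitP_pg]
  simp [counitPGen]

/-- The opposite Borel algebra acts on the left, so the last letter of a product acts first.
Appending $F_i$ to $F_{w'}$ thus applies the skew derivation to $E_w$ before $F_{w'}$ acts, and the
factor $K_i$ left behind by `gam_wordP` is invisible to the remaining pairing. -/
theorem pairP_wordP_append (D : Datum I) (w w' : List I) (i : I) :
    pairP D (wordP D w) (wordP D.transpose (w' ++ [i]))
      = D.cc i * removeR D i (fun u => pairP D (wordP D u) (wordP D.transpose w')) w := by
  have h : pairP D (wordP D w) (wordP D.transpose (w' ++ [i]))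
      = pairP D (gam D 0 i (wordP D w)) (wordP D.transpose w') := by
    rw [wordP, wordP, word_append, pairP_apply, map_mul, Module.End.mul_apply, pairP_apply]
    simp only [word, List.map_cons, List.map_nil, List.prod_cons, List.prod_nil, mul_one, actP_pg]
    rfl
  rw [h, gam_wordP, map_smul, LinearMap.smul_apply, smul_eq_mul]
  congr 1
  have hm := map_removeR D ((pairP D).flip (wordP D.transpose w')) i
    (fun u => wordP D u * pg D (.K i)) w
  simp only [LinearMap.flip_apply, pairP_mul_K] at hm
  exact hm

/-- The base case of the induction on the $F$-word. Both counits vanish on a nonempty word, and the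
coefficient of the empty word is $1$. -/
theorem counitP_wordP_reverse (D : Datum I) (w : List I) :
    counitP D (wordP D w) = pairCoeff D w * barK (counitP D (wordP D w.reverse)) := by
  cases w with
  | nil => simp [word, pairCoeff]
  | cons j w =>
    rw [List.reverse_cons, wordP, wordP, word_append, word_cons, map_mul, map_mul]
    simp [word, counitP_pg, counitPGen]

/-- The bar conjugate of the pairing, on monomials. -/
theorem pairP_wordP_bar (D : Datum I) (w w' : List I) :
    pairP D (wordP D w) (wordP D.transpose w')
      = pairCoeff D w * barK (pairP D (wordP D w.reverse) (wordP D.transpose w')) := by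
  -- The recursion for the pairing strips the last letter of the $F$-word and shortens the $E$-word
  -- by one letter at varying places. The induction therefore runs from the right on `w'`, for all
  -- `w` at once; only the $E$-word gets reversed.
  induction w' using List.reverseRecOn generalizing w with
  | nil =>
    have h : wordP D.transpose [] = 1 := by simp [word]
    rw [h, pairP_one_right, pairP_one_right]
    exact counitP_wordP_reverse D w
  | append_singleton w' i ih =>
    -- Both sides are unfolded by one letter. The sign of $\overline{c_i}=-c_i$ on the right meets
    -- the sign produced by `removeR_pairCoeff` on the left, where the induction hypothesis serves
    -- as the link between `f` and `g`.
    rw [pairP_wordP_append, pairP_wordP_append, map_mul, barK_cc, barK_removeR_reverse,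
      removeR_pairCoeff D i _ _ ih]
    ring

/-! ### The coefficient in terms of the weight -/

/-- The integer division is exact, since $\mu\cdot\mu=2\langle\mu,\mu\rangle$. -/
theorem dot_self_half (D : Datum I) (μ : I → ℤ) : D.dot μ μ / 2 = D.ang μ μ := by
  rw [Datum.dot]; omega

/-- The symbol $\{i,l\}$ is multiplicative in its second argument, so the product depends only on
the weight of the word. Its $t$-part is precisely the twist picked up when $\sigma$ moves $\theta_i$
past the word. -/
theorem chiWord_eq (D : Datum I) (i : I) (w : List I) :
    chiWord D i w = vv ^ D.dot (eI i) (wtZ w) * D.tw (eI i) (wtZ w) := by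
  induction w with
  | nil => simp [chiWord, wtZ, Datum.dot, Datum.tw, ang_zero_left, ang_zero_right]
  | cons j w ih =>
    have hd : D.dot (eI i) (eI j + wtZ w) = D.dotI i j + D.dot (eI i) (wtZ w) := by
      simp only [Datum.dot, Datum.dotI, ang_add_left, ang_add_right, ang_eI]; ring
    have ht : D.tw (eI i) (eI j) = tt ^ (D.Ω j i - D.Ω i j) := by rw [Datum.tw, ang_eI, ang_eI]
    rw [chiWord_cons, ih, wtZ, D.tw_add_right, hd, zpow_add₀ vv_ne, Datum.chi, ht]
    ring

theorem vwt_neg_add (D : Datum I) (i : I) (μ : I → ℤ) :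
    D.vwt (-(eI i + μ)) = (vv ^ D.Ω i i)⁻¹ * D.vwt (-μ) := by
  have hv : ∀ l, D.vi l ≠ 0 := fun l => zpow_ne_zero _ vv_ne
  have h : ∏ l, D.vi l ^ (-eI i l) = (vv ^ D.Ω i i)⁻¹ := by
    rw [Finset.prod_eq_single i]
    · simp [eI, D.vi_eq]
    · intro l _ hl; simp [eI, hl]
    · simp
  rw [Datum.vwt, Datum.vwt, ← h, ← Finset.prod_mul_distrib]
  refine Finset.prod_congr rfl fun l _ => ?_
  rw [← zpow_add₀ (hv l), Pi.neg_apply, Pi.neg_apply, Pi.add_apply, neg_add]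

/-- For a word of weight $\nu$, expanding $\langle\nu,\nu\rangle$ letter by letter gives
$\sum_{a<b}i_a\cdot i_b$ plus the diagonal terms $\Omega_{i_ai_a}$. The factor $v_{-\nu}$ removes
the diagonal terms. The powers of $t$ multiply up to `twist`, so apart from it the coefficient
depends only on $\nu$. -/
theorem pairCoeff_eq (D : Datum I) (w : List I) :
    pairCoeff D w = (-1) ^ w.length * vv ^ (D.dot (wtZ w) (wtZ w) / 2) * D.vwt (-wtZ w)
      * D.twist w := by
  induction w with
  | nil => simp [pairCoeff, wtZ, Datum.dot, Datum.twist, Datum.vwt, ang_zero_left]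
  | cons j w ih =>
    -- The diagonal term $\Omega_{jj}$ will cancel against the factor $v_j^{-1}$ supplied by
    -- `vwt_neg_add`; the middle term is the $v$-exponent of the new factor $\prod_l\{j,l\}$.
    have ha : D.ang (eI j + wtZ w) (eI j + wtZ w)
        = D.Ω j j + D.dot (eI j) (wtZ w) + D.ang (wtZ w) (wtZ w) := by
      simp only [Datum.dot, ang_add_left, ang_add_right, ang_eI]; ring
    have hv : vv ^ D.Ω j j ≠ 0 := zpow_ne_zero _ vv_ne
    rw [pairCoeff, ih, chiWord_eq, wtZ, Datum.twist, vwt_neg_add, dot_self_half, dot_self_half, ha,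
      zpow_add₀ vv_ne, zpow_add₀ vv_ne, List.length_cons, pow_succ]
    field_simp

/-! ### Length, trace and weight of words and of their reversals. -/

theorem sum_wtZ (w : List I) : ∑ i, wtZ w i = w.length := by
  induction w with
  | nil => simp [wtZ]
  | cons j w ih =>
    have h : ∑ i, eI j i = 1 := by classical simp [eI, Finset.sum_ite_eq']
    simp only [wtZ, Pi.add_apply, Finset.sum_add_distrib, ih, h, List.length_cons]
    push_cast; ring

theorem length_eq_tr {w : List I} {ν : I → ℕ} (h : wtZ w = natZ ν) : w.length = tr ν := by
  have h1 := sum_wtZ w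
  rw [h] at h1
  simp only [natZ] at h1
  rw [tr]
  exact_mod_cast h1.symm

theorem wtZ_reverse (w : List I) : wtZ w.reverse = wtZ w := by
  induction w with
  | nil => rfl
  | cons j w ih => rw [List.reverse_cons, wtZ_append, ih, wtZ, wtZ, wtZ, add_zero, add_comm]

/-- The coefficient `(-1)^{tr ν} v^{ν·ν/2} v_{-ν}`. -/
def thetaCoeff (D : Datum I) (ν : I → ℕ) : Kvt :=
  (-1) ^ tr ν * vv ^ (D.dot (natZ ν) (natZ ν) / 2) * D.vwt (-natZ ν)

/-! ### The bar conjugate of the pairing on weight spaces -/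

/-- The skew-Hopf pairing, extended to a bilinear form on `U`. -/
def phiU (D : Datum I) : U D →ₗ[Kvt] U D →ₗ[Kvt] Kvt :=
  (pairP D).compl₁₂ (retGeq D) (retLeq D)

theorem inGeq_wordP (D : Datum I) (w : List I) : inGeq D (wordP D w) = wordE D w := by
  induction w with
  | nil => simp [word]
  | cons i w ih => rw [wordP, wordE, word_cons, word_cons, map_mul, ih, inGeq_pg]; rfl

theorem inLeq_wordP (D : Datum I) (w : List I) : inLeq D (wordP D.transpose w) = wordF D w := by
  induction w with
  | nil => simp [word]
  | cons i w ih => rw [wordP, wordF, word_cons, word_cons, map_mul, ih, inLeq_pg]; rfl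

/-- The retractions undo the embeddings of the presented Borel algebras. Having the form on all of
$\mathbf U$ avoids membership proofs in the linear algebra that follows; only its values on $\mathbf
U_{\ge0}\times\mathbf U_{\le0}$ matter. -/
theorem phiU_word (D : Datum I) (w w' : List I) :
    phiU D (wordE D w) (wordF D w') = pairP D (wordP D w) (wordP D.transpose w') := by
  rw [phiU, LinearMap.compl₁₂_apply, ← inGeq_wordP, ← inLeq_wordP, retGeq_inGeq, retLeq_inLeq]

theorem barU_wordE (D : Datum I) (w : List I) : barU D (wordE D w) = wordE D w :=
  barU_word D _ (fun i => barU_ug D (.E i)) w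

theorem barU_wordF (D : Datum I) (w : List I) : barU D (wordF D w) = wordF D w :=
  barU_word D _ (fun i => barU_ug D (.F i)) w

/-- The twist is a power of $t$ alone, and the bar map fixes $t$. -/
theorem barK_twist (D : Datum I) (w : List I) : barK (D.twist w) = D.twist w := by
  induction w with
  | nil => simp [Datum.twist]
  | cons i w ih => rw [Datum.twist, map_mul, ih, Datum.tw, map_zpow₀, barK_t]

/-- A monomial goes to a multiple of its reversal, which has the same weight. -/
theorem sigmaU_mem (D : Datum I) {ν : I → ℕ} {x : U D} (hx : x ∈ UplusWt D ν) :
    sigmaU D x ∈ UplusWt D ν := by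
  have : UplusWt D ν ≤ (UplusWt D ν).comap (sigmaU D) := by
    refine Submodule.span_le.2 ?_
    rintro x ⟨w, hw, rfl⟩
    change sigmaU D (wordE D w) ∈ UplusWt D ν
    rw [sigmaU_wordE]
    exact Submodule.smul_mem _ _ (Submodule.subset_span ⟨_, (wtZ_reverse w).trans hw, rfl⟩)
  exact this hx

/-- By `barK_barK` the elements fixed by the square of the bar map form a linear subspace. It
contains $1$ and is stable under left multiplication by generators, because bar permutes the
generators by an involution; so it is all of $\mathbf U$. -/
theorem barU_barU (D : Datum I) (x : U D) : barU D (barU D x) = x := by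
  let S : Submodule Kvt (U D) :=
    { carrier := {x | barU D (barU D x) = x}
      zero_mem' := by simp
      add_mem' := fun {a b} ha hb => by
        simp only [Set.mem_ofPred_eq, map_add] at ha hb ⊢; rw [ha, hb]
      smul_mem' := fun c a ha => by
        simp only [Set.mem_ofPred_eq, barU_smul, barK_barK] at ha ⊢; rw [ha] }
  refine Pres.induction_left (S := S) ?_ ?_ x
  · change barU D (barU D 1) = 1; simp
  · intro g y hy
    change barU D (barU D (ug D g * y)) = ug D g * y
    change barU D (barU D y) = y at hy
    rw [map_mul, map_mul, hy, barU_ug, barU_ug]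
    cases g <;> rfl

/-- On the right each argument lies under two bars, one in $\mathbf U$ and one on the value, so both
sides are bilinear and words suffice. For words this is `pairP_wordP_bar`: by `pairCoeff_eq` the
coefficient there is `thetaCoeff` times `twist`, and the twist is what $\sigma^+$ contributes when
it reverses the word. -/
theorem phiU_bar (D : Datum I) {ν : I → ℕ} {x y : U D} (hx : x ∈ UplusWt D ν)
    (hy : y ∈ UminusWt D ν) :
    phiU D x y = thetaCoeff D ν * barK (phiU D (barU D (sigmaU D x)) (barU D y)) := by
  induction hx using Submodule.span_induction with
  | zero => simp
  | add a b _ _ ha hb => simp only [map_add, LinearMap.add_apply, ha, hb, mul_add]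
  | smul c a _ ha =>
    simp only [map_smul, LinearMap.smul_apply, barU_smul, smul_eq_mul, map_mul, barK_barK, ha]
    ring
  | mem x hx =>
    obtain ⟨w, hw, rfl⟩ := hx
    induction hy using Submodule.span_induction with
    | zero => simp
    | add a b _ _ ha hb => simp only [map_add, ha, hb, mul_add]
    | smul c a _ ha =>
      simp only [map_smul, barU_smul, smul_eq_mul, map_mul, barK_barK, ha]
      ring
    | mem y hy =>
      obtain ⟨w', hw', rfl⟩ := hy
      -- The twist leaves the form through two conjugations, neither of which affects a power of
      -- $t$.
      rw [sigmaU_wordE, barU_smul, barU_wordE, barU_wordF, barK_twist, map_smul,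
        LinearMap.smul_apply, smul_eq_mul, map_mul, barK_twist, phiU_word, phiU_word,
        pairP_wordP_bar, pairCoeff_eq, hw, length_eq_tr hw, thetaCoeff]
      ring

/-! ### The bar image of `Θ_ν` -/

section

variable {D : Datum I} {ν : I → ℕ} {β : Type*} (B : DualBases D ν β)

open Classical in
-- On the two Borel subalgebras `phiU` and `phi` agree by definition, so duality carries over as it
-- stands.
theorem phiU_dual (x y : β) :
    phiU D (B.bstar x : U D) (B.b y : U D) = if x = y then 1 else 0 := B.dual x y

variable [Fintype β]

/-- Duality identifies the coordinate of `y` at $b$ with $(b^*,y)_\phi$: pair the basis expansion of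
`y` with $b^*$. `plus_expand` is the mirror statement for $\mathbf U^+_\nu$. -/
theorem minus_expand {y : U D} (hy : y ∈ UminusWt D ν) :
    y = ∑ x, phiU D (B.bstar x : U D) y • (B.b x : U D) := by
  classical
  have h := congrArg (Submodule.subtype _) (B.b.sum_repr ⟨y, hy⟩)
  simp only [map_sum, map_smul, Submodule.subtype_apply] at h
  have hc : ∀ x, phiU D (B.bstar x : U D) y = B.b.repr ⟨y, hy⟩ x := by
    intro x
    conv_lhs => rw [← h]
    -- Only the occurrence of `y` inside the form has been expanded, the coordinates being kept as
    -- they are; orthogonality then singles out one term.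
    simp [phiU_dual]
  simp only [hc, h]

theorem plus_expand {z : U D} (hz : z ∈ UplusWt D ν) :
    z = ∑ x, phiU D z (B.b x : U D) • (B.bstar x : U D) := by
  classical
  have h := congrArg (Submodule.subtype _) (B.bstar.sum_repr ⟨z, hz⟩)
  simp only [map_sum, map_smul, Submodule.subtype_apply] at h
  have hc : ∀ x, phiU D z (B.b x : U D) = B.bstar.repr ⟨z, hz⟩ x := by
    intro x
    conv_lhs => rw [← h]
    simp [phiU_dual]
  simp only [hc, h]

theorem thetaSigma_eq :
    thetaSigma B = thetaCoeff D ν • ∑ x, (B.b x : U D) ⊗ₜ[Kvt] sigmaU D (B.bstar x : U D) := rfl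

/-- Expand $\overline{\sigma^+(b_y^*)}$ in the dual basis and apply the bar map. This writes
$\sigma^+(b_y^*)$ as a combination of the $\overline{b_x^*}$ with conjugated coefficients, and
`phiU_bar`, used with $\overline{b_x}$ as second argument, identifies these up to $\kappa_\nu$ with
$(b_y^*,\overline{b_x})_\phi$. -/
theorem sum_bar_bstar (y : β) :
    ∑ x, phiU D (B.bstar y : U D) (barU D (B.b x : U D)) • barU D (B.bstar x : U D)
      = thetaCoeff D ν • sigmaU D (B.bstar y : U D) := by
  have hz : barU D (sigmaU D (B.bstar y : U D)) ∈ UplusWt D ν :=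
    barU_UplusWt D ν (sigmaU_mem D (B.bstar y).2)
  have h := congrArg (barU D) (plus_expand B hz)
  -- The left side becomes $\sigma^+(b_y^*)$ itself, since bar is an involution.
  rw [barU_barU, map_sum] at h
  rw [h, Finset.smul_sum]
  refine Finset.sum_congr rfl fun x _ => ?_
  have hx : barU D (B.b x : U D) ∈ UminusWt D ν := barU_UminusWt D ν (B.b x).2
  rw [barU_smul, smul_smul, phiU_bar D (B.bstar y).2 hx, barU_barU]

/-- The conjugated sum $\sum_x\overline{b_x}\otimes\overline{b_x^*}$ is rewritten with the $b_y$
themselves as first factors; the coefficients of $\overline{b_x}$ in that basis then assemble the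
required second factors. -/
theorem barUU_theta : barUU D (theta B) = thetaSigma B := by
  calc barUU D (theta B)
      = ∑ x, barU D (B.b x : U D) ⊗ₜ[Kvt] barU D (B.bstar x : U D) := by
        rw [theta, map_sum]; rfl
    _ = ∑ x, ∑ y, (B.b y : U D) ⊗ₜ[Kvt]
          (phiU D (B.bstar y : U D) (barU D (B.b x : U D)) • barU D (B.bstar x : U D)) := by
        refine Finset.sum_congr rfl fun x _ => ?_
        have hx : barU D (B.b x : U D) ∈ UminusWt D ν := barU_UminusWt D ν (B.b x).2
        conv_lhs => rw [minus_expand B hx]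
        rw [TensorProduct.sum_tmul]
        -- The coefficients $(b_y^*,\overline{b_x})_\phi$ cross the tensor sign.
        exact Finset.sum_congr rfl fun y _ => TensorProduct.smul_tmul _ _ _
    _ = thetaSigma B := by
        -- After exchanging the sums, each $b_y$ is tensored with exactly the sum over $x$ that
        -- `sum_bar_bstar` evaluates.
        rw [Finset.sum_comm, thetaSigma_eq, Finset.smul_sum]
        refine Finset.sum_congr rfl fun y _ => ?_
        rw [← TensorProduct.tmul_sum, sum_bar_bstar, TensorProduct.tmul_smul]

theorem thetaSigma_mem : thetaSigma B ∈ Submodule.map₂ (TensorProduct.mk Kvt (U D) (U D))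
    (UminusWt D ν) (UplusWt D ν) :=
  Submodule.smul_mem _ _ (Submodule.sum_mem _ fun x _ =>
    Submodule.apply_mem_map₂ _ (B.b x).2 (sigmaU_mem D (B.bstar x).2))

end

/-! ### Passage to the completion. -/

theorem barHat_quasiR {D : Datum I} {β : (I → ℕ) → Type*} [∀ ν, Fintype (β ν)]
    (B : ∀ ν, DualBases D ν (β ν)) :
    barHat D (quasiR B) =
      hatSum D (fun ν => thetaSigma (B ν)) (fun ν => thetaSigma_mem_HN (B ν)) := by
  -- Elements of the completion are compared modulo each $\mathcal H_N$. There the completed bar map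
  -- acts by the bar map on representatives, and both series are represented by their finite partial
  -- sums over $\operatorname{tr}\nu<N$, so additivity reduces the claim to the single $\Theta_\nu$.
  refine Subtype.ext (funext fun N => ?_)
  change Submodule.Quotient.mk (barUU D (∑ ν ∈ below N, theta (B ν))) =
    Submodule.Quotient.mk (∑ ν ∈ below N, thetaSigma (B ν))
  rw [map_sum]
  simp only [barUU_theta]

end

end TwoParam

theorem mainTheorem6 {I : Type*} [Fintype I] (D : TwoParam.Datum I) :
    (∀ (ν : I → ℕ) (β : Type*) [Fintype β] (B : TwoParam.DualBases D ν β),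
      TwoParam.barUU D (TwoParam.theta B) = TwoParam.thetaSigma B ∧
      TwoParam.thetaSigma B ∈ Submodule.map₂
        (TensorProduct.mk TwoParam.Kvt (TwoParam.U D) (TwoParam.U D))
        (TwoParam.UminusWt D ν) (TwoParam.UplusWt D ν)) ∧
    (∀ (β : (I → ℕ) → Type*) [∀ ν, Fintype (β ν)] (B : ∀ ν, TwoParam.DualBases D ν (β ν)),
      TwoParam.barHat D (TwoParam.quasiR B) =
        TwoParam.hatSum D (fun ν => TwoParam.thetaSigma (B ν))
          (fun ν => TwoParam.thetaSigma_mem_HN (B ν))) := by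
  exact ⟨fun _ _ _ B => ⟨TwoParam.barUU_theta B, TwoParam.thetaSigma_mem B⟩,
    fun _ _ B => TwoParam.barHat_quasiR B⟩
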